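/- Let $\Phi$ be a commutative ring with $\tfrac16\in\Phi$ and let $T$ be a strongly nondegenerate Jordan triple system over $\Phi$, with triple product $\{x,y,z\}$ (strongly nondegenerate: $\{x,T,x\}=0$ implies $x=0$). **Triple systems of quotients.** An ideal of $T$ is a submodule $I$ with $\{I,T,T\}+\{T,I,T\}+\{T,T,I\}\subseteq I$; its annihilator is $\mathrm{Ann}_T(I)=\{z\in T:\{z,I,T\}=\{z,T,I\}=\{T,z,I\}=0\}$. A Jordan triple system $W$ containing $T$ as a subsystem is a Jordan triple system of $\mathfrak M$-quotients of $T$ if for each $0\ne q\in W$ there is an ideal $I$ of $T$ with $\mathrm{Ann}_T(I)=0$ such that $\{q,I,T\}$, $\{q,T,I\}$ and $\{I,q,T\}$ are contained in $T$ and are not all zero. A Jordan triple system of $\mathfrak M$-quotients $Q$ of $T$ is *maximal* if every Jordan triple system $W$ of $\mathfrak M$-quotients of $T$ admits a unique homomorphism $W\to Q$ that is the identity on $T$, and this homomorphism is injective. **The Lie algebra.** Let $V(T)=(T,T)$ be the double Jordan pair of $T$, and let $L=\mathrm{TKK}(V(T))=T\oplus\mathrm{IDer}(V(T))\oplus T$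 be its Tits–Kantor–Koecher algebra, graded by $L_1=T$, $L_0=\mathrm{IDer}(V(T))$, $L_{-1}=T$. The Lie algebra $L$ is semiprime; let $Q_m(L)=\varinjlim \mathrm{Der}(I,L)$ be its maximal algebra of quotients, the direct limit, over the essential ideals $I$ of $L$, of the modules of derivations $\delta:I\to L$, with bracket induced by $\delta\mu-\mu\delta$. Let $Q_m(L)_1$ be the set of classes of derivations of degree $1$ defined on graded essential ideals of $L$, and let $\tau$ be the automorphism of $Q_m(L)$ induced by the exchange automorphism $x\oplus(\gamma_+,\gamma_-)\oplus y\mapsto y\oplus(\gamma_-,\gamma_+)\oplus x$ of $L$. **Theorem.** The module $Q_m(L)_1$ with the product $\{p,q,r\}=[[p,\tau(q)],r]$ is a Jordan triple system, and, with $T=L_1$ embedded by $x\mapsto \mathrm{ad}\,x$, it is the maximal Jordan triple system of $\mathfrak M$-quotients of $T$. That is, $$Q_m(T)=\bigl(Q_m(\mathrm{TKK}(V(T)))\bigr)_1 .$$ -/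

import Mathlib

universe u v w x

/-! ### Algebras of quotients of Lie algebras -/

namespace LieQuot

section Basic

variable {Φ L : Type*} [CommRing Φ] [LieRing L] [LieAlgebra Φ L]

/-- An ideal is essential if it meets every nonzero ideal nontrivially. -/
def IsEssential (I : LieIdeal Φ L) : Prop :=
  ∀ J : LieIdeal Φ L, J ≠ ⊥ → I ⊓ J ≠ ⊥

variable (Φ L) in
/-- A Lie algebra is semiprime if `[I, I] ≠ 0` for every nonzero ideal `I`. -/
class Semiprime : Prop where
  lie_self_ne_bot : ∀ I : LieIdeal Φ L, I ≠ ⊥ → ⁅I, I⁆ ≠ ⊥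

theorem IsEssential.top : IsEssential (⊤ : LieIdeal Φ L) := by
  intro J hJ
  rwa [top_inf_eq]

theorem IsEssential.inf {I J : LieIdeal Φ L} (hI : IsEssential I) (hJ : IsEssential J) :
    IsEssential (I ⊓ J) := by
  intro K hK
  rw [inf_assoc]
  exact hI _ (hJ K hK)

theorem IsEssential.lie_self [Semiprime Φ L] {I : LieIdeal Φ L} (hI : IsEssential I) :
    IsEssential ⁅I, I⁆ := by
  intro J hJ h
  refine Semiprime.lie_self_ne_bot (Φ := Φ) (L := L) (I ⊓ J) (hI J hJ) (le_bot_iff.mp ?_)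
  rw [← h]
  exact le_inf (LieSubmodule.mono_lie inf_le_left inf_le_left)
    ((LieSubmodule.mono_lie inf_le_right inf_le_right).trans (LieSubmodule.lie_le_right _ _))

/-- The `Φ`-module `Der(I, L)` of derivations from the ideal `I` into `L`. -/
def PDer (I : LieIdeal Φ L) : Submodule Φ (I →ₗ[Φ] L) where
  carrier := {δ | ∀ x y : I, δ ⁅x, y⁆ = ⁅δ x, (y : L)⁆ + ⁅(x : L), δ y⁆}
  add_mem' := by
    intro a b ha hb x y
    simp only [LinearMap.add_apply, ha x y, hb x y, add_lie, lie_add]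
    abel
  zero_mem' := by
    intro x y
    simp
  smul_mem' := by
    intro c a ha x y
    simp only [LinearMap.smul_apply, ha x y, smul_lie, lie_smul, smul_add]

/-- Restriction of a derivation to a smaller ideal. -/
def PDer.restrict {I J : LieIdeal Φ L} (h : J ≤ I) : PDer I →ₗ[Φ] PDer J where
  toFun δ := ⟨δ.1.comp (LieSubmodule.inclusion h : J →ₗ[Φ] I), fun x y =>
    δ.2 (LieSubmodule.inclusion h x) (LieSubmodule.inclusion h y)⟩
  map_add' _ _ := rfl
  map_smul' _ _ := rfl

theorem PDer.apply_lie {I : LieIdeal Φ L} (δ : PDer I) {x y : L} (hx : x ∈ I) (hy : y ∈ I)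
    (h : ⁅x, y⁆ ∈ I) : δ.1 ⟨⁅x, y⁆, h⟩ = ⁅δ.1 ⟨x, hx⟩, y⁆ + ⁅x, δ.1 ⟨y, hy⟩⁆ :=
  δ.2 ⟨x, hx⟩ ⟨y, hy⟩

theorem PDer.apply_mem {I : LieIdeal Φ L} (δ : PDer I) {x : L} (hx : x ∈ ⁅I, I⁆) (hx' : x ∈ I) :
    δ.1 ⟨x, hx'⟩ ∈ I := by
  have key : (⁅I, I⁆ : LieIdeal Φ L).toSubmodule ≤
      (I.toSubmodule.comap δ.1).map I.toSubmodule.subtype := by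
    rw [LieSubmodule.lieIdeal_oper_eq_linear_span', Submodule.span_le]
    rintro _ ⟨a, ha, b, hb, rfl⟩
    refine ⟨⟨⁅a, b⁆, lie_mem_right Φ L I a b hb⟩, ?_, rfl⟩
    change δ.1 ⟨⁅a, b⁆, _⟩ ∈ I
    rw [PDer.apply_lie δ ha hb]
    exact add_mem (lie_mem_right Φ L I _ _ hb) (lie_mem_left Φ L I _ _ ha)
  obtain ⟨y, hy, rfl⟩ := key hx
  exact hy

theorem lie_self_le (I : LieIdeal Φ L) : ⁅I, I⁆ ≤ I := LieSubmodule.lie_le_right I I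

/-- The composite `δ ∘ μ`, defined on `[I, I]`. -/
def PDer.compSq {I : LieIdeal Φ L} (δ μ : PDer I) : (⁅I, I⁆ : LieIdeal Φ L) →ₗ[Φ] L where
  toFun x := δ.1 ⟨μ.1 ⟨x, lie_self_le I x.2⟩, PDer.apply_mem μ x.2 _⟩
  map_add' x y := by
    rw [← map_add]
    congr 1
    exact Subtype.ext (map_add μ.1 ⟨x, lie_self_le I x.2⟩ ⟨y, lie_self_le I y.2⟩)
  map_smul' c x := by
    rw [RingHom.id_apply, ← map_smul]
    congr 1
    exact Subtype.ext (map_smul μ.1 c ⟨x, lie_self_le I x.2⟩)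

theorem PDer.compSq_apply {I : LieIdeal Φ L} (δ μ : PDer I) (x : L) (hx : x ∈ ⁅I, I⁆) :
    PDer.compSq δ μ ⟨x, hx⟩ = δ.1 ⟨μ.1 ⟨x, lie_self_le I hx⟩, PDer.apply_mem μ hx _⟩ := rfl

theorem PDer.compSq_lie {I : LieIdeal Φ L} (δ μ : PDer I) (x y : (⁅I, I⁆ : LieIdeal Φ L)) :
    PDer.compSq δ μ ⁅x, y⁆ = ⁅PDer.compSq δ μ x, (y : L)⁆ +
      ⁅μ.1 ⟨x, lie_self_le I x.2⟩, δ.1 ⟨y, lie_self_le I y.2⟩⁆ +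
      ⁅δ.1 ⟨x, lie_self_le I x.2⟩, μ.1 ⟨y, lie_self_le I y.2⟩⁆ + ⁅(x : L), PDer.compSq δ μ y⁆ := by
  obtain ⟨x, hx⟩ := x
  obtain ⟨y, hy⟩ := y
  have hxI := lie_self_le I hx
  have hyI := lie_self_le I hy
  have h1 : (⟨μ.1 ⟨⁅x, y⁆, lie_mem_right Φ L I x y hyI⟩,
        PDer.apply_mem μ (lie_mem_right Φ L _ x y hy) _⟩ : I) =
      ⟨⁅μ.1 ⟨x, hxI⟩, y⁆, lie_mem_right Φ L I _ _ hyI⟩ +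
      ⟨⁅x, μ.1 ⟨y, hyI⟩⁆, lie_mem_left Φ L I _ _ hxI⟩ :=
    Subtype.ext (PDer.apply_lie μ hxI hyI _)
  change δ.1 ⟨μ.1 ⟨⁅x, y⁆, _⟩, _⟩ = _
  rw [h1, map_add, PDer.apply_lie δ (PDer.apply_mem μ hx hxI) hyI, PDer.apply_lie δ hxI (PDer.apply_mem μ hy hyI)]
  simp only [PDer.compSq_apply]
  abel

/-- The bracket `δ ∘ μ - μ ∘ δ` of two derivations defined on `I`; it is defined on `[I, I]`. -/
def PDer.bracket {I : LieIdeal Φ L} (δ μ : PDer I) : PDer ⁅I, I⁆ :=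
  ⟨PDer.compSq δ μ - PDer.compSq μ δ, fun x y => by
    simp only [LinearMap.sub_apply, PDer.compSq_lie, sub_lie, lie_sub]
    abel⟩

theorem PDer.bracket_apply {I : LieIdeal Φ L} (δ μ : PDer I) (x : L) (hx : x ∈ ⁅I, I⁆) :
    (PDer.bracket δ μ).1 ⟨x, hx⟩ = δ.1 ⟨μ.1 ⟨x, lie_self_le I hx⟩, PDer.apply_mem μ hx _⟩ -
      μ.1 ⟨δ.1 ⟨x, lie_self_le I hx⟩, PDer.apply_mem δ hx _⟩ := rfl

theorem PDer.restrict_apply {I J : LieIdeal Φ L} (h : J ≤ I) (δ : PDer I) (x : L) (hx : x ∈ J) :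
    (PDer.restrict h δ).1 ⟨x, hx⟩ = δ.1 ⟨x, h hx⟩ := rfl

theorem PDer.ext' {I : LieIdeal Φ L} {δ μ : PDer I}
    (h : ∀ (x : L) (hx : x ∈ I), δ.1 ⟨x, hx⟩ = μ.1 ⟨x, hx⟩) : δ = μ :=
  Subtype.ext (LinearMap.ext fun x => h x.1 x.2)

variable (Φ L) in
/-- The essential ideals of `L`, ordered by reverse inclusion. -/
abbrev EssIdeal : Type _ := {I : LieIdeal Φ L // IsEssential I}ᵒᵈ

instance : Nonempty (EssIdeal Φ L) := ⟨OrderDual.toDual ⟨⊤, IsEssential.top⟩⟩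

instance : IsDirectedOrder (EssIdeal Φ L) :=
  ⟨fun I J => ⟨OrderDual.toDual ⟨_, (OrderDual.ofDual I).2.inf (OrderDual.ofDual J).2⟩,
    inf_le_left (a := (OrderDual.ofDual I).1), inf_le_right (b := (OrderDual.ofDual J).1)⟩⟩

/-- `Der(I, L)` as a system indexed by the essential ideals. -/
abbrev derSystem (I : EssIdeal Φ L) : Type _ := PDer (OrderDual.ofDual I).1

/-- The transition maps of the system: restriction. -/
abbrev derSystemMap (I J : EssIdeal Φ L) (h : I ≤ J) : derSystem I →ₗ[Φ] derSystem J :=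
  PDer.restrict (I := (OrderDual.ofDual I).1) (J := (OrderDual.ofDual J).1) h

instance : DirectedSystem (derSystem (Φ := Φ) (L := L)) (derSystemMap · · ·) where
  map_self _ _ := rfl
  map_map _ _ _ _ _ _ := rfl

variable (Φ L) in
/-- The maximal algebra of quotients `Q_m(L) = lim Der(I, L)`, the direct limit over the essential
ideals `I` of `L`. -/
def Qm : Type _ :=
  DirectLimit (derSystem (Φ := Φ) (L := L)) (derSystemMap (Φ := Φ) (L := L))

noncomputable instance : AddCommGroup (Qm Φ L) :=
  inferInstanceAs (AddCommGroup
    (DirectLimit (derSystem (Φ := Φ) (L := L)) (derSystemMap (Φ := Φ) (L := L))))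

noncomputable instance : Module Φ (Qm Φ L) :=
  inferInstanceAs (Module Φ
    (DirectLimit (derSystem (Φ := Φ) (L := L)) (derSystemMap (Φ := Φ) (L := L))))

/-- The class in `Q_m(L)` of a derivation `δ : I → L` defined on an essential ideal `I`. -/
def Qm.mk {I : LieIdeal Φ L} (hI : IsEssential I) (δ : PDer I) : Qm Φ L :=
  Quotient.mk (DirectLimit.setoid (derSystemMap (Φ := Φ) (L := L)))
    ⟨OrderDual.toDual ⟨I, hI⟩, δ⟩

theorem Qm.sound {I J K : LieIdeal Φ L} (hI : IsEssential I) (hJ : IsEssential J)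
    (hK : IsEssential K) (hKI : K ≤ I) (hKJ : K ≤ J) (δ : PDer I) (μ : PDer J)
    (h : ∀ (x : L) (hx : x ∈ K), δ.1 ⟨x, hKI hx⟩ = μ.1 ⟨x, hKJ hx⟩) :
    Qm.mk hI δ = Qm.mk hJ μ :=
  Quotient.sound ⟨OrderDual.toDual ⟨K, hK⟩, hKI, hKJ, PDer.ext' fun x hx => h x hx⟩

theorem Qm.mk_restrict {I J : LieIdeal Φ L} (hI : IsEssential I) (hJ : IsEssential J)
    (h : J ≤ I) (δ : PDer I) : Qm.mk hJ (PDer.restrict h δ) = Qm.mk hI δ :=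
  Qm.sound hJ hI hJ le_rfl h _ _ fun _ _ => rfl

theorem Qm.mk_add {I : LieIdeal Φ L} (hI : IsEssential I) (δ μ : PDer I) :
    Qm.mk hI (δ + μ) = Qm.mk hI δ + Qm.mk hI μ :=
  (DirectLimit.add_def (G := derSystem (Φ := Φ) (L := L)) (f := derSystemMap (Φ := Φ) (L := L))
    (OrderDual.toDual ⟨I, hI⟩) δ μ).symm

theorem Qm.mk_zero {I : LieIdeal Φ L} (hI : IsEssential I) : Qm.mk hI 0 = 0 :=
  (DirectLimit.zero_def (G := derSystem (Φ := Φ) (L := L)) (f := derSystemMap (Φ := Φ) (L := L)) (OrderDual.toDual ⟨I, hI⟩)).symm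

theorem Qm.mk_smul {I : LieIdeal Φ L} (hI : IsEssential I) (c : Φ) (δ : PDer I) :
    Qm.mk hI (c • δ) = c • Qm.mk hI δ := rfl

theorem Qm.ind₃ {P : Qm Φ L → Qm Φ L → Qm Φ L → Prop}
    (h : ∀ (I : LieIdeal Φ L) (hI : IsEssential I) (a b c : PDer I),
      P (Qm.mk hI a) (Qm.mk hI b) (Qm.mk hI c)) (p q r : Qm Φ L) : P p q r :=
  DirectLimit.induction₃ (derSystemMap (Φ := Φ) (L := L))
    (C := fun p q r : Qm Φ L => P p q r)
    (fun i x y z => h (OrderDual.ofDual i).1 (OrderDual.ofDual i).2 x y z) p q r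

theorem PDer.restrict_bracket {I J : LieIdeal Φ L} (h : J ≤ I) (δ μ : PDer I) :
    PDer.restrict (LieSubmodule.mono_lie h h) (PDer.bracket δ μ) =
      PDer.bracket (PDer.restrict h δ) (PDer.restrict h μ) := rfl

/-- The bracket `[δ_I, μ_J] = (δμ - μδ)_{[K, K]}`, `K = I ∩ J`. -/
noncomputable instance [Semiprime Φ L] : Bracket (Qm Φ L) (Qm Φ L) where
  bracket := DirectLimit.lift₂ (derSystemMap (Φ := Φ) (L := L)) (derSystemMap (Φ := Φ) (L := L))
    (fun I δ μ => Qm.mk (OrderDual.ofDual I).2.lie_self (PDer.bracket δ μ))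
    (fun I J h δ μ =>
       (Qm.mk_restrict (OrderDual.ofDual I).2.lie_self (OrderDual.ofDual J).2.lie_self
        (LieSubmodule.mono_lie h h) (PDer.bracket δ μ)).symm)

theorem Qm.mk_lie [Semiprime Φ L] {I : LieIdeal Φ L} (hI : IsEssential I) (δ μ : PDer I) :
    ⁅Qm.mk hI δ, Qm.mk hI μ⁆ = Qm.mk hI.lie_self (PDer.bracket δ μ) :=
  DirectLimit.lift₂_def (derSystemMap (Φ := Φ) (L := L)) (derSystemMap (Φ := Φ) (L := L))
    (fun I δ μ => Qm.mk (OrderDual.ofDual I).2.lie_self (PDer.bracket δ μ)) _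
    (OrderDual.toDual ⟨I, hI⟩) δ μ

theorem PDer.bracket_add_left {I : LieIdeal Φ L} (a b c : PDer I) :
    PDer.bracket (a + b) c = PDer.bracket a c + PDer.bracket b c := by
  refine PDer.ext' fun x hx => ?_
  have h : (⟨(a + b).1 ⟨x, lie_self_le I hx⟩, PDer.apply_mem (a + b) hx _⟩ : I) =
    ⟨a.1 ⟨x, lie_self_le I hx⟩, PDer.apply_mem a hx _⟩ + ⟨b.1 ⟨x, lie_self_le I hx⟩, PDer.apply_mem b hx _⟩ :=
    rfl
  change (a + b).1 _ - c.1 ⟨(a + b).1 ⟨x, lie_self_le I hx⟩, _⟩ =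
    (a.1 _ - c.1 _) + (b.1 _ - c.1 _)
  rw [h, map_add]
  change (a.1 _ + b.1 _) - (_ + _) = _
  abel

theorem PDer.bracket_skew {I : LieIdeal Φ L} (a b : PDer I) :
    PDer.bracket a b = - PDer.bracket b a := by
  refine PDer.ext' fun x hx => ?_
  change a.1 _ - b.1 _ = - (b.1 _ - a.1 _)
  abel

theorem PDer.bracket_smul {I : LieIdeal Φ L} (t : Φ) (a b : PDer I) :
    PDer.bracket a (t • b) = t • PDer.bracket a b := by
  refine PDer.ext' fun x hx => ?_
  have h : (⟨(t • b).1 ⟨x, lie_self_le I hx⟩, PDer.apply_mem (t • b) hx _⟩ : I) =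
    t • ⟨b.1 ⟨x, lie_self_le I hx⟩, PDer.apply_mem b hx _⟩ := rfl
  change a.1 ⟨(t • b).1 ⟨x, lie_self_le I hx⟩, _⟩ - (t • b).1 _ = t • (a.1 _ - b.1 _)
  rw [h, map_smul, smul_sub]
  rfl

theorem Qm.jacobi [Semiprime Φ L] (p q r : Qm Φ L) : ⁅p, ⁅q, r⁆⁆ = ⁅⁅p, q⁆, r⁆ + ⁅q, ⁅p, r⁆⁆ := by
  refine Qm.ind₃ (P := fun p q r => ⁅p, ⁅q, r⁆⁆ = ⁅⁅p, q⁆, r⁆ + ⁅q, ⁅p, r⁆⁆)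
    (fun I hI a b c => ?_) p q r
  have hS := hI.lie_self
  have hres : ∀ d : PDer I, Qm.mk hI d = Qm.mk hS (PDer.restrict (lie_self_le I) d) :=
    fun d => (Qm.mk_restrict _ _ _ _).symm
  rw [Qm.mk_lie hI b c, Qm.mk_lie hI a b, Qm.mk_lie hI a c, hres a, hres b, hres c, Qm.mk_lie,
    Qm.mk_lie, Qm.mk_lie, ← Qm.mk_add]
  congr 1
  refine PDer.ext' fun x hx => ?_
  have e : ∀ (f : PDer I) (u v w : I), w = u - v → f.1 w = f.1 u - f.1 v := by
    rintro f u v _ rfl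
    exact map_sub _ _ _
  have hx1 : x ∈ ⁅I, I⁆ := lie_self_le _ hx
  have hx0 : x ∈ I := lie_self_le _ hx1
  have m : ∀ f : PDer I, f.1 ⟨x, hx0⟩ ∈ ⁅I, I⁆ := fun f =>
    PDer.apply_mem (PDer.restrict (lie_self_le I) f) hx hx1
  have m' : ∀ f : PDer I, f.1 ⟨x, hx0⟩ ∈ I := fun f => lie_self_le I (m f)
  have mm : ∀ f g : PDer I, f.1 ⟨g.1 ⟨x, hx0⟩, m' g⟩ ∈ I := fun f g => PDer.apply_mem f (m g) _
  have k : ∀ (f g h : PDer I) (hm), f.1 ⟨(PDer.bracket g h).1 ⟨x, hx1⟩, hm⟩ =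
      f.1 ⟨g.1 ⟨h.1 ⟨x, hx0⟩, m' h⟩, mm g h⟩ - f.1 ⟨h.1 ⟨g.1 ⟨x, hx0⟩, m' g⟩, mm h g⟩ :=
    fun f g h hm => e f _ _ _ rfl
  have hm : ∀ g h : PDer I, (PDer.bracket g h).1 ⟨x, hx1⟩ ∈ I := fun g h =>
    sub_mem (mm g h) (mm h g)
  refine (congrArg₂ (· - ·) (k a b c (hm b c)) (PDer.bracket_apply b c _ (m a))).trans
    (Eq.trans ?_ (congrArg₂ (· + ·)
      (congrArg₂ (· - ·) (PDer.bracket_apply a b _ (m c)) (k c a b (hm a b)))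
      (congrArg₂ (· - ·) (k b a c (hm a c)) (PDer.bracket_apply a c _ (m b)))).symm)
  abel

noncomputable instance [Semiprime Φ L] : LieRing (Qm Φ L) where
  add_lie p q r := by
    refine Qm.ind₃ (P := fun p q r => ⁅p + q, r⁆ = ⁅p, r⁆ + ⁅q, r⁆) (fun I hI a b c => ?_) p q r
    rw [← Qm.mk_add, Qm.mk_lie, Qm.mk_lie, Qm.mk_lie, ← Qm.mk_add, PDer.bracket_add_left]
  lie_add p q r := by
    refine Qm.ind₃ (P := fun p q r => ⁅p, q + r⁆ = ⁅p, q⁆ + ⁅p, r⁆) (fun I hI a b c => ?_) p q r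
    rw [← Qm.mk_add, Qm.mk_lie, Qm.mk_lie, Qm.mk_lie, ← Qm.mk_add, PDer.bracket_skew,
      PDer.bracket_add_left, PDer.bracket_skew a b, PDer.bracket_skew a c, neg_add]
  lie_self p := by
    refine Qm.ind₃ (P := fun p _ _ => ⁅p, p⁆ = 0) (fun I hI a _ _ => ?_) p p p
    rw [Qm.mk_lie, ← Qm.mk_zero hI.lie_self]
    congr 1
    exact PDer.ext' fun x hx => sub_self _
  leibniz_lie := Qm.jacobi

noncomputable instance [Semiprime Φ L] : LieAlgebra Φ (Qm Φ L) where
  lie_smul t p q := by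
    refine Qm.ind₃ (P := fun p q _ => ⁅p, t • q⁆ = t • ⁅p, q⁆) (fun I hI a b _ => ?_) p q q
    rw [← Qm.mk_smul, Qm.mk_lie, Qm.mk_lie, ← Qm.mk_smul, PDer.bracket_smul]

/-- The inner derivation `ad x : L → L`. -/
def PDer.ad (x : L) : PDer (⊤ : LieIdeal Φ L) :=
  ⟨(LieAlgebra.ad Φ L x).comp (⊤ : LieIdeal Φ L).toSubmodule.subtype, fun y z => by
    change ⁅x, ⁅(y : L), (z : L)⁆⁆ = ⁅⁅x, (y : L)⁆, (z : L)⁆ + ⁅(y : L), ⁅x, (z : L)⁆⁆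
    exact leibniz_lie _ _ _⟩

variable (Φ L) in
/-- The canonical map `L → Q_m(L)`, `x ↦ (ad x)_L`. -/
def Qm.of : L →ₗ[Φ] Qm Φ L where
  toFun x := Qm.mk IsEssential.top (PDer.ad x)
  map_add' x y := by
    rw [← Qm.mk_add]
    congr 1
    exact PDer.ext' fun z hz => add_lie x y z
  map_smul' c x := by
    rw [RingHom.id_apply, ← Qm.mk_smul]
    congr 1
    exact PDer.ext' fun z hz => smul_lie c x z

/-- The derivation `e ∘ δ ∘ e⁻¹`, defined on `e(I)`. -/
def PDer.conj (e : L ≃ₗ⁅Φ⁆ L) {I : LieIdeal Φ L} (δ : PDer I) :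
    PDer (I.comap (e.symm : L →ₗ⁅Φ⁆ L)) :=
  ⟨{ toFun := fun x => e (δ.1 ⟨e.symm x, x.2⟩)
     map_add' := fun x y => by
      rw [← map_add, ← map_add]
      congr 2
      exact Subtype.ext (map_add e.symm (x : L) y)
     map_smul' := fun c x => by
      rw [RingHom.id_apply, ← map_smul, ← map_smul]
      congr 2
      exact Subtype.ext (map_smul e.symm c (x : L)) }, fun x y => by
    have h := PDer.apply_lie δ (x := e.symm x) (y := e.symm y) x.2 y.2 (lie_mem_right Φ L I _ _ y.2)
    have h2 := congrArg e h
    rw [map_add, LieEquiv.map_lie, LieEquiv.map_lie, LieEquiv.apply_symm_apply,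
      LieEquiv.apply_symm_apply] at h2
    refine Eq.trans ?_ h2
    change e (δ.1 ⟨e.symm ⁅(x : L), (y : L)⁆, _⟩) = _
    congr 2
    exact Subtype.ext (LieEquiv.map_lie e.symm _ _)⟩

theorem ne_bot_iff_mem (I : LieIdeal Φ L) : I ≠ ⊥ ↔ ∃ x ∈ I, x ≠ 0 := by
  rw [ne_eq, LieSubmodule.eq_bot_iff]
  push Not
  rfl

theorem IsEssential.comap (e : L ≃ₗ⁅Φ⁆ L) {I : LieIdeal Φ L} (hI : IsEssential I) :
    IsEssential (I.comap (e.symm : L →ₗ⁅Φ⁆ L)) := by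
  intro J hJ h
  obtain ⟨z, hz, hz0⟩ := (ne_bot_iff_mem _).mp hJ
  have hJ' : J.comap (e : L →ₗ⁅Φ⁆ L) ≠ ⊥ := (ne_bot_iff_mem _).mpr
    ⟨e.symm z, by
      change e (e.symm z) ∈ J
      rwa [LieEquiv.apply_symm_apply], fun h0 => hz0 (by
      rw [← e.apply_symm_apply z, h0, map_zero])⟩
  obtain ⟨w, hw, hw0⟩ := (ne_bot_iff_mem _).mp (hI _ hJ')
  obtain ⟨hw1, hw2⟩ := (LieSubmodule.mem_inf _ _ _).mp hw
  have : e w ∈ I.comap (e.symm : L →ₗ⁅Φ⁆ L) ⊓ J := by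
    refine (LieSubmodule.mem_inf _ _ _).mpr ⟨?_, hw2⟩
    change e.symm (e w) ∈ I
    rwa [LieEquiv.symm_apply_apply]
  rw [h, LieSubmodule.mem_bot] at this
  exact hw0 (by rw [← e.symm_apply_apply w, this, map_zero])

/-- The map of `Q_m(L)` induced by an automorphism `e` of `L`: it sends `δ_I` to
`(e ∘ δ ∘ e⁻¹)_{e(I)}`. -/
def Qm.conj (e : L ≃ₗ⁅Φ⁆ L) : Qm Φ L → Qm Φ L :=
  DirectLimit.lift (derSystemMap (Φ := Φ) (L := L))
    (fun I δ => Qm.mk ((OrderDual.ofDual I).2.comap e) (PDer.conj e δ))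
    (fun I J h _ => Qm.sound _ _ ((OrderDual.ofDual J).2.comap e)
      (fun x (hx : e.symm x ∈ (OrderDual.ofDual J).1) =>
        show e.symm x ∈ (OrderDual.ofDual I).1 from
        (show (OrderDual.ofDual J).1 ≤ (OrderDual.ofDual I).1 from h) hx) le_rfl _ _
      fun _ _ => rfl)

theorem Qm.conj_mk (e : L ≃ₗ⁅Φ⁆ L) {I : LieIdeal Φ L} (hI : IsEssential I) (δ : PDer I) :
    Qm.conj e (Qm.mk hI δ) = Qm.mk (hI.comap e) (PDer.conj e δ) := rfl

end Basic

section Graded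

variable {Φ L G : Type*} [CommRing Φ] [LieRing L] [LieAlgebra Φ L]
  [AddCommGroup G] [DecidableEq G] (ℒ : G → Submodule Φ L) [GradedLieAlgebra ℒ]

/-- A derivation `δ : I → L` has degree `σ` if `δ(I ∩ L_τ) ⊆ L_{τ + σ}` for all `τ`. -/
def PDer.HasDegree {I : LieIdeal Φ L} (δ : PDer I) (σ : G) : Prop :=
  ∀ (τ : G) (x : I), (x : L) ∈ ℒ τ → δ.1 x ∈ ℒ (τ + σ)

/-- The degree `σ` component of `Q_m(L)`: the classes of the derivations of degree `σ` defined on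
graded essential ideals of `L`. -/
def Qm.component (σ : G) : Submodule Φ (Qm Φ L) where
  carrier := {q | ∃ (I : LieIdeal Φ L) (hI : IsEssential I) (δ : PDer I),
    DirectSum.SetLike.IsHomogeneous ℒ I ∧ PDer.HasDegree ℒ δ σ ∧ q = Qm.mk hI δ}
  zero_mem' := ⟨⊤, IsEssential.top, 0, fun _ _ _ => LieSubmodule.mem_top _,
    fun _ _ _ => zero_mem _, (Qm.mk_zero _).symm⟩
  add_mem' := by
    rintro _ _ ⟨I, hI, δ, gI, hδ, rfl⟩ ⟨J, hJ, μ, gJ, hμ, rfl⟩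
    refine ⟨I ⊓ J, hI.inf hJ, PDer.restrict inf_le_left δ + PDer.restrict inf_le_right μ, ?_, ?_,
      ?_⟩
    · intro i m hm
      obtain ⟨h1, h2⟩ := (LieSubmodule.mem_inf _ _ _).mp hm
      exact (LieSubmodule.mem_inf _ _ _).mpr ⟨gI i h1, gJ i h2⟩
    · intro τ x hx
      exact add_mem (hδ τ _ hx) (hμ τ _ hx)
    · rw [Qm.mk_add, Qm.mk_restrict hI, Qm.mk_restrict hJ]
  smul_mem' := by
    rintro c _ ⟨I, hI, δ, gI, hδ, rfl⟩
    exact ⟨I, hI, c • δ, gI, fun τ x hx => Submodule.smul_mem _ _ (hδ τ x hx), rfl⟩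

theorem Qm.of_mem_component {σ : G} {x : L} (hx : x ∈ ℒ σ) :
    Qm.of Φ L x ∈ Qm.component ℒ σ := by
  refine ⟨⊤, IsEssential.top, PDer.ad x, fun _ _ _ => LieSubmodule.mem_top _, ?_, rfl⟩
  intro τ y hy
  rw [add_comm]
  exact SetLike.GradedBracket.bracket_mem hx hy

end Graded

end LieQuot

/-! ### Jordan pairs and their Tits-Kantor-Koecher algebras -/

/-- A (linear) Jordan pair `(V⁺, V⁻)` over `Φ`, given by its triple products
`{x, y, z} = tp x y z` and `{x, y, z} = tm x y z`; over a ring of scalars containing `1/6` these are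
the Jordan pairs, with quadratic maps `Q_x y = ½ {x, y, x}`. -/
class JordanPair (Φ Vp Vm : Type*) [CommRing Φ] [AddCommGroup Vp] [Module Φ Vp]
    [AddCommGroup Vm] [Module Φ Vm] where
  tp : Vp →ₗ[Φ] Vm →ₗ[Φ] Vp →ₗ[Φ] Vp
  tm : Vm →ₗ[Φ] Vp →ₗ[Φ] Vm →ₗ[Φ] Vm
  tp_comm : ∀ x y z, tp x y z = tp z y x
  tm_comm : ∀ x y z, tm x y z = tm z y x
  tp_jordan : ∀ x y u v z,
    tp x y (tp u v z) = tp (tp x y u) v z - tp u (tm y x v) z + tp u v (tp x y z)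
  tm_jordan : ∀ x y u v z,
    tm x y (tm u v z) = tm (tm x y u) v z - tm u (tp y x v) z + tm u v (tm x y z)

/-- A (linear) Jordan triple system over `Φ` with triple product `{x, y, z} = triple x y z`; over a
ring of scalars containing `1/6` these are the Jordan triple systems, with quadratic map
`P_x y = ½ {x, y, x}`. -/
class JordanTripleSystem (Φ T : Type*) [CommRing Φ] [AddCommGroup T] [Module Φ T] where
  triple : T →ₗ[Φ] T →ₗ[Φ] T →ₗ[Φ] T
  triple_comm : ∀ x y z, triple x y z = triple z y x
  triple_jordan : ∀ x y u v z, triple x y (triple u v z) =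
    triple (triple x y u) v z - triple u (triple y x v) z + triple u v (triple x y z)

/-- The double Jordan pair `V(T) = (T, T)` of a Jordan triple system. -/
instance JordanTripleSystem.doublePair (Φ T : Type*) [CommRing Φ] [AddCommGroup T] [Module Φ T]
    [JordanTripleSystem Φ T] : JordanPair Φ T T where
  tp := triple
  tm := triple
  tp_comm := triple_comm
  tm_comm := triple_comm
  tp_jordan := triple_jordan
  tm_jordan := triple_jordan

namespace JordanPair

attribute [local instance] LieRing.ofAssociativeRing

variable (Φ Vp Vm : Type*) [CommRing Φ] [AddCommGroup Vp] [Module Φ Vp]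
  [AddCommGroup Vm] [Module Φ Vm] [JordanPair Φ Vp Vm]

/-- A Jordan pair is strongly nondegenerate if it has no nonzero absolute zero divisors
(elements `x` with `Q_x = 0`). -/
class StronglyNondegenerate : Prop where
  eq_zero_of_tp : ∀ x : Vp, (∀ y : Vm, tp (Φ := Φ) x y x = 0) → x = 0
  eq_zero_of_tm : ∀ x : Vm, (∀ y : Vp, tm (Φ := Φ) x y x = 0) → x = 0

variable {Vp Vm} in
/-- The inner derivation `δ(x, y) = (D_{x,y}, -D_{y,x})`. -/
def innerDer (x : Vp) (y : Vm) : Module.End Φ Vp × Module.End Φ Vm :=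
  (tp x y, -tm y x)

/-- `γ = (γ⁺, γ⁻)` is a derivation of the Jordan pair. -/
def IsDerivation (γ : Module.End Φ Vp × Module.End Φ Vm) : Prop :=
  (∀ x y z, γ.1 (tp (Φ := Φ) x y z) = tp (Φ := Φ) (γ.1 x) y z + tp (Φ := Φ) x (γ.2 y) z +
    tp (Φ := Φ) x y (γ.1 z)) ∧
  (∀ x y z, γ.2 (tm (Φ := Φ) x y z) = tm (Φ := Φ) (γ.2 x) y z + tm (Φ := Φ) x (γ.1 y) z +
    tm (Φ := Φ) x y (γ.2 z))

variable {Vp Vm} in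
theorem isDerivation_innerDer (x : Vp) (y : Vm) : IsDerivation Φ Vp Vm (innerDer Φ x y) := by
  constructor
  · intro u v z
    simp only [innerDer, LinearMap.neg_apply, map_neg]
    rw [tp_jordan]
    abel
  · intro u v z
    simp only [innerDer, LinearMap.neg_apply, map_neg]
    rw [tm_jordan]
    abel

theorem innerDer_add_left (x x' : Vp) (y : Vm) :
    innerDer Φ (x + x') y = innerDer Φ x y + innerDer Φ x' y := by
  refine Prod.ext ?_ ?_
  · simp [innerDer]
  · simp [innerDer, add_comm]

theorem innerDer_add_right (x : Vp) (y y' : Vm) :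
    innerDer Φ x (y + y') = innerDer Φ x y + innerDer Φ x y' := by
  refine Prod.ext ?_ ?_
  · simp [innerDer]
  · simp [innerDer, add_comm]

theorem innerDer_smul_left (c : Φ) (x : Vp) (y : Vm) :
    innerDer Φ (c • x) y = c • innerDer Φ x y := by
  refine Prod.ext ?_ ?_
  · simp [innerDer]
  · simp [innerDer]

theorem innerDer_smul_right (c : Φ) (x : Vp) (y : Vm) :
    innerDer Φ x (c • y) = c • innerDer Φ x y := by
  refine Prod.ext ?_ ?_
  · simp [innerDer]
  · simp [innerDer]

variable {Vp Vm} in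
theorem lie_innerDer {γ : Module.End Φ Vp × Module.End Φ Vm} (hγ : IsDerivation Φ Vp Vm γ)
    (x : Vp) (y : Vm) :
    ⁅γ, innerDer Φ x y⁆ = innerDer Φ (γ.1 x) y + innerDer Φ x (γ.2 y) := by
  rw [Ring.lie_def]
  refine Prod.ext (LinearMap.ext fun z => ?_) (LinearMap.ext fun z => ?_)
  · change γ.1 (tp (Φ := Φ) x y z) - tp (Φ := Φ) x y (γ.1 z) =
      tp (Φ := Φ) (γ.1 x) y z + tp (Φ := Φ) x (γ.2 y) z
    rw [hγ.1]
    abel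
  · change γ.2 (-tm (Φ := Φ) y x z) - -tm (Φ := Φ) y x (γ.2 z) =
      -tm (Φ := Φ) y (γ.1 x) z + -tm (Φ := Φ) (γ.2 y) x z
    rw [map_neg, hγ.2]
    abel

/-- The `Φ`-span of the inner derivations. -/
def innerSpan : Submodule Φ (Module.End Φ Vp × Module.End Φ Vm) :=
  Submodule.span Φ {γ | ∃ (x : Vp) (y : Vm), innerDer Φ x y = γ}

theorem isDerivation_of_mem {γ : Module.End Φ Vp × Module.End Φ Vm}
    (h : γ ∈ innerSpan Φ Vp Vm) : IsDerivation Φ Vp Vm γ := by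
  refine Submodule.span_induction ?_ ?_ ?_ ?_ h
  · rintro _ ⟨x, y, rfl⟩
    exact isDerivation_innerDer Φ x y
  · constructor <;> intros <;> simp
  · intro a b _ _ ha hb
    constructor
    · intro x y z
      simp only [Prod.fst_add, Prod.snd_add, LinearMap.add_apply, map_add, ha.1, hb.1]
      abel
    · intro x y z
      simp only [Prod.fst_add, Prod.snd_add, LinearMap.add_apply, map_add, ha.2, hb.2]
      abel
  · intro c a _ ha
    constructor
    · intro x y z
      simp only [Prod.smul_fst, Prod.smul_snd, LinearMap.smul_apply, map_smul, ha.1, smul_add]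
    · intro x y z
      simp only [Prod.smul_fst, Prod.smul_snd, LinearMap.smul_apply, map_smul, ha.2, smul_add]

/-- The Lie algebra `IDer(V)` of inner derivations, i.e. the `Φ`-span of all `δ(x, y)`. -/
def IDer : LieSubalgebra Φ (Module.End Φ Vp × Module.End Φ Vm) where
  toSubmodule := innerSpan Φ Vp Vm
  lie_mem' := by
    intro γ μ hγ hμ
    have hd := isDerivation_of_mem Φ Vp Vm hγ
    change μ ∈ innerSpan Φ Vp Vm at hμ
    change ⁅γ, μ⁆ ∈ innerSpan Φ Vp Vm
    refine Submodule.span_induction (p := fun μ _ => ⁅γ, μ⁆ ∈ innerSpan Φ Vp Vm) ?_ ?_ ?_ ?_ hμ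
    · rintro _ ⟨x, y, rfl⟩
      rw [lie_innerDer Φ hd]
      exact add_mem (Submodule.subset_span ⟨_, _, rfl⟩) (Submodule.subset_span ⟨_, _, rfl⟩)
    · rw [lie_zero]
      exact zero_mem _
    · intro a b _ _ ha hb
      rw [lie_add]
      exact add_mem ha hb
    · intro c a _ ha
      rw [lie_smul]
      exact Submodule.smul_mem _ c ha

variable {Vp Vm} in
/-- `δ(x, y)` as an element of `IDer(V)`. -/
def inner (x : Vp) (y : Vm) : IDer Φ Vp Vm :=
  ⟨innerDer Φ x y, Submodule.subset_span ⟨x, y, rfl⟩⟩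

/-- The Tits-Kantor-Koecher algebra `TKK(V) = V⁺ ⊕ IDer(V) ⊕ V⁻`. -/
def TKK : Type _ := Vp × IDer Φ Vp Vm × Vm

namespace TKK

noncomputable instance : AddCommGroup (TKK Φ Vp Vm) :=
  inferInstanceAs (AddCommGroup (Vp × IDer Φ Vp Vm × Vm))

noncomputable instance : Module Φ (TKK Φ Vp Vm) :=
  inferInstanceAs (Module Φ (Vp × IDer Φ Vp Vm × Vm))

variable {Φ Vp Vm}

/-- The element `x ⊕ γ ⊕ y` of `TKK(V)`. -/
def mk (x : Vp) (γ : IDer Φ Vp Vm) (y : Vm) : TKK Φ Vp Vm := (x, γ, y)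

/-- The component in `V⁺`. -/
def pos (a : TKK Φ Vp Vm) : Vp := a.1

/-- The component in `IDer(V)`. -/
def der (a : TKK Φ Vp Vm) : IDer Φ Vp Vm := a.2.1

/-- The component in `V⁻`. -/
def neg (a : TKK Φ Vp Vm) : Vm := a.2.2

theorem ext {a b : TKK Φ Vp Vm} (h1 : a.pos = b.pos) (h0 : a.der = b.der) (h2 : a.neg = b.neg) :
    a = b := Prod.ext h1 (Prod.ext h0 h2)

@[simp] theorem pos_mk (x : Vp) (γ : IDer Φ Vp Vm) (y : Vm) : (mk x γ y).pos = x := rfl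
@[simp] theorem der_mk (x : Vp) (γ : IDer Φ Vp Vm) (y : Vm) : (mk x γ y).der = γ := rfl
@[simp] theorem neg_mk (x : Vp) (γ : IDer Φ Vp Vm) (y : Vm) : (mk x γ y).neg = y := rfl
@[simp] theorem pos_add (a b : TKK Φ Vp Vm) : (a + b).pos = a.pos + b.pos := rfl
@[simp] theorem der_add (a b : TKK Φ Vp Vm) : (a + b).der = a.der + b.der := rfl
@[simp] theorem neg_add (a b : TKK Φ Vp Vm) : (a + b).neg = a.neg + b.neg := rfl
@[simp] theorem pos_smul (c : Φ) (a : TKK Φ Vp Vm) : (c • a).pos = c • a.pos := rfl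
@[simp] theorem der_smul (c : Φ) (a : TKK Φ Vp Vm) : (c • a).der = c • a.der := rfl
@[simp] theorem neg_smul (c : Φ) (a : TKK Φ Vp Vm) : (c • a).neg = c • a.neg := rfl
@[simp] theorem pos_zero : (0 : TKK Φ Vp Vm).pos = 0 := rfl
@[simp] theorem der_zero : (0 : TKK Φ Vp Vm).der = 0 := rfl
@[simp] theorem neg_zero : (0 : TKK Φ Vp Vm).neg = 0 := rfl

/-- `[x⁺ ⊕ γ ⊕ x⁻, y⁺ ⊕ μ ⊕ y⁻] =
(γ₊ y⁺ - μ₊ x⁺) ⊕ ([γ, μ] + δ(x⁺, y⁻) - δ(y⁺, x⁻)) ⊕ (γ₋ y⁻ - μ₋ x⁻)`. -/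
noncomputable instance : Bracket (TKK Φ Vp Vm) (TKK Φ Vp Vm) where
  bracket a b := mk (a.der.1.1 b.pos - b.der.1.1 a.pos)
    (⁅a.der, b.der⁆ + inner Φ a.pos b.neg - inner Φ b.pos a.neg)
    (a.der.1.2 b.neg - b.der.1.2 a.neg)

theorem pos_lie (a b : TKK Φ Vp Vm) : ⁅a, b⁆.pos = a.der.1.1 b.pos - b.der.1.1 a.pos := rfl

theorem der_lie (a b : TKK Φ Vp Vm) :
    ⁅a, b⁆.der = ⁅a.der, b.der⁆ + inner Φ a.pos b.neg - inner Φ b.pos a.neg := rfl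

theorem neg_lie (a b : TKK Φ Vp Vm) : ⁅a, b⁆.neg = a.der.1.2 b.neg - b.der.1.2 a.neg := rfl

theorem inner_add_left (x x' : Vp) (y : Vm) :
    inner Φ (x + x') y = inner Φ x y + inner Φ x' y :=
  Subtype.ext (innerDer_add_left Φ Vp Vm x x' y)

theorem inner_add_right (x : Vp) (y y' : Vm) :
    inner Φ x (y + y') = inner Φ x y + inner Φ x y' :=
  Subtype.ext (innerDer_add_right Φ Vp Vm x y y')

theorem inner_smul_left (c : Φ) (x : Vp) (y : Vm) : inner Φ (c • x) y = c • inner Φ x y :=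
  Subtype.ext (innerDer_smul_left Φ Vp Vm c x y)

theorem inner_smul_right (c : Φ) (x : Vp) (y : Vm) : inner Φ x (c • y) = c • inner Φ x y :=
  Subtype.ext (innerDer_smul_right Φ Vp Vm c x y)

theorem inner_sub_left (x x' : Vp) (y : Vm) :
    inner Φ (x - x') y = inner Φ x y - inner Φ x' y := by
  rw [eq_sub_iff_add_eq, ← inner_add_left, sub_add_cancel]

theorem inner_sub_right (x : Vp) (y y' : Vm) :
    inner Φ x (y - y') = inner Φ x y - inner Φ x y' := by
  rw [eq_sub_iff_add_eq, ← inner_add_right, sub_add_cancel]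

theorem lie_inner (γ : IDer Φ Vp Vm) (x : Vp) (y : Vm) :
    ⁅γ, inner Φ x y⁆ = inner Φ (γ.1.1 x) y + inner Φ x (γ.1.2 y) :=
  Subtype.ext (lie_innerDer Φ (isDerivation_of_mem Φ Vp Vm γ.2) x y)

theorem inner_fst (x z : Vp) (y : Vm) : (inner Φ x y).1.1 z = tp (Φ := Φ) x y z := rfl

theorem inner_snd (x : Vp) (y z : Vm) : (inner Φ x y).1.2 z = -tm (Φ := Φ) y x z := rfl

theorem add_fst (γ μ : IDer Φ Vp Vm) (z : Vp) : (γ + μ).1.1 z = γ.1.1 z + μ.1.1 z := rfl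
theorem add_snd (γ μ : IDer Φ Vp Vm) (z : Vm) : (γ + μ).1.2 z = γ.1.2 z + μ.1.2 z := rfl
theorem sub_fst (γ μ : IDer Φ Vp Vm) (z : Vp) : (γ - μ).1.1 z = γ.1.1 z - μ.1.1 z := rfl
theorem sub_snd (γ μ : IDer Φ Vp Vm) (z : Vm) : (γ - μ).1.2 z = γ.1.2 z - μ.1.2 z := rfl
theorem lie_fst (γ μ : IDer Φ Vp Vm) (z : Vp) :
    (⁅γ, μ⁆ : IDer Φ Vp Vm).1.1 z = γ.1.1 (μ.1.1 z) - μ.1.1 (γ.1.1 z) := rfl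
theorem lie_snd (γ μ : IDer Φ Vp Vm) (z : Vm) :
    (⁅γ, μ⁆ : IDer Φ Vp Vm).1.2 z = γ.1.2 (μ.1.2 z) - μ.1.2 (γ.1.2 z) := rfl

theorem jacobi (a b c : TKK Φ Vp Vm) : ⁅a, ⁅b, c⁆⁆ = ⁅⁅a, b⁆, c⁆ + ⁅b, ⁅a, c⁆⁆ := by
  refine ext ?_ ?_ ?_
  · simp only [pos_lie, der_lie, pos_add, map_sub, add_fst, sub_fst, lie_fst,
      inner_fst]
    rw [tp_comm b.pos c.neg a.pos, tp_comm c.pos b.neg a.pos, tp_comm c.pos a.neg b.pos]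
    abel
  · simp only [pos_lie, der_lie, neg_lie, der_add, lie_add, lie_sub, add_lie, sub_lie,
      inner_sub_left, inner_sub_right, lie_inner]
    rw [← lie_skew (inner Φ a.pos b.neg), ← lie_skew (inner Φ b.pos a.neg), lie_inner, lie_inner,
      leibniz_lie a.der b.der c.der]
    abel
  · simp only [der_lie, neg_lie, neg_add, map_sub, add_snd, sub_snd, lie_snd,
      inner_snd]
    rw [tm_comm c.neg b.pos a.neg, tm_comm b.neg c.pos a.neg, tm_comm c.neg a.pos b.neg]
    abel

noncomputable instance : LieRing (TKK Φ Vp Vm) where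
  add_lie a b c := by
    refine ext ?_ ?_ ?_
    · simp only [pos_lie, pos_add, der_add, map_add, add_fst]
      abel
    · simp only [der_lie, pos_add, der_add, neg_add, add_lie, inner_add_left, inner_add_right]
      abel
    · simp only [neg_lie, neg_add, der_add, map_add, add_snd]
      abel
  lie_add a b c := by
    refine ext ?_ ?_ ?_
    · simp only [pos_lie, pos_add, der_add, map_add, add_fst]
      abel
    · simp only [der_lie, pos_add, der_add, neg_add, lie_add, inner_add_left, inner_add_right]
      abel
    · simp only [neg_lie, neg_add, der_add, map_add, add_snd]
      abel
  lie_self a := by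
    refine ext ?_ ?_ ?_
    · simp [pos_lie]
    · simp [der_lie]
    · simp [neg_lie]
  leibniz_lie := jacobi

noncomputable instance : LieAlgebra Φ (TKK Φ Vp Vm) where
  lie_smul t a b := by
    refine ext ?_ ?_ ?_
    · rw [pos_smul, pos_lie, pos_lie, smul_sub, pos_smul, map_smul]
      rfl
    · simp only [der_lie, pos_smul, der_smul, neg_smul, lie_smul, inner_smul_left,
        inner_smul_right, smul_add, smul_sub]
    · rw [neg_smul, neg_lie, neg_lie, smul_sub, neg_smul, map_smul]
      rfl

variable (Φ Vp Vm) in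
/-- The 3-grading of `TKK(V)`: `TKK(V)₁ = V⁺`, `TKK(V)₀ = IDer(V)`, `TKK(V)₋₁ = V⁻`, and
`TKK(V)ₙ = 0` for all other `n`. -/
def grading (n : ℤ) : Submodule Φ (TKK Φ Vp Vm) where
  carrier := {a | (n ≠ 1 → a.pos = 0) ∧ (n ≠ 0 → a.der = 0) ∧ (n ≠ -1 → a.neg = 0)}
  zero_mem' := ⟨fun _ => rfl, fun _ => rfl, fun _ => rfl⟩
  add_mem' := by
    rintro a b ⟨h1, h2, h3⟩ ⟨k1, k2, k3⟩
    exact ⟨fun h => by rw [pos_add, h1 h, k1 h, add_zero],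
      fun h => by rw [der_add, h2 h, k2 h, add_zero],
      fun h => by rw [neg_add, h3 h, k3 h, add_zero]⟩
  smul_mem' := by
    rintro c a ⟨h1, h2, h3⟩
    exact ⟨fun h => by rw [pos_smul, h1 h, smul_zero],
      fun h => by rw [der_smul, h2 h, smul_zero],
      fun h => by rw [neg_smul, h3 h, smul_zero]⟩

theorem mem_grading {n : ℤ} {a : TKK Φ Vp Vm} : a ∈ grading Φ Vp Vm n ↔
    (n ≠ 1 → a.pos = 0) ∧ (n ≠ 0 → a.der = 0) ∧ (n ≠ -1 → a.neg = 0) := Iff.rfl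

instance : SetLike.GradedBracket (grading Φ Vp Vm) where
  bracket_mem := by
    intro i j a b ha hb
    rw [mem_grading] at ha hb ⊢
    obtain ⟨a1, a0, a2⟩ := ha
    obtain ⟨b1, b0, b2⟩ := hb
    refine ⟨fun h => ?_, fun h => ?_, fun h => ?_⟩
    · have e1 : a.der.1.1 b.pos = 0 := by
        by_cases hi : i = 0
        · rw [b1 (by omega), map_zero]
        · rw [a0 hi]
          rfl
      have e2 : b.der.1.1 a.pos = 0 := by
        by_cases hj : j = 0
        · rw [a1 (by omega), map_zero]
        · rw [b0 hj]
          rfl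
      rw [pos_lie, e1, e2, sub_zero]
    · have e0 : ⁅a.der, b.der⁆ = 0 := by
        by_cases hi : i = 0
        · rw [b0 (by omega), lie_zero]
        · rw [a0 hi, zero_lie]
      have e1 : inner Φ a.pos b.neg = 0 := by
        by_cases hi : i = 1
        · rw [b2 (by omega), ← sub_self b.neg, inner_sub_right, sub_self]
        · rw [a1 hi, ← sub_self a.pos, inner_sub_left, sub_self]
      have e2 : inner Φ b.pos a.neg = 0 := by
        by_cases hj : j = 1
        · rw [a2 (by omega), ← sub_self a.neg, inner_sub_right, sub_self]
        · rw [b1 hj, ← sub_self b.pos, inner_sub_left, sub_self]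
      rw [der_lie, e0, e1, e2, add_zero, sub_zero]
    · have e1 : a.der.1.2 b.neg = 0 := by
        by_cases hi : i = 0
        · rw [b2 (by omega), map_zero]
        · rw [a0 hi]
          rfl
      have e2 : b.der.1.2 a.neg = 0 := by
        by_cases hj : j = 0
        · rw [a2 (by omega), map_zero]
        · rw [b0 hj]
          rfl
      rw [neg_lie, e1, e2, sub_zero]

/-- The inclusions of the three homogeneous components, as elements of the graded pieces. -/
def homPos (a : TKK Φ Vp Vm) : grading Φ Vp Vm 1 :=
  ⟨mk a.pos 0 0, fun h => absurd rfl h, fun _ => rfl, fun _ => rfl⟩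

/-- See `homPos`. -/
def homDer (a : TKK Φ Vp Vm) : grading Φ Vp Vm 0 :=
  ⟨mk 0 a.der 0, fun _ => rfl, fun h => absurd rfl h, fun _ => rfl⟩

/-- See `homPos`. -/
def homNeg (a : TKK Φ Vp Vm) : grading Φ Vp Vm (-1) :=
  ⟨mk 0 0 a.neg, fun _ => rfl, fun _ => rfl, fun h => absurd rfl h⟩

theorem homPos_add (a b : TKK Φ Vp Vm) : homPos (a + b) = homPos a + homPos b :=
  Subtype.ext (ext rfl (add_zero _).symm (add_zero _).symm)

theorem homDer_add (a b : TKK Φ Vp Vm) : homDer (a + b) = homDer a + homDer b :=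
  Subtype.ext (ext (add_zero _).symm rfl (add_zero _).symm)

theorem homNeg_add (a b : TKK Φ Vp Vm) : homNeg (a + b) = homNeg a + homNeg b :=
  Subtype.ext (ext (add_zero _).symm (add_zero _).symm rfl)

/-- The decomposition of an element of `TKK(V)` into its homogeneous components. -/
noncomputable def decomp (a : TKK Φ Vp Vm) : DirectSum ℤ fun n => grading Φ Vp Vm n :=
  DirectSum.of (fun n => grading Φ Vp Vm n) 1 (homPos a) +
    DirectSum.of (fun n => grading Φ Vp Vm n) 0 (homDer a) +
    DirectSum.of (fun n => grading Φ Vp Vm n) (-1) (homNeg a)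

theorem decomp_add (a b : TKK Φ Vp Vm) : decomp (a + b) = decomp a + decomp b := by
  simp only [decomp, homPos_add, homDer_add, homNeg_add, map_add]
  abel

theorem decomp_of (n : ℤ) (x : grading Φ Vp Vm n) :
    decomp (x : TKK Φ Vp Vm) = DirectSum.of (fun n => grading Φ Vp Vm n) n x := by
  obtain ⟨a, h1, h0, h2⟩ := x
  have z1 : a.pos = 0 → homPos a = 0 := fun h => Subtype.ext (ext h rfl rfl)
  have z0 : a.der = 0 → homDer a = 0 := fun h => Subtype.ext (ext rfl h rfl)
  have z2 : a.neg = 0 → homNeg a = 0 := fun h => Subtype.ext (ext rfl rfl h)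
  unfold decomp
  by_cases n1 : n = 1
  · subst n1
    rw [z0 (h0 (by norm_num)), z2 (h2 (by norm_num)), map_zero, map_zero, add_zero, add_zero]
    congr 1
    exact Subtype.ext (ext rfl (h0 (by norm_num)).symm (h2 (by norm_num)).symm)
  by_cases n0 : n = 0
  · subst n0
    rw [z1 (h1 (by norm_num)), z2 (h2 (by norm_num)), map_zero, map_zero, add_zero, zero_add]
    congr 1
    exact Subtype.ext (ext (h1 (by norm_num)).symm rfl (h2 (by norm_num)).symm)
  by_cases n2 : n = -1
  · subst n2
    rw [z1 (h1 (by norm_num)), z0 (h0 (by norm_num)), map_zero, map_zero, add_zero, zero_add]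
    congr 1
    exact Subtype.ext (ext (h1 (by norm_num)).symm (h0 (by norm_num)).symm rfl)
  · rw [z1 (h1 n1), z0 (h0 n0), z2 (h2 n2), map_zero, map_zero, map_zero, add_zero, add_zero]
    have : (⟨a, h1, h0, h2⟩ : grading Φ Vp Vm n) = 0 :=
      Subtype.ext (ext (h1 n1) (h0 n0) (h2 n2))
    rw [this, map_zero]

noncomputable instance : GradedLieAlgebra (grading Φ Vp Vm) where
  decompose' := decomp
  left_inv a := by
    simp only [decomp, map_add, DirectSum.coeAddMonoidHom_of]
    refine ext ?_ ?_ ?_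
    · change a.pos + 0 + 0 = a.pos
      rw [add_zero, add_zero]
    · change 0 + a.der + 0 = a.der
      rw [add_zero, zero_add]
    · change 0 + 0 + a.neg = a.neg
      rw [add_zero, zero_add]
  right_inv x := by
    induction x using DirectSum.induction_on with
    | zero =>
      rw [map_zero]
      have h := decomp_add (0 : TKK Φ Vp Vm) 0
      rw [add_zero] at h
      exact left_eq_add.mp h
    | of i x =>
      rw [DirectSum.coeAddMonoidHom_of]
      exact decomp_of i x
    | add x y hx hy => rw [map_add, decomp_add, hx, hy]

/-- The TKK-algebra of a strongly nondegenerate Jordan pair is semiprime. -/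
instance [StronglyNondegenerate Φ Vp Vm] : LieQuot.Semiprime Φ (TKK Φ Vp Vm) where
  lie_self_ne_bot := by
    intro I hI hII
    apply hI
    have key : ∀ a ∈ I, ∀ b : TKK Φ Vp Vm, ⁅a, ⁅a, b⁆⁆ = 0 := by
      intro a ha b
      have : ⁅a, ⁅a, b⁆⁆ ∈ ⁅I, I⁆ :=
        LieSubmodule.lie_mem_lie ha (lie_mem_left Φ _ I a b ha)
      rwa [hII, LieSubmodule.mem_bot] at this
    have hpos : ∀ a ∈ I, a.pos = 0 := by
      intro a ha
      refine StronglyNondegenerate.eq_zero_of_tp (Φ := Φ) (Vm := Vm) _ fun y => ?_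
      have h := congrArg pos (key a ha (mk 0 0 y))
      simp only [pos_lie, der_lie, pos_mk, der_mk, neg_mk, map_zero, lie_zero, zero_sub,
        zero_add, sub_fst, inner_fst, pos_zero] at h
      have e : (0 : IDer Φ Vp Vm).1.1 a.pos = 0 := rfl
      simpa [e] using h
    have hneg : ∀ a ∈ I, a.neg = 0 := by
      intro a ha
      refine StronglyNondegenerate.eq_zero_of_tm (Φ := Φ) (Vp := Vp) _ fun y => ?_
      have h := congrArg neg (key a ha (mk y 0 0))
      simp only [neg_lie, der_lie, pos_mk, der_mk, neg_mk, map_zero, lie_zero, zero_sub,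
        zero_add, sub_snd, inner_snd, neg_zero] at h
      have e : (0 : IDer Φ Vp Vm).1.2 a.neg = 0 := rfl
      simpa [e, inner_snd] using h
    rw [LieSubmodule.eq_bot_iff]
    intro a ha
    refine ext (hpos a ha) (Subtype.ext (Prod.ext (LinearMap.ext fun x => ?_)
      (LinearMap.ext fun y => ?_))) (hneg a ha)
    · have h := hpos _ (lie_mem_left Φ _ I a (mk x 0 0) ha)
      rw [pos_lie, hpos a ha, map_zero, sub_zero] at h
      exact h
    · have h := hneg _ (lie_mem_left Φ _ I a (mk 0 0 y) ha)
      rw [neg_lie, hneg a ha, map_zero, sub_zero] at h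
      exact h

end TKK

end JordanPair

/-! ### Jordan triple systems -/

namespace JordanTripleSystem

open JordanPair LieQuot

section

variable (Φ T : Type*) [CommRing Φ] [AddCommGroup T] [Module Φ T] [JordanTripleSystem Φ T]

/-- A Jordan triple system is strongly nondegenerate if it has no nonzero absolute zero divisors
(elements `x` with `P_x = 0`). -/
class StronglyNondegenerate : Prop where
  eq_zero : ∀ x : T, (∀ y : T, triple (Φ := Φ) x y x = 0) → x = 0

instance [StronglyNondegenerate Φ T] : JordanPair.StronglyNondegenerate Φ T T where
  eq_zero_of_tp := StronglyNondegenerate.eq_zero (Φ := Φ)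
  eq_zero_of_tm := StronglyNondegenerate.eq_zero (Φ := Φ)

variable {Φ T}

/-- `I` is an ideal of `T`: `{I, T, T} + {T, I, T} + {T, T, I} ⊆ I`. -/
def IsIdeal (I : Submodule Φ T) : Prop :=
  ∀ a ∈ I, ∀ x y : T, triple (Φ := Φ) a x y ∈ I ∧ triple (Φ := Φ) x a y ∈ I ∧
    triple (Φ := Φ) x y a ∈ I

/-- The annihilator of `I` in `T` is zero, where `z` annihilates `I` if
`{z, I, T} = {z, T, I} = {T, z, I} = 0`. -/
def AnnEqZero (I : Submodule Φ T) : Prop :=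
  ∀ z : T, (∀ a ∈ I, ∀ x : T, triple (Φ := Φ) z a x = 0 ∧ triple (Φ := Φ) z x a = 0 ∧
    triple (Φ := Φ) x z a = 0) → z = 0

/-- A linear map that is a homomorphism of Jordan triple systems. -/
def IsTripleHom {W : Type*} [AddCommGroup W] [Module Φ W] [JordanTripleSystem Φ W]
    (f : T →ₗ[Φ] W) : Prop :=
  ∀ x y z, f (triple (Φ := Φ) x y z) = triple (Φ := Φ) (f x) (f y) (f z)

/-- `W` is a Jordan triple system of `𝔐`-quotients of `T`, where `T` is viewed as a subsystem of `W`
through the injective homomorphism `j`: every nonzero `q ∈ W` is absorbed nontrivially into `T` by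
an ideal `I` of `T` with zero annihilator. -/
def IsMQuotients {W : Type*} [AddCommGroup W] [Module Φ W] [JordanTripleSystem Φ W]
    (j : T →ₗ[Φ] W) : Prop :=
  Function.Injective j ∧ IsTripleHom j ∧
  ∀ q : W, q ≠ 0 → ∃ I : Submodule Φ T, IsIdeal I ∧ AnnEqZero I ∧
    (∀ a ∈ I, ∀ x : T,
      triple (Φ := Φ) q (j a) (j x) ∈ LinearMap.range j ∧
      triple (Φ := Φ) q (j x) (j a) ∈ LinearMap.range j ∧
      triple (Φ := Φ) (j a) q (j x) ∈ LinearMap.range j) ∧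
    ∃ a ∈ I, ∃ x : T,
      triple (Φ := Φ) q (j a) (j x) ≠ 0 ∨
      triple (Φ := Φ) q (j x) (j a) ≠ 0 ∨
      triple (Φ := Φ) (j a) q (j x) ≠ 0

/-- `Q`, with `T` embedded through `ι`, is the maximal Jordan triple system of `𝔐`-quotients of `T`:
it is a Jordan triple system of `𝔐`-quotients of `T`, and every Jordan triple system `W` of
`𝔐`-quotients of `T` embeds into `Q` over `T`, in a unique way. -/
def IsMaximalMQuotients {Φ : Type u} {T : Type v} {Q : Type w} [CommRing Φ]
    [AddCommGroup T] [Module Φ T] [JordanTripleSystem Φ T] [AddCommGroup Q] [Module Φ Q]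
    [JordanTripleSystem Φ Q] (ι : T →ₗ[Φ] Q) : Prop :=
  IsMQuotients ι ∧
  ∀ (W : Type x) [AddCommGroup W] [Module Φ W] [JordanTripleSystem Φ W] (j : T →ₗ[Φ] W),
    IsMQuotients j →
    ∃ f : W →ₗ[Φ] Q, IsTripleHom f ∧ Function.Injective f ∧ f ∘ₗ j = ι ∧
      ∀ g : W →ₗ[Φ] Q, IsTripleHom g → g ∘ₗ j = ι → g = f

end

section

variable (Φ T : Type*) [CommRing Φ] [AddCommGroup T] [Module Φ T] [JordanTripleSystem Φ T]

theorem swap_mem {γ : Module.End Φ T × Module.End Φ T} (h : γ ∈ innerSpan Φ T T) :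
    γ.swap ∈ innerSpan Φ T T := by
  refine Submodule.span_induction ?_ ?_ ?_ ?_ h
  · rintro _ ⟨x, y, rfl⟩
    have : (innerDer Φ x y).swap = -innerDer Φ y x := by
      refine Prod.ext rfl ?_
      change triple (Φ := Φ) x y = - -triple (Φ := Φ) x y
      rw [neg_neg]
    rw [this]
    exact neg_mem (Submodule.subset_span ⟨y, x, rfl⟩)
  · exact zero_mem _
  · intro a b _ _ ha hb
    exact add_mem ha hb
  · intro c a _ ha
    exact Submodule.smul_mem _ c ha

variable {Φ T} in
/-- The exchange `(γ⁺, γ⁻) ↦ (γ⁻, γ⁺)` on `IDer(V(T))`. -/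
def swapDer (γ : IDer Φ T T) : IDer Φ T T := ⟨γ.1.swap, swap_mem Φ T γ.2⟩

theorem swapDer_inner (x y : T) :
    swapDer (JordanPair.inner Φ x y) = -JordanPair.inner Φ y x := by
  refine Subtype.ext (Prod.ext rfl ?_)
  change triple (Φ := Φ) x y = - -triple (Φ := Φ) x y
  rw [neg_neg]

/-- The exchange automorphism `x ⊕ (γ⁺, γ⁻) ⊕ y ↦ y ⊕ (γ⁻, γ⁺) ⊕ x` of `TKK(V(T))`. -/
noncomputable def exchange : TKK Φ T T ≃ₗ⁅Φ⁆ TKK Φ T T where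
  toFun a := TKK.mk a.neg (swapDer a.der) a.pos
  invFun a := TKK.mk a.neg (swapDer a.der) a.pos
  left_inv _ := rfl
  right_inv _ := rfl
  map_add' _ _ := rfl
  map_smul' _ _ := rfl
  map_lie' := by
    intro a b
    refine TKK.ext rfl ?_ rfl
    change swapDer (⁅a.der, b.der⁆ + JordanPair.inner Φ a.pos b.neg -
        JordanPair.inner Φ b.pos a.neg) =
      ⁅swapDer a.der, swapDer b.der⁆ + JordanPair.inner Φ a.neg b.pos -
        JordanPair.inner Φ b.neg a.pos
    have h : swapDer (⁅a.der, b.der⁆ + JordanPair.inner Φ a.pos b.neg -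
        JordanPair.inner Φ b.pos a.neg) = ⁅swapDer a.der, swapDer b.der⁆ +
        swapDer (JordanPair.inner Φ a.pos b.neg) - swapDer (JordanPair.inner Φ b.pos a.neg) := rfl
    rw [h, swapDer_inner, swapDer_inner]
    abel

/-- The degree `1` component `(Q_m(TKK(V(T))))₁`. -/
noncomputable abbrev QmOne : Submodule Φ (Qm Φ (TKK Φ T T)) :=
  Qm.component (TKK.grading Φ T T) 1

/-- The inclusion of `T = TKK(V(T))₁` in `TKK(V(T))`. -/
noncomputable def toTKK : T →ₗ[Φ] TKK Φ T T where
  toFun x := TKK.mk x 0 0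
  map_add' _ _ := TKK.ext rfl (add_zero _).symm (add_zero _).symm
  map_smul' c _ := TKK.ext rfl (smul_zero c).symm (smul_zero c).symm

/-- The canonical map `T = TKK(V(T))₁ → (Q_m(TKK(V(T))))₁`. -/
noncomputable def toQmOne : T →ₗ[Φ] QmOne Φ T :=
  ((Qm.of Φ (TKK Φ T T)).comp (toTKK Φ T)).codRestrict _ fun _ =>
    Qm.of_mem_component _ ⟨fun h => absurd rfl h, fun _ => rfl, fun _ => rfl⟩

end

end JordanTripleSystem

/-! Write $L=\mathrm{TKK}(V(T))$. Brackets in $Q_m(L)$ are computed by the rule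
$[\delta,\mathrm{ad}\,a]=\mathrm{ad}\,\delta(a)$ (`Qm.mk_lie_of`), and an essential ideal of a
semiprime algebra has zero centralizer (`IsEssential.eq_zero_of_lie`).

The Jordan identity for $[[p,\tau q],r]$ is the Jacobi identity together with $\tau^2=1$. The outer
symmetry $\{p,q,r\}=\{r,q,p\}$ says that $[\tau q,[p,r]]=0$, so it is enough that $Q_m(L)_2=0$
(`component_two_eq_zero`). A derivation of degree 2 is determined by a map $d$ from degree $-1$ to
degree 1. The trilinear maps $\{x,dy,z\}$ and $\{dx,y,dz\}$ turn out to be totally symmetric, and a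
cube argument with polarization and nondegeneracy forces $d=0$ (`degree_two_eq_zero`). Nondegeneracy
has to be tested on elements of an ideal only; `eq_zero_of_triple_ideal` allows this by way of the
fundamental formula $P_{P_xw}=P_xP_wP_x$, proved as an identity between powers of $\mathrm{ad}$.

A class $q$ of degree 1 is represented by $\delta$ on a homogeneous essential ideal $K$ stable under
exchange. The ideal $K_1$ of $T$ has zero annihilator (`eq_zero_of_inner_ideal`), and the products
of $q$ with $K_1$ and $T$ are read off from values of $\delta$, hence lie in $T$. If all of them
vanish, so does $\delta$.

For maximality, let $W$ be a system of $\mathfrak M$-quotients. An inner derivation of $W$ vanishing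
on $T$ is zero (`IsMQuotients.ider_eq_zero`), so inner derivations of $T$ extend uniquely to $W$ and
$L$ embeds in $\mathrm{TKK}(V(W))$. An ideal of $T$ with zero annihilator generates an essential
ideal $J$ of $L$, and if it absorbs $w$ then $[w,[J,J]]\subseteq L$ (`absorbs_lie_self`). Thus
$\mathrm{ad}\,w$ restricts to a derivation $[J,J]\to L$ of degree 1, and its class is the image of
$w$. Injectivity and uniqueness hold because homomorphisms are controlled by their values on the
products that fall into $T$. -/

namespace LieQuot

/-! ### Essential ideals and the calculus of $Q_m(L)$ -/

section Basic

variable {Φ L : Type*} [CommRing Φ] [LieRing L] [LieAlgebra Φ L]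

/-- The centralizer of an ideal, as an ideal. -/
def centralizer (I : LieIdeal Φ L) : LieIdeal Φ L where
  carrier := {c | ∀ k ∈ I, ⁅c, k⁆ = 0}
  add_mem' ha hb k hk := by rw [add_lie, ha k hk, hb k hk, add_zero]
  zero_mem' k _ := zero_lie k
  smul_mem' t c hc k hk := by rw [smul_lie, hc k hk, smul_zero]
  lie_mem {x c} hc k hk := by
    rw [lie_lie, hc k hk, lie_zero, hc _ (lie_mem_right Φ L I x k hk), sub_zero]

/-- The intersection of $I$ with its centralizer has zero square, so it is zero by semiprimeness,
and then the centralizer is zero because $I$ is essential. -/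
theorem IsEssential.eq_zero_of_lie [Semiprime Φ L] {I : LieIdeal Φ L} (hI : IsEssential I) {c : L}
    (hc : ∀ k ∈ I, ⁅c, k⁆ = 0) : c = 0 := by
  by_contra h0
  have hC : centralizer I ≠ ⊥ := (ne_bot_iff_mem _).mpr ⟨c, hc, h0⟩
  refine Semiprime.lie_self_ne_bot (Φ := Φ) (L := L) _ (hI _ hC) (le_bot_iff.mp ?_)
  rw [LieSubmodule.lieIdeal_oper_eq_span, LieSubmodule.lieSpan_le]
  rintro _ ⟨a, b, rfl⟩
  have ha := ((LieSubmodule.mem_inf _ _ _).mp a.2).2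
  have hb := ((LieSubmodule.mem_inf _ _ _).mp b.2).1
  exact (LieSubmodule.mem_bot _).mpr (ha _ hb)

/-- Converse criterion, valid without semiprimeness: if $I\cap J=0$ then $[J,I]\subseteq I\cap J=0$,
so $J$ centralizes $I$. -/
theorem isEssential_of_centralizer {I : LieIdeal Φ L}
    (h : ∀ c : L, (∀ k ∈ I, ⁅c, k⁆ = 0) → c = 0) : IsEssential I := by
  intro J hJ hIJ
  obtain ⟨z, hz, hz0⟩ := (ne_bot_iff_mem _).mp hJ
  refine hz0 (h z fun k hk => ?_)
  have : ⁅z, k⁆ ∈ I ⊓ J :=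
    (LieSubmodule.mem_inf _ _ _).mpr ⟨lie_mem_right Φ L I z k hk, lie_mem_left Φ L J z k hz⟩
  rwa [hIJ, LieSubmodule.mem_bot] at this

theorem Qm.ind {P : Qm Φ L → Prop}
    (h : ∀ (I : LieIdeal Φ L) (hI : IsEssential I) (a : PDer I), P (Qm.mk hI a)) (p : Qm Φ L) :
    P p :=
  Qm.ind₃ (P := fun p _ _ => P p) (fun I hI a _ _ => h I hI a) p p p

theorem Qm.ind₂ {P : Qm Φ L → Qm Φ L → Prop}
    (h : ∀ (I : LieIdeal Φ L) (hI : IsEssential I) (a b : PDer I), P (Qm.mk hI a) (Qm.mk hI b))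
    (p q : Qm Φ L) : P p q :=
  Qm.ind₃ (P := fun p q _ => P p q) (fun I hI a b _ => h I hI a b) p q q

theorem Qm.exact {I J : LieIdeal Φ L} {hI : IsEssential I} {hJ : IsEssential J} {δ : PDer I}
    {μ : PDer J} (h : Qm.mk hI δ = Qm.mk hJ μ) :
    ∃ (K : LieIdeal Φ L) (_ : IsEssential K) (hKI : K ≤ I) (hKJ : K ≤ J),
      ∀ (x : L) (hx : x ∈ K), δ.1 ⟨x, hKI hx⟩ = μ.1 ⟨x, hKJ hx⟩ := by
  obtain ⟨K, hKI, hKJ, e⟩ := Quotient.exact h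
  refine ⟨(OrderDual.ofDual K).1, (OrderDual.ofDual K).2, hKI, hKJ, fun x hx => ?_⟩
  exact congrArg (fun d : PDer (OrderDual.ofDual K).1 => d.1 ⟨x, hx⟩) e

theorem Qm.mk_eq_zero {I : LieIdeal Φ L} (hI : IsEssential I) {δ : PDer I}
    (h : ∀ (x : L) (hx : x ∈ I), δ.1 ⟨x, hx⟩ = 0) : Qm.mk hI δ = 0 := by
  rw [← Qm.mk_zero hI]
  congr 1
  exact PDer.ext' h

/-- This is the Leibniz rule for $\delta[a,x]$. It is the rule by which brackets of a class with
elements of $L$ are evaluated, and so how a quotient is pushed back into $L$. -/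
theorem Qm.mk_lie_of [Semiprime Φ L] {I : LieIdeal Φ L} (hI : IsEssential I) (δ : PDer I)
    {a : L} (ha : a ∈ I) :
    ⁅Qm.mk hI δ, Qm.of Φ L a⁆ = Qm.of Φ L (δ.1 ⟨a, ha⟩) := by
  change ⁅Qm.mk hI δ, Qm.mk IsEssential.top (PDer.ad a)⁆ = Qm.mk IsEssential.top _
  rw [← Qm.mk_restrict IsEssential.top hI le_top (PDer.ad a), Qm.mk_lie]
  refine Qm.sound _ _ hI.lie_self le_rfl le_top _ _ fun x hx => ?_
  have hx' : x ∈ I := lie_self_le I hx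
  rw [PDer.bracket_apply]
  change δ.1 ⟨⁅a, x⁆, _⟩ - ⁅a, δ.1 ⟨x, hx'⟩⁆ = ⁅δ.1 ⟨a, ha⟩, x⁆
  exact sub_eq_of_eq_add (PDer.apply_lie δ ha hx' _)

theorem Qm.of_lie [Semiprime Φ L] (a b : L) : Qm.of Φ L ⁅a, b⁆ = ⁅Qm.of Φ L a, Qm.of Φ L b⁆ :=
  (Qm.mk_lie_of IsEssential.top (PDer.ad a) (LieSubmodule.mem_top b)).symm

theorem Qm.of_injective [Semiprime Φ L] : Function.Injective (Qm.of Φ L) := by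
  refine (injective_iff_map_eq_zero _).mpr fun a ha => ?_
  obtain ⟨K, hK, _, _, h⟩ := Qm.exact (ha.trans (Qm.mk_zero (Φ := Φ) (L := L) IsEssential.top).symm)
  exact hK.eq_zero_of_lie h

theorem Qm.conj_add (e : L ≃ₗ⁅Φ⁆ L) (p q : Qm Φ L) :
    Qm.conj e (p + q) = Qm.conj e p + Qm.conj e q := by
  refine Qm.ind₂ (P := fun p q => Qm.conj e (p + q) = Qm.conj e p + Qm.conj e q)
    (fun I hI a b => ?_) p q
  rw [← Qm.mk_add, Qm.conj_mk, Qm.conj_mk, Qm.conj_mk, ← Qm.mk_add]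
  congr 1
  exact PDer.ext' fun x hx => map_add e _ _

theorem Qm.conj_smul (e : L ≃ₗ⁅Φ⁆ L) (c : Φ) (p : Qm Φ L) :
    Qm.conj e (c • p) = c • Qm.conj e p := by
  refine Qm.ind (P := fun p => Qm.conj e (c • p) = c • Qm.conj e p) (fun I hI a => ?_) p
  rw [← Qm.mk_smul, Qm.conj_mk, Qm.conj_mk, ← Qm.mk_smul]
  congr 1
  exact PDer.ext' fun x hx => map_smul e _ _

/-- Conjugating a bracket gives a derivation on $e([I,I])$, while the bracket of the conjugates
lives on $[e(I),e(I)]$; the inclusion gives an ideal on which the two can be compared. -/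
theorem comap_lie_self_le (e : L ≃ₗ⁅Φ⁆ L) (I : LieIdeal Φ L) :
    (⁅I.comap (e.symm : L →ₗ⁅Φ⁆ L), I.comap (e.symm : L →ₗ⁅Φ⁆ L)⁆ : LieIdeal Φ L) ≤
      (⁅I, I⁆ : LieIdeal Φ L).comap (e.symm : L →ₗ⁅Φ⁆ L) := by
  rw [LieSubmodule.lieIdeal_oper_eq_span, LieSubmodule.lieSpan_le]
  rintro _ ⟨a, b, rfl⟩
  change e.symm ⁅(a : L), (b : L)⁆ ∈ ⁅I, I⁆
  rw [LieEquiv.map_lie]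
  exact LieSubmodule.lie_mem_lie a.2 b.2

theorem Qm.conj_lie [Semiprime Φ L] (e : L ≃ₗ⁅Φ⁆ L) (p q : Qm Φ L) :
    Qm.conj e ⁅p, q⁆ = ⁅Qm.conj e p, Qm.conj e q⁆ := by
  refine Qm.ind₂ (P := fun p q => Qm.conj e ⁅p, q⁆ = ⁅Qm.conj e p, Qm.conj e q⁆)
    (fun I hI a b => ?_) p q
  rw [Qm.mk_lie, Qm.conj_mk, Qm.conj_mk, Qm.conj_mk, Qm.mk_lie]
  refine Qm.sound _ _ (hI.comap e).lie_self (comap_lie_self_le e I) le_rfl _ _ fun x hx => ?_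
  have hx' : e.symm x ∈ ⁅I, I⁆ := comap_lie_self_le e I hx
  have k : ∀ (f g : PDer I) (h : e.symm (e (g.1 ⟨e.symm x, lie_self_le I hx'⟩)) ∈ I),
      f.1 ⟨e.symm (e (g.1 ⟨e.symm x, lie_self_le I hx'⟩)), h⟩ =
        f.1 ⟨g.1 ⟨e.symm x, lie_self_le I hx'⟩, PDer.apply_mem g hx' _⟩ := by
    intro f g h
    congr 2
    exact e.symm_apply_apply _
  rw [PDer.bracket_apply]
  change e ((PDer.bracket a b).1 ⟨e.symm x, hx'⟩) =
    e (a.1 ⟨e.symm (e (b.1 ⟨e.symm x, _⟩)), _⟩) - e (b.1 ⟨e.symm (e (a.1 ⟨e.symm x, _⟩)), _⟩)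
  rw [PDer.bracket_apply, map_sub]
  exact (congrArg₂ (fun u v => e u - e v) (k a b _) (k b a _)).symm

theorem Qm.conj_of (e : L ≃ₗ⁅Φ⁆ L) (a : L) :
    Qm.conj e (Qm.of Φ L a) = Qm.of Φ L (e a) := by
  change Qm.conj e (Qm.mk _ _) = Qm.mk _ _
  rw [Qm.conj_mk]
  refine Qm.sound _ _ (IsEssential.top.comap e) le_rfl le_top _ _ fun x hx => ?_
  change e ⁅a, e.symm x⁆ = ⁅e a, x⁆
  rw [LieEquiv.map_lie, LieEquiv.apply_symm_apply]

theorem Qm.conj_conj {e : L ≃ₗ⁅Φ⁆ L} (he : ∀ a, e (e a) = a) (p : Qm Φ L) :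
    Qm.conj e (Qm.conj e p) = p := by
  refine Qm.ind (P := fun p => Qm.conj e (Qm.conj e p) = p) (fun I hI a => ?_) p
  have hs : ∀ x, e.symm (e.symm x) = x := fun x => by
    conv_lhs => rw [← he x, LieEquiv.symm_apply_apply, LieEquiv.symm_apply_apply]
  rw [Qm.conj_mk, Qm.conj_mk]
  refine Qm.sound _ _ hI (fun x hx => ?_) le_rfl _ _ fun x hx => ?_
  · change e.symm (e.symm x) ∈ I
    rwa [hs]
  · change e (e (a.1 ⟨e.symm (e.symm x), _⟩)) = a.1 ⟨x, hx⟩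
    rw [he]
    congr 2
    exact hs x

end Basic

/-! ### From elements of an overalgebra absorbed by essential ideals to $Q_m(L)$ -/

section Extension

variable {Φ L M : Type*} [CommRing Φ] [LieRing L] [LieAlgebra Φ L] [LieRing M] [LieAlgebra Φ M]
  {φ : L →ₗ⁅Φ⁆ M} (hφ : Function.Injective φ)

/-- The ideal `I` of `L` absorbs `m ∈ M` into `L`, where `L` is mapped to `M` by `φ`. -/
def Absorbs (φ : L →ₗ⁅Φ⁆ M) (I : LieIdeal Φ L) (m : M) : Prop :=
  ∀ k ∈ I, ∃ l : L, φ l = ⁅m, φ k⁆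

theorem Absorbs.mono {I J : LieIdeal Φ L} {m : M} (h : Absorbs φ I m) (hJ : J ≤ I) :
    Absorbs φ J m := fun k hk => h k (hJ hk)

theorem Absorbs.add {I : LieIdeal Φ L} {m n : M}
    (hm : Absorbs φ I m) (hn : Absorbs φ I n) : Absorbs φ I (m + n) := fun k hk => by
  obtain ⟨a, ha⟩ := hm k hk
  obtain ⟨b, hb⟩ := hn k hk
  exact ⟨a + b, by rw [map_add, ha, hb, add_lie]⟩

theorem Absorbs.smul {I : LieIdeal Φ L} {m : M} (c : Φ) (hm : Absorbs φ I m) :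
    Absorbs φ I (c • m) := fun k hk => by
  obtain ⟨a, ha⟩ := hm k hk
  exact ⟨c • a, by rw [map_smul, ha, smul_lie]⟩

theorem absorbs_range (l : L) : Absorbs φ ⊤ (φ l) := fun k _ => ⟨⁅l, k⁆, LieHom.map_lie φ l k⟩

/-- The derivation `φ⁻¹ ∘ ad m ∘ φ`. -/
noncomputable def Absorbs.der {I : LieIdeal Φ L} {m : M} (h : Absorbs φ I m) : PDer I :=
  ⟨{ toFun := fun k => (h k k.2).choose
     map_add' := fun a b => hφ (by
      rw [map_add, (h _ (a + b).2).choose_spec, (h _ a.2).choose_spec, (h _ b.2).choose_spec,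
        ← lie_add, ← map_add]
      rfl)
     map_smul' := fun c a => hφ (by
      rw [RingHom.id_apply, map_smul, (h _ (c • a).2).choose_spec, (h _ a.2).choose_spec,
        ← lie_smul, ← map_smul]
      rfl) }, fun a b => hφ (by
    have ea : φ (h a a.2).choose = _ := (h _ a.2).choose_spec
    have eb : φ (h b b.2).choose = _ := (h _ b.2).choose_spec
    change φ (h _ ⁅a, b⁆.2).choose = φ (⁅(h a a.2).choose, (b : L)⁆ + ⁅(a : L), (h b b.2).choose⁆)
    rw [(h _ ⁅a, b⁆.2).choose_spec, map_add, LieHom.map_lie, LieHom.map_lie, ea, eb,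
      ← leibniz_lie, ← LieHom.map_lie]
    rfl)⟩

theorem Absorbs.map_der {I : LieIdeal Φ L} {m : M} (h : Absorbs φ I m) {k : L} (hk : k ∈ I) :
    φ ((h.der hφ).1 ⟨k, hk⟩) = ⁅m, φ k⁆ := (h k hk).choose_spec

open Classical in
/-- The map to `Q_m(L)` from the elements of `M` that are absorbed into `L` by an essential
ideal. -/
noncomputable def quotMap (m : M) : Qm Φ L :=
  if h : ∃ I : LieIdeal Φ L, IsEssential I ∧ Absorbs φ I m then
    Qm.mk h.choose_spec.1 (h.choose_spec.2.der hφ) else 0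

/-- Independence of the chosen ideal: two derivations induced by $m$ agree on the intersection of
their domains, since both are $\mathrm{ad}\,m$ read through the injection $\varphi$. -/
theorem quotMap_eq {I : LieIdeal Φ L} (hI : IsEssential I) {m : M} (h : Absorbs φ I m) :
    quotMap hφ m = Qm.mk hI (h.der hφ) := by
  have h' : ∃ I : LieIdeal Φ L, IsEssential I ∧ Absorbs φ I m := ⟨I, hI, h⟩
  rw [quotMap, dif_pos h']
  refine Qm.sound _ _ (h'.choose_spec.1.inf hI) inf_le_left inf_le_right _ _ fun x hx => hφ ?_
  rw [Absorbs.map_der, Absorbs.map_der]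

theorem quotMap_add {I : LieIdeal Φ L} (hI : IsEssential I) {m n : M} (hm : Absorbs φ I m)
    (hn : Absorbs φ I n) : quotMap hφ (m + n) = quotMap hφ m + quotMap hφ n := by
  rw [quotMap_eq hφ hI hm, quotMap_eq hφ hI hn, quotMap_eq hφ hI (hm.add hn), ← Qm.mk_add]
  congr 1
  refine PDer.ext' fun x hx => hφ ?_
  change _ = φ ((hm.der hφ).1 ⟨x, hx⟩ + (hn.der hφ).1 ⟨x, hx⟩)
  rw [map_add, Absorbs.map_der, Absorbs.map_der, Absorbs.map_der, add_lie]

theorem quotMap_smul {I : LieIdeal Φ L} (hI : IsEssential I) {m : M} (c : Φ)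
    (hm : Absorbs φ I m) : quotMap hφ (c • m) = c • quotMap hφ m := by
  rw [quotMap_eq hφ hI hm, quotMap_eq hφ hI (hm.smul c), ← Qm.mk_smul]
  congr 1
  refine PDer.ext' fun x hx => hφ ?_
  change _ = φ (c • (hm.der hφ).1 ⟨x, hx⟩)
  rw [map_smul, Absorbs.map_der, Absorbs.map_der, smul_lie]

theorem quotMap_range (l : L) : quotMap hφ (φ l) = Qm.of Φ L l := by
  rw [quotMap_eq hφ IsEssential.top (absorbs_range l)]
  refine Qm.sound _ _ IsEssential.top le_rfl le_rfl _ _ fun x hx => hφ ?_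
  rw [Absorbs.map_der]
  exact (LieHom.map_lie φ l x).symm

/-- Expand $[[m,n],k]=[m,[n,k]]-[n,[m,k]]$. The passage to $[I,I]$ is needed because a derivation
$I\to L$ maps $[I,I]$ back into $I$, so that a second bracket can be absorbed. -/
theorem Absorbs.lie (hφ : Function.Injective φ) {I : LieIdeal Φ L} {m n : M} (hm : Absorbs φ I m)
    (hn : Absorbs φ I n) : Absorbs φ ⁅I, I⁆ ⁅m, n⁆ := fun k hk => by
  have hk' := lie_self_le I hk
  refine ⟨(hm.der hφ).1 ⟨_, PDer.apply_mem (hn.der hφ) hk hk'⟩ -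
    (hn.der hφ).1 ⟨_, PDer.apply_mem (hm.der hφ) hk hk'⟩, ?_⟩
  rw [map_sub, Absorbs.map_der, Absorbs.map_der, Absorbs.map_der, Absorbs.map_der, lie_lie]

theorem quotMap_lie [Semiprime Φ L] {I : LieIdeal Φ L} (hI : IsEssential I) {m n : M}
    (hm : Absorbs φ I m) (hn : Absorbs φ I n) :
    quotMap hφ ⁅m, n⁆ = ⁅quotMap hφ m, quotMap hφ n⁆ := by
  rw [quotMap_eq hφ hI hm, quotMap_eq hφ hI hn, Qm.mk_lie,
    quotMap_eq hφ hI.lie_self (Absorbs.lie hφ hm hn)]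
  congr 1
  refine PDer.ext' fun x hx => hφ ?_
  rw [PDer.bracket_apply, map_sub, Absorbs.map_der, Absorbs.map_der, Absorbs.map_der,
    Absorbs.map_der, Absorbs.map_der, lie_lie]

theorem Absorbs.conj {e : L ≃ₗ⁅Φ⁆ L} {e' : M ≃ₗ⁅Φ⁆ M} (he : ∀ l, φ (e l) = e' (φ l))
    {I : LieIdeal Φ L} {m : M} (hm : Absorbs φ I m) :
    Absorbs φ (I.comap (e.symm : L →ₗ⁅Φ⁆ L)) (e' m) := fun k hk => by
  obtain ⟨l, hl⟩ := hm (e.symm k) hk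
  refine ⟨e l, ?_⟩
  rw [he, hl, LieEquiv.map_lie, ← he, LieEquiv.apply_symm_apply]

theorem quotMap_conj {e : L ≃ₗ⁅Φ⁆ L} {e' : M ≃ₗ⁅Φ⁆ M} (he : ∀ l, φ (e l) = e' (φ l))
    {I : LieIdeal Φ L} (hI : IsEssential I) {m : M} (hm : Absorbs φ I m) :
    quotMap hφ (e' m) = Qm.conj e (quotMap hφ m) := by
  rw [quotMap_eq hφ hI hm, Qm.conj_mk, quotMap_eq hφ (hI.comap e) (hm.conj he)]
  congr 1
  refine PDer.ext' fun x hx => hφ ?_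
  rw [Absorbs.map_der]
  change _ = φ (e ((hm.der hφ).1 ⟨e.symm x, hx⟩))
  refine Eq.trans ?_ (he _).symm
  refine Eq.trans ?_ (congrArg e' (hm.map_der hφ hx)).symm
  rw [LieEquiv.map_lie, ← he]
  exact congrArg (fun t => ⁅e' m, φ t⁆) (e.apply_symm_apply x).symm

end Extension

end LieQuot

/-! ### Symmetric trilinear maps -/

theorem eq_zero_of_two_nsmul {Φ A : Type*} [CommRing Φ] [AddCommGroup A] [Module Φ A]
    (h6 : IsUnit (6 : Φ)) {x : A} (h : (2 : ℕ) • x = 0) : x = 0 := by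
  refine h6.smul_eq_zero.mp ?_
  have : (6 : Φ) • x = (3 : ℕ) • (2 : ℕ) • x := by
    rw [← mul_nsmul, ← Nat.cast_smul_eq_nsmul Φ]
    norm_num
  rw [this, h, smul_zero]

theorem eq_zero_of_three_nsmul {Φ A : Type*} [CommRing Φ] [AddCommGroup A] [Module Φ A]
    (h6 : IsUnit (6 : Φ)) {x : A} (h : (3 : ℕ) • x = 0) : x = 0 := by
  refine h6.smul_eq_zero.mp ?_
  have : (6 : Φ) • x = (2 : ℕ) • (3 : ℕ) • x := by
    rw [← mul_nsmul, ← Nat.cast_smul_eq_nsmul Φ]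
    norm_num
  rw [this, h, smul_zero]

/-- In a totally symmetric triple system whose operators `S x y` are derivations, the cube `u` of an
element satisfies `S u u = 0`. -/
theorem symm_triple_cube {A : Type*} [AddCommGroup A] (h2 : ∀ a : A, (2 : ℕ) • a = 0 → a = 0)
    (S : A → A → A → A) (h0 : ∀ y z, S 0 y z = 0) (h12 : ∀ x y z, S x y z = S y x z)
    (h23 : ∀ x y z, S x y z = S x z y)
    (hd : ∀ x y u v z, S x y (S u v z) = S (S x y u) v z + S u (S x y v) z + S u v (S x y z))
    (y w : A) : S (S y y y) (S y y y) w = 0 := by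
  have h13 : ∀ x y z, S x y z = S z y x := fun x y z => by rw [h12, h23, h12]
  set u := S y y y with hu
  have hyyu : S y y u = 0 := by
    -- The derivation $S_{y,y}$ applied to $u=S(y,y,y)$ gives $S(y,y,u)=3S(y,y,u)$, hence
    -- $2S(y,y,u)=0$.
    have h := hd y y y y y
    rw [← hu, h13 u y y, h23 y u y] at h
    refine h2 _ ?_
    rw [add_assoc] at h
    rw [two_nsmul]
    exact left_eq_add.mp h
  -- The commutator of $S_{y,y}$ and $S_{y,u}$ at $w$ is computed in two ways: by the derivation
  -- property of $S_{y,y}$ it is $S(u,u,w)$, by that of $S_{y,u}$ it is zero.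
  have h1 := hd y y y u w
  have h3 := hd y u y y w
  rw [← hu, hyyu, h12 y 0 w, h0, add_zero] at h1
  rw [h23 y u y, hyyu, h0, h12 y 0 w, h0, add_zero, zero_add] at h3
  rw [h3] at h1
  exact (right_eq_add.mp h1)

/-- The cube of $a+b$ gives $3F(a,a,b)+3F(a,b,b)=0$; subtracting the same relation for $-b$ leaves
$6F(a,a,b)=0$. Additivity in the other two variables comes from symmetry. -/
theorem symm_triple_polarize {A B : Type*} [AddCommGroup A] [AddCommGroup B]
    (h2 : ∀ b : B, (2 : ℕ) • b = 0 → b = 0) (h3 : ∀ b : B, (3 : ℕ) • b = 0 → b = 0)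
    (F : A → A → A → B) (hadd : ∀ x x' y z, F (x + x') y z = F x y z + F x' y z)
    (h12 : ∀ x y z, F x y z = F y x z) (h23 : ∀ x y z, F x y z = F x z y)
    (hF : ∀ y, F y y y = 0) (y w : A) : F y y w = 0 := by
  have h13 : ∀ x y z, F x y z = F z y x := fun x y z => by rw [h12, h23, h12]
  have cube : ∀ a b, (3 : ℕ) • F a a b + (3 : ℕ) • F a b b = 0 := fun a b => by
    have h := hF (a + b)
    rw [hadd, h12 a, h12 b, hadd, hadd, h13 a a, h13 b a, h13 a b, h13 b b, hadd, hadd, hadd, hadd,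
      hF, hF] at h
    rw [h13 b a a, h12 b a b, h13 b b a] at h
    rw [h12 a b a, h23 b a a, h13 b a a] at h
    rw [← h]
    abel
  have hneg : ∀ a b c, F (-a) b c = -F a b c := fun a b c => by
    have h := hadd a (-a) b c
    have h0 := hadd 0 0 b c
    rw [add_zero] at h0
    rw [add_neg_cancel, left_eq_add.mp h0] at h
    exact (neg_eq_of_add_eq_zero_right h.symm).symm
  refine h2 _ (h3 _ ?_)
  have e1 := cube y w
  have e2 := cube y (-w)
  rw [h13 y y (-w), hneg, h12 y (-w) (-w), hneg, h12 w y (-w), h13 y w (-w), hneg, neg_neg,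
    h13 w y y, h13 w w y] at e2
  have : (3 : ℕ) • (2 : ℕ) • F y y w =
    ((3 : ℕ) • F y y w + (3 : ℕ) • F y w w) - ((3 : ℕ) • -F y y w + (3 : ℕ) • F y w w) := by abel
  rw [this, e1, e2, sub_zero]

/-- If `ad X` is nilpotent of index `3`, then `(ad [[X, W], X])² = X²W²X²`. -/
theorem sq_jordan_identity {R : Type*} [Ring R] {X W : R} (h : X * X * X = 0)
    (hXW : X * X * W * X = X * W * X * X) :
    ((X * W - W * X) * X - X * (X * W - W * X)) * ((X * W - W * X) * X - X * (X * W - W * X)) =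
      X * X * W * W * X * X := by
  have e0 : X * X * W * X * X = 0 := by
    rw [hXW, mul_assoc, mul_assoc, ← mul_assoc X X X, h, mul_zero]
  have e1 : X * W * X * W * X * X = X * W * X * X * W * X := by
    have e : X * W * (X * X * W * X) = X * W * (X * W * X * X) := by rw [hXW]
    simp only [mul_assoc] at e ⊢
    exact e.symm
  have e2 : X * X * W * X * W * X = X * W * X * X * W * X := by rw [hXW]
  -- Apart from $X^2W^2X^2$, each word of the expansion contains $X^3$ or $X^2WX^2$, both zero, or
  -- is one of three words that coincide by `e1` and `e2` and have coefficients $4,-2,-2$.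
  have key : ((X * W - W * X) * X - X * (X * W - W * X)) *
      ((X * W - W * X) * X - X * (X * W - W * X)) = X * X * W * W * X * X
      + (4 • (X * W * X * X * W * X) - 2 • (X * X * W * X * W * X) - 2 • (X * W * X * W * X * X))
      + X * X * W * X * X * W + W * (X * X * W * X * X)
      - 2 • (X * W * (X * X * X) * W) - 2 • (W * (X * X * X) * W * X)
      + W * (X * X * X) * X * W := by
    simp only [mul_sub, sub_mul, mul_assoc]
    abel
  have e3 : ∀ a : R, 4 • a - 2 • a - 2 • a = 0 := fun a => by abel
  rw [key, e0, h, e1, e2, e3]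
  simp only [mul_zero, zero_mul, smul_zero, add_zero, sub_zero]

/-! ### Derivations of degree two -/

namespace JordanTripleSystem

variable {Φ T : Type*} [CommRing Φ] [AddCommGroup T] [Module Φ T] [JordanTripleSystem Φ T]

/-- Put $S(x,y,z)=\{x,\delta y,z\}$ and $F(x,y,z)=\{\delta x,y,\delta z\}$. The first two relations,
with the outer symmetry of the triple product, make both totally symmetric, and the third gives
$\delta S=-F$. Cubes for $S$ are then killed by $\delta$, so $F$ vanishes on the diagonal, hence
$F(y,y,w)=\{\delta y,w,\delta y\}=0$ by polarization. The last hypothesis is the form of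
nondegeneracy available when only elements of $N$ can be tested. -/
theorem degree_two_eq_zero (h6 : IsUnit (6 : Φ)) (N : Submodule Φ T)
    (hN : ∀ y ∈ N, ∀ (x : T), ∀ z ∈ N, triple (Φ := Φ) y x z ∈ N) (δ : N →ₗ[Φ] T)
    (h1 : ∀ (y z : N) (v : T), triple (Φ := Φ) (δ y) z v = triple (Φ := Φ) (δ z) y v)
    (h2 : ∀ (y z : N) (v : T), triple (Φ := Φ) (z : T) (δ y) v = triple (Φ := Φ) (y : T) (δ z) v)
    (h3 : ∀ (y : N) (x : T) (z : N), δ ⟨triple (Φ := Φ) (y : T) x z, hN y y.2 x z z.2⟩ =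
      -triple (Φ := Φ) x y (δ z))
    (h4 : ∀ y : N, (∀ w : N, triple (Φ := Φ) (δ y) w (δ y) = 0) → δ y = 0) : δ = 0 := by
  let S : N → N → N → N := fun x y z => ⟨triple (Φ := Φ) (x : T) (δ y) z, hN x x.2 _ z z.2⟩
  let F : N → N → N → T := fun x y z => triple (Φ := Φ) (δ x) y (δ z)
  have F12 : ∀ x y z, F x y z = F y x z := fun x y z => h1 x y _
  have F13 : ∀ x y z, F x y z = F z y x := fun x y z => triple_comm _ _ _
  have F23 : ∀ x y z, F x y z = F x z y := fun x y z => by rw [F12, F13, F12]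
  have S12 : ∀ x y z, S x y z = S y x z := fun x y z => Subtype.ext (h2 y x z)
  have S13 : ∀ x y z, S x y z = S z y x := fun x y z => Subtype.ext (triple_comm _ _ _)
  have S23 : ∀ x y z, S x y z = S x z y := fun x y z => by rw [S12, S13, S12]
  have δS : ∀ x y z, δ (S x y z) = -F x y z := fun x y z => by
    rw [F12]
    exact h3 x (δ y) z
  -- The minus sign in the middle term of the Jordan identity is cancelled by the one in $\delta
  -- S=-F$, so $S_{x,y}$ is an honest derivation of $S$.
  have hd : ∀ x y u v z, S x y (S u v z) = S (S x y u) v z + S u (S x y v) z + S u v (S x y z) := by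
    intro x y u v z
    refine Subtype.ext ?_
    change triple (Φ := Φ) (x : T) (δ y) (triple (Φ := Φ) (u : T) (δ v) z) =
      triple (Φ := Φ) (triple (Φ := Φ) (x : T) (δ y) u) (δ v) z +
        triple (Φ := Φ) (u : T) (δ (S x y v)) z +
        triple (Φ := Φ) (u : T) (δ v) (triple (Φ := Φ) (x : T) (δ y) z)
    rw [δS, F12, triple_jordan]
    change _ = _ + triple (Φ := Φ) (u : T) (-triple (Φ := Φ) (δ y) x (δ v)) z + _
    rw [map_neg, LinearMap.neg_apply, sub_eq_add_neg]
  have F0 : ∀ y, F y y y = 0 := by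
    intro y
    -- With $u=S(y,y,y)$, applying $\delta$ to $S(u,u,w)=0$ gives $F(u,u,w)=0$, which by symmetry is
    -- $\{\delta u,w,\delta u\}=0$; so $\delta u=-F(y,y,y)$ vanishes.
    have hu : ∀ w, F (S y y y) w (S y y y) = 0 := fun w => by
      have h := δS (S y y y) (S y y y) w
      rw [symm_triple_cube (fun a => eq_zero_of_two_nsmul h6) S
        (fun y z => Subtype.ext (by
          change triple (Φ := Φ) (0 : T) (δ y) z = 0
          rw [map_zero, LinearMap.zero_apply, LinearMap.zero_apply])) S12 S23 hd, map_zero] at h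
      rw [F23]
      exact neg_eq_zero.mp h.symm
    have := h4 _ hu
    rw [δS] at this
    exact neg_eq_zero.mp this
  refine LinearMap.ext fun y => h4 y fun w => ?_
  have h := symm_triple_polarize (fun b => eq_zero_of_two_nsmul h6)
    (fun b => eq_zero_of_three_nsmul h6) F (fun x x' y z => by
      change triple (Φ := Φ) (δ (x + x')) y (δ z) = _
      rw [map_add, map_add]
      rfl) F12 F23 F0 y w
  rw [F23] at h
  exact h

end JordanTripleSystem

/-! ### Homogeneous ideals of the Tits-Kantor-Koecher algebra -/

namespace JordanPair

namespace TKK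

section

variable {Φ Vp Vm : Type*} [CommRing Φ] [AddCommGroup Vp] [Module Φ Vp]
  [AddCommGroup Vm] [Module Φ Vm] [JordanPair Φ Vp Vm]

instance : Zero (IDer Φ Vp Vm) := inferInstance
noncomputable instance : Zero (TKK Φ Vp Vm) := inferInstance
instance : Neg (IDer Φ Vp Vm) := inferInstance
noncomputable instance : Neg (TKK Φ Vp Vm) := inferInstance
instance : AddGroup (IDer Φ Vp Vm) := inferInstance
noncomputable instance : AddGroup (TKK Φ Vp Vm) := inferInstance

@[simp] theorem inner_zero_left (y : Vm) : inner Φ (0 : Vp) y = 0 := by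
  rw [← sub_self (0 : Vp), inner_sub_left, sub_self]

@[simp] theorem inner_zero_right (x : Vp) : inner Φ x (0 : Vm) = 0 := by
  rw [← sub_self (0 : Vm), inner_sub_right, sub_self]

@[simp] theorem zero_fst (x : Vp) : (0 : IDer Φ Vp Vm).1.1 x = 0 := rfl

@[simp] theorem zero_snd (y : Vm) : (0 : IDer Φ Vp Vm).1.2 y = 0 := rfl

theorem mk_add (x x' : Vp) (γ γ' : IDer Φ Vp Vm) (y y' : Vm) :
    mk x γ y + mk x' γ' y' = mk (x + x') (γ + γ') (y + y') := rfl

theorem mk_neg (x : Vp) (γ : IDer Φ Vp Vm) (y : Vm) : -mk x γ y = mk (-x) (-γ) (-y) := rfl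

theorem mk_smul (c : Φ) (x : Vp) (γ : IDer Φ Vp Vm) (y : Vm) :
    c • mk x γ y = mk (c • x) (c • γ) (c • y) := rfl

theorem eq_sum (a : TKK Φ Vp Vm) : a = mk a.pos 0 0 + mk 0 a.der 0 + mk 0 0 a.neg :=
  ext (by simp) (by simp) (by simp)

theorem lie_pos_pos (x y : Vp) : ⁅(mk x 0 0 : TKK Φ Vp Vm), (mk y 0 0 : TKK Φ Vp Vm)⁆ = 0 :=
  ext (by simp [pos_lie]) (by simp [der_lie]) (by simp [neg_lie])

theorem lie_neg_neg (x y : Vm) : ⁅(mk 0 0 x : TKK Φ Vp Vm), (mk 0 0 y : TKK Φ Vp Vm)⁆ = 0 :=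
  ext (by simp [pos_lie]) (by simp [der_lie]) (by simp [neg_lie])

theorem lie_pos_neg (x : Vp) (y : Vm) :
    ⁅(mk x 0 0 : TKK Φ Vp Vm), mk 0 0 y⁆ = mk 0 (inner Φ x y) 0 :=
  ext (by simp [pos_lie]) (by simp [der_lie]) (by simp [neg_lie])

theorem lie_neg_pos (x : Vp) (y : Vm) :
    ⁅(mk 0 0 y : TKK Φ Vp Vm), mk x 0 0⁆ = mk 0 (-inner Φ x y) 0 :=
  ext (by simp [pos_lie]) (by simp [der_lie]) (by simp [neg_lie])

theorem lie_der_pos (γ : IDer Φ Vp Vm) (x : Vp) :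
    ⁅(mk 0 γ 0 : TKK Φ Vp Vm), (mk x 0 0 : TKK Φ Vp Vm)⁆ = mk (γ.1.1 x) 0 0 :=
  ext (by simp [pos_lie]) (by simp [der_lie]) (by simp [neg_lie])

theorem lie_der_neg (γ : IDer Φ Vp Vm) (y : Vm) :
    ⁅(mk 0 γ 0 : TKK Φ Vp Vm), (mk 0 0 y : TKK Φ Vp Vm)⁆ = mk 0 0 (γ.1.2 y) :=
  ext (by simp [pos_lie]) (by simp [der_lie]) (by simp [neg_lie])

theorem lie_pos_der (γ : IDer Φ Vp Vm) (x : Vp) :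
    ⁅(mk x 0 0 : TKK Φ Vp Vm), mk 0 γ 0⁆ = mk (-γ.1.1 x) 0 0 :=
  ext (by simp [pos_lie]) (by simp [der_lie]) (by simp [neg_lie])

theorem lie_neg_der (γ : IDer Φ Vp Vm) (y : Vm) :
    ⁅(mk 0 0 y : TKK Φ Vp Vm), mk 0 γ 0⁆ = mk 0 0 (-γ.1.2 y) :=
  ext (by simp [pos_lie]) (by simp [der_lie]) (by simp [neg_lie])

theorem lie_der_der (γ μ : IDer Φ Vp Vm) :
    ⁅(mk 0 γ 0 : TKK Φ Vp Vm), mk 0 μ 0⁆ = mk 0 ⁅γ, μ⁆ 0 :=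
  ext (by simp [pos_lie]) (by simp [der_lie]) (by simp [neg_lie])

theorem lie_pos (x : Vp) (a : TKK Φ Vp Vm) :
    ⁅(mk x 0 0 : TKK Φ Vp Vm), a⁆ = mk (-a.der.1.1 x) (inner Φ x a.neg) 0 :=
  ext (by simp [pos_lie]) (by simp [der_lie]) (by simp [neg_lie])

/-- It turns the quadratic operator of $x$ into $(\mathrm{ad}\,x)^2$, so that quadratic Jordan
identities can be checked in the associative algebra $\mathrm{End}(L)$. -/
theorem lie_lie_pos (x : Vp) (a : TKK Φ Vp Vm) :
    ⁅(mk x 0 0 : TKK Φ Vp Vm), ⁅(mk x 0 0 : TKK Φ Vp Vm), a⁆⁆ =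
      mk (-tp (Φ := Φ) x a.neg x) 0 0 := by
  rw [lie_pos, lie_pos]
  simp [inner_fst]

theorem mk_pos_injective {x y : Vp} (h : (mk x 0 0 : TKK Φ Vp Vm) = mk y 0 0) : x = y :=
  congrArg pos h

theorem mk_pos_mem_grading (x : Vp) : (mk x 0 0 : TKK Φ Vp Vm) ∈ grading Φ Vp Vm 1 :=
  ⟨fun h => absurd rfl h, fun _ => rfl, fun _ => rfl⟩

theorem mk_der_mem_grading (γ : IDer Φ Vp Vm) :
    (mk 0 γ 0 : TKK Φ Vp Vm) ∈ grading Φ Vp Vm 0 :=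
  ⟨fun _ => rfl, fun h => absurd rfl h, fun _ => rfl⟩

theorem mk_neg_mem_grading (y : Vm) : (mk 0 0 y : TKK Φ Vp Vm) ∈ grading Φ Vp Vm (-1) :=
  ⟨fun _ => rfl, fun _ => rfl, fun h => absurd rfl h⟩

theorem eq_of_mem_grading_one {a : TKK Φ Vp Vm} (h : a ∈ grading Φ Vp Vm 1) :
    a = mk a.pos 0 0 := ext rfl (h.2.1 (by norm_num)) (h.2.2 (by norm_num))

theorem eq_of_mem_grading_zero {a : TKK Φ Vp Vm} (h : a ∈ grading Φ Vp Vm 0) :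
    a = mk 0 a.der 0 := ext (h.1 (by norm_num)) rfl (h.2.2 (by norm_num))

theorem eq_zero_of_mem_grading {n : ℤ} {a : TKK Φ Vp Vm} (h : a ∈ grading Φ Vp Vm n)
    (h1 : n ≠ 1) (h0 : n ≠ 0) (h2 : n ≠ -1) : a = 0 := ext (h.1 h1) (h.2.1 h0) (h.2.2 h2)

theorem isHomogeneous_iff (K : LieIdeal Φ (TKK Φ Vp Vm)) :
    DirectSum.SetLike.IsHomogeneous (grading Φ Vp Vm) K ↔
      ∀ a ∈ K, mk a.pos 0 0 ∈ K ∧ mk 0 a.der 0 ∈ K ∧ mk 0 0 a.neg ∈ K := by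
  have e : ∀ (a : TKK Φ Vp Vm) (i : ℤ),
      (DirectSum.decompose (grading Φ Vp Vm) a i : TKK Φ Vp Vm) =
        (DirectSum.decompose (grading Φ Vp Vm) (mk a.pos 0 0) i : TKK Φ Vp Vm) +
        DirectSum.decompose (grading Φ Vp Vm) (mk 0 a.der 0) i +
        DirectSum.decompose (grading Φ Vp Vm) (mk 0 0 a.neg) i := fun a i => by
    conv_lhs => rw [eq_sum a, DirectSum.decompose_add, DirectSum.decompose_add]
    rfl
  constructor
  · intro h a ha
    refine ⟨?_, ?_, ?_⟩
    · have := h 1 ha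
      rwa [e, DirectSum.decompose_of_mem_same (grading Φ Vp Vm) (mk_pos_mem_grading _),
        DirectSum.decompose_of_mem_ne (grading Φ Vp Vm) (mk_der_mem_grading _) (by norm_num),
        DirectSum.decompose_of_mem_ne (grading Φ Vp Vm) (mk_neg_mem_grading _) (by norm_num),
        add_zero,
        add_zero] at this
    · have := h 0 ha
      rwa [e, DirectSum.decompose_of_mem_same (grading Φ Vp Vm) (mk_der_mem_grading _),
        DirectSum.decompose_of_mem_ne (grading Φ Vp Vm) (mk_pos_mem_grading _) (by norm_num),
        DirectSum.decompose_of_mem_ne (grading Φ Vp Vm) (mk_neg_mem_grading _) (by norm_num),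
        add_zero,
        zero_add] at this
    · have := h (-1) ha
      rwa [e, DirectSum.decompose_of_mem_same (grading Φ Vp Vm) (mk_neg_mem_grading _),
        DirectSum.decompose_of_mem_ne (grading Φ Vp Vm) (mk_der_mem_grading _) (by norm_num),
        DirectSum.decompose_of_mem_ne (grading Φ Vp Vm) (mk_pos_mem_grading _) (by norm_num),
        zero_add,
        zero_add] at this
  · intro h i a ha
    obtain ⟨h1, h0, h2⟩ := h a ha
    have key : ∀ {n : ℤ} {b : TKK Φ Vp Vm}, b ∈ K → b ∈ grading Φ Vp Vm n →
        (DirectSum.decompose (grading Φ Vp Vm) b i : TKK Φ Vp Vm) ∈ K := fun {n b} hb hn => by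
      by_cases hi : n = i
      · subst hi
        rwa [DirectSum.decompose_of_mem_same _ hn]
      · rw [DirectSum.decompose_of_mem_ne _ hn hi]
        exact zero_mem _
    change (DirectSum.decompose (grading Φ Vp Vm) a i : TKK Φ Vp Vm) ∈ K
    rw [e]
    exact add_mem (add_mem (key h1 (mk_pos_mem_grading _)) (key h0 (mk_der_mem_grading _)))
      (key h2 (mk_neg_mem_grading _))

theorem isHomogeneous_inf {I J : LieIdeal Φ (TKK Φ Vp Vm)}
    (hI : DirectSum.SetLike.IsHomogeneous (grading Φ Vp Vm) I)
    (hJ : DirectSum.SetLike.IsHomogeneous (grading Φ Vp Vm) J) :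
    DirectSum.SetLike.IsHomogeneous (grading Φ Vp Vm) (I ⊓ J : LieIdeal Φ (TKK Φ Vp Vm)) := by
  intro i m hm
  obtain ⟨h1, h2⟩ := (LieSubmodule.mem_inf _ _ _).mp hm
  exact (LieSubmodule.mem_inf _ _ _).mpr ⟨hI i h1, hJ i h2⟩

/-- Each component of $[a,b]$ is a sum of brackets of components of $a$ and $b$, and these lie in
$I$. -/
theorem isHomogeneous_lie_self {I : LieIdeal Φ (TKK Φ Vp Vm)}
    (hI : DirectSum.SetLike.IsHomogeneous (grading Φ Vp Vm) I) :
    DirectSum.SetLike.IsHomogeneous (grading Φ Vp Vm) (⁅I, I⁆ : LieIdeal Φ (TKK Φ Vp Vm)) := by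
  rw [isHomogeneous_iff] at hI ⊢
  intro a ha
  have ha' : a ∈ (⁅I, I⁆ : LieIdeal Φ (TKK Φ Vp Vm)).toSubmodule := ha
  rw [LieSubmodule.lieIdeal_oper_eq_linear_span'] at ha'
  refine Submodule.span_induction
    (p := fun a _ => mk a.pos 0 0 ∈ (⁅I, I⁆ : LieIdeal Φ (TKK Φ Vp Vm)) ∧
      mk 0 a.der 0 ∈ (⁅I, I⁆ : LieIdeal Φ (TKK Φ Vp Vm)) ∧
      mk 0 0 a.neg ∈ (⁅I, I⁆ : LieIdeal Φ (TKK Φ Vp Vm))) ?_ ?_ ?_ ?_ ha'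
  · rintro _ ⟨a, ha, b, hb, rfl⟩
    obtain ⟨a1, a0, a2⟩ := hI a ha
    obtain ⟨b1, b0, b2⟩ := hI b hb
    refine ⟨?_, ?_, ?_⟩
    · have h := add_mem (LieSubmodule.lie_mem_lie a0 b1) (LieSubmodule.lie_mem_lie a1 b0)
      rw [lie_der_pos, lie_pos_der, mk_add] at h
      simpa [pos_lie, sub_eq_add_neg] using h
    · have h := add_mem (add_mem (LieSubmodule.lie_mem_lie a0 b0)
        (LieSubmodule.lie_mem_lie a1 b2)) (LieSubmodule.lie_mem_lie a2 b1)
      rw [lie_der_der, lie_pos_neg, lie_neg_pos, mk_add, mk_add] at h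
      simpa [der_lie, sub_eq_add_neg] using h
    · have h := add_mem (LieSubmodule.lie_mem_lie a0 b2) (LieSubmodule.lie_mem_lie a2 b0)
      rw [lie_der_neg, lie_neg_der, mk_add] at h
      simpa [neg_lie, sub_eq_add_neg] using h
  · exact ⟨zero_mem _, zero_mem _, zero_mem _⟩
  · rintro a b _ _ ⟨a1, a0, a2⟩ ⟨b1, b0, b2⟩
    have h1 := add_mem a1 b1
    have h0 := add_mem a0 b0
    have h2 := add_mem a2 b2
    simp only [mk_add, add_zero] at h1 h0 h2
    exact ⟨h1, h0, h2⟩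
  · rintro c a _ ⟨a1, a0, a2⟩
    have h1 := SMulMemClass.smul_mem c a1
    have h0 := SMulMemClass.smul_mem c a0
    have h2 := SMulMemClass.smul_mem c a2
    simp only [mk_smul, smul_zero] at h1 h0 h2
    exact ⟨h1, h0, h2⟩

open LieQuot in
theorem lie_mem_component [Semiprime Φ (TKK Φ Vp Vm)] {σ ρ : ℤ} {p q : Qm Φ (TKK Φ Vp Vm)}
    (hp : p ∈ Qm.component (grading Φ Vp Vm) σ) (hq : q ∈ Qm.component (grading Φ Vp Vm) ρ) :
    ⁅p, q⁆ ∈ Qm.component (grading Φ Vp Vm) (σ + ρ) := by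
  obtain ⟨I, hI, δ, gI, hδ, rfl⟩ := hp
  obtain ⟨J, hJ, μ, gJ, hμ, rfl⟩ := hq
  rw [← Qm.mk_restrict hI (hI.inf hJ) inf_le_left, ← Qm.mk_restrict hJ (hI.inf hJ) inf_le_right,
    Qm.mk_lie]
  refine ⟨_, _, _, isHomogeneous_lie_self (isHomogeneous_inf gI gJ), fun τ x hx => ?_, rfl⟩
  obtain ⟨x, hx'⟩ := x
  rw [PDer.bracket_apply]
  have hx0 := lie_self_le _ hx'
  have h1 := PDer.apply_mem (PDer.restrict inf_le_left δ) hx' hx0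
  have h2 := PDer.apply_mem (PDer.restrict inf_le_right μ) hx' hx0
  refine sub_mem ?_ ?_
  · have := hδ (τ + ρ) ⟨_, (inf_le_left : I ⊓ J ≤ I) h2⟩
      (hμ τ ⟨x, (inf_le_right : I ⊓ J ≤ J) hx0⟩ hx)
    rwa [add_assoc, add_comm ρ] at this
  · have := hμ (τ + σ) ⟨_, (inf_le_right : I ⊓ J ≤ J) h1⟩
      (hδ τ ⟨x, (inf_le_left : I ⊓ J ≤ I) hx0⟩ hx)
    rwa [add_assoc] at this

open LieQuot in
theorem pder_apply {K : LieIdeal Φ (TKK Φ Vp Vm)} (δ : PDer K) {a : TKK Φ Vp Vm} (ha : a ∈ K)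
    (h1 : mk a.pos 0 0 ∈ K) (h0 : mk 0 a.der 0 ∈ K) (h2 : mk 0 0 a.neg ∈ K) :
    δ.1 ⟨a, ha⟩ = δ.1 ⟨_, h1⟩ + δ.1 ⟨_, h0⟩ + δ.1 ⟨_, h2⟩ := by
  rw [← map_add, ← map_add]
  congr 1
  exact Subtype.ext (eq_sum a)

end

end TKK

end JordanPair

/-! ### Nondegeneracy relative to ideals, and the vanishing of $Q_m(L)_2$ -/

namespace JordanTripleSystem

open JordanPair LieQuot

section

variable {Φ T : Type*} [CommRing Φ] [AddCommGroup T] [Module Φ T] [JordanTripleSystem Φ T]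

theorem tp_eq (x y z : T) : tp (Φ := Φ) x y z = triple (Φ := Φ) x y z := rfl

theorem tm_eq (x y z : T) : tm (Φ := Φ) x y z = triple (Φ := Φ) x y z := rfl

theorem inner_eq_zero_iff {x y : T} : JordanPair.inner Φ x y = 0 ↔
    ∀ z, triple (Φ := Φ) x y z = 0 ∧ triple (Φ := Φ) y x z = 0 := by
  constructor
  · intro h z
    refine ⟨?_, ?_⟩
    · rw [← tp_eq, ← TKK.inner_fst, h, TKK.zero_fst]
    · rw [← tm_eq, ← neg_eq_zero, ← TKK.inner_snd, h, TKK.zero_snd]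
  · intro h
    refine Subtype.ext (Prod.ext (LinearMap.ext fun z => (h z).1) (LinearMap.ext fun z => ?_))
    exact neg_eq_zero.mpr (h z).2

theorem exchange_exchange (a : TKK Φ T T) : exchange Φ T (exchange Φ T a) = a := rfl

theorem exchange_mem_grading {n : ℤ} {a : TKK Φ T T} (ha : a ∈ TKK.grading Φ T T n) :
    exchange Φ T a ∈ TKK.grading Φ T T (-n) := by
  obtain ⟨h1, h0, h2⟩ := ha
  refine ⟨fun h => h2 (by omega), fun h => ?_, fun h => h1 (by omega)⟩
  change swapDer a.der = 0
  rw [h0 (by omega)]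
  rfl

/-- The image of an ideal under the exchange automorphism. -/
noncomputable abbrev exchangeIdeal (K : LieIdeal Φ (TKK Φ T T)) : LieIdeal Φ (TKK Φ T T) :=
  K.comap ((exchange Φ T).symm : TKK Φ T T →ₗ⁅Φ⁆ TKK Φ T T)

theorem mem_exchangeIdeal {K : LieIdeal Φ (TKK Φ T T)} {a : TKK Φ T T} :
    a ∈ exchangeIdeal K ↔ exchange Φ T a ∈ K := Iff.rfl

theorem isHomogeneous_exchangeIdeal {K : LieIdeal Φ (TKK Φ T T)}
    (hK : DirectSum.SetLike.IsHomogeneous (TKK.grading Φ T T) K) :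
    DirectSum.SetLike.IsHomogeneous (TKK.grading Φ T T) (exchangeIdeal K) := by
  rw [TKK.isHomogeneous_iff] at hK ⊢
  intro a ha
  obtain ⟨h1, h0, h2⟩ := hK _ (mem_exchangeIdeal.mp ha)
  exact ⟨h2, h0, h1⟩

theorem conj_mem_component {σ : ℤ} {p : Qm Φ (TKK Φ T T)}
    (hp : p ∈ Qm.component (TKK.grading Φ T T) σ) :
    Qm.conj (exchange Φ T) p ∈ Qm.component (TKK.grading Φ T T) (-σ) := by
  obtain ⟨I, hI, δ, gI, hδ, rfl⟩ := hp
  refine ⟨_, hI.comap (exchange Φ T), PDer.conj (exchange Φ T) δ, isHomogeneous_exchangeIdeal gI,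
    fun τ x hx => ?_, rfl⟩
  have h := exchange_mem_grading
    (hδ (-τ) ⟨exchange Φ T x, x.2⟩ (exchange_mem_grading hx))
  rw [_root_.neg_add, neg_neg] at h
  exact h

section Nondegenerate

attribute [local instance] LieRing.ofAssociativeRing

variable [StronglyNondegenerate Φ T]

/-- An element `x` of an ideal `K` of `TKK(V(T))` with `{x, [K, K]₋₁, x} = 0` is zero. -/
theorem eq_zero_of_triple_ideal (h6 : IsUnit (6 : Φ)) {K : LieIdeal Φ (TKK Φ T T)} {x : T}
    (hx : TKK.mk x 0 0 ∈ K)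
    (h : ∀ y : T, TKK.mk 0 0 y ∈ ⁅K, K⁆ → triple (Φ := Φ) x y x = 0) : x = 0 := by
  refine StronglyNondegenerate.eq_zero (Φ := Φ) x fun w => ?_
  -- Nondegeneracy is used twice: it suffices that every $b=\{x,w,x\}$ is an absolute zero divisor.
  -- Up to scalars, $P_b=P_xP_wP_x$ reduces this to the action of $P_x$ on $[K,K]_{-1}$.
  refine StronglyNondegenerate.eq_zero (Φ := Φ) _ fun z => ?_
  set p : TKK Φ T T := TKK.mk x 0 0 with hp
  set n : TKK Φ T T := TKK.mk 0 0 w with hn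
  set X := LieAlgebra.ad Φ (TKK Φ T T) p with hX
  set W := LieAlgebra.ad Φ (TKK Φ T T) n with hW
  have hb : ⁅⁅p, n⁆, p⁆ = TKK.mk (triple (Φ := Φ) x w x) 0 0 := by
    rw [hp, hn, TKK.lie_pos_neg, TKK.lie_der_pos]
    rfl
  have hXX : ∀ a, (X * X) a = TKK.mk (-triple (Φ := Φ) x a.neg x) 0 0 := TKK.lie_lie_pos x
  have hX3 : X * X * X = 0 := by
    refine LinearMap.ext fun a => ?_
    change (X * X) ⁅p, a⁆ = 0
    rw [hXX, hp, TKK.lie_pos]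
    simp only [TKK.neg_mk, map_zero, LinearMap.zero_apply, _root_.neg_zero]
    rfl
  have hXW : X * X * W * X = X * W * X * X := by
    have h1 : ⁅X, ⁅X, ⁅X, W⁆⁆⁆ = 0 := by
      rw [hX, hW, ← LieHom.map_lie, ← LieHom.map_lie, ← LieHom.map_lie]
      have : ⁅p, ⁅p, ⁅p, n⁆⁆⁆ = 0 := LinearMap.congr_fun hX3 n
      rw [this, map_zero]
    -- The triple commutator equals $X^3W-3X^2WX+3XWX^2-WX^3$ and vanishes because it is
    -- $\mathrm{ad}$ of $(\mathrm{ad}\,p)^3n=0$; dividing by 3 gives the hypothesis of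
    -- `sq_jordan_identity`.
    have h2 : (3 : ℕ) • (X * X * W * X - X * W * X * X) =
        X * X * X * W - W * (X * X * X) - ⁅X, ⁅X, ⁅X, W⁆⁆⁆ := by
      simp only [Ring.lie_def, mul_sub, sub_mul, mul_assoc]
      abel
    rw [h1, hX3, zero_mul, mul_zero, sub_zero, sub_zero] at h2
    exact sub_eq_zero.mp (eq_zero_of_three_nsmul h6 h2)
  have key := sq_jordan_identity hX3 hXW
  have hB : LieAlgebra.ad Φ (TKK Φ T T) (TKK.mk (triple (Φ := Φ) x w x) 0 0) =
      (X * W - W * X) * X - X * (X * W - W * X) := by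
    rw [← hb, LieHom.map_lie, LieHom.map_lie, Ring.lie_def, Ring.lie_def]
  rw [← hB] at key
  have e := LinearMap.congr_fun key (TKK.mk 0 0 z)
  have e1 : (LieAlgebra.ad Φ (TKK Φ T T) (TKK.mk (triple (Φ := Φ) x w x) 0 0) *
      LieAlgebra.ad Φ (TKK Φ T T) (TKK.mk (triple (Φ := Φ) x w x) 0 0)) (TKK.mk 0 0 z) =
      TKK.mk (-triple (Φ := Φ) (triple (Φ := Φ) x w x) z (triple (Φ := Φ) x w x)) 0 0 :=
    TKK.lie_lie_pos _ _
  have e2 : (X * X * W * W * X * X) (TKK.mk 0 0 z) = 0 := by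
    change (X * X) (⁅n, ⁅n, (X * X) (TKK.mk 0 0 z)⁆⁆) = 0
    -- Both $p$ and $[p,z]$ lie in $K$, so $X^2z=[p,[p,z]]$ is already in $[K,K]$; two further
    -- brackets with $n$ stay there and land in degree $-1$, where the hypothesis on $x$ applies.
    have hK : ⁅n, ⁅n, (X * X) (TKK.mk 0 0 z)⁆⁆ ∈ (⁅K, K⁆ : LieIdeal Φ (TKK Φ T T)) :=
      lie_mem_right Φ _ _ _ _ (lie_mem_right Φ _ _ _ _
        (LieSubmodule.lie_mem_lie hx (lie_mem_left Φ _ K _ _ hx)))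
    rw [hXX (TKK.mk 0 0 z), hn, TKK.lie_neg_pos, TKK.lie_neg_der] at hK
    rw [hXX, hXX (TKK.mk 0 0 z), hn, TKK.lie_neg_pos, TKK.lie_neg_der, TKK.neg_mk, h _ hK,
      _root_.neg_zero]
    rfl
  rw [e1, e2] at e
  exact neg_eq_zero.mp (congrArg TKK.pos e)

/-- The degree `-1` part of an essential homogeneous ideal has zero centralizer in degree `1`. -/
theorem eq_zero_of_inner_ideal (h6 : IsUnit (6 : Φ)) {K : LieIdeal Φ (TKK Φ T T)}
    (hK : IsEssential K) (gK : DirectSum.SetLike.IsHomogeneous (TKK.grading Φ T T) K) {z : T}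
    (hz : ∀ y : T, TKK.mk 0 0 y ∈ K → JordanPair.inner Φ z y = 0) : z = 0 := by
  rw [TKK.isHomogeneous_iff] at gK
  refine TKK.mk_pos_injective (Φ := Φ) (Vm := T) (hK.eq_zero_of_lie fun k hk => ?_)
  obtain ⟨-, k0, k2⟩ := gK k hk
  -- For $\gamma\in K_0$ the element $\gamma z$ lies in $K_1$, and $\delta(\gamma
  -- z,y)=[\gamma,\delta(z,y)]-\delta(z,\gamma y)=0$ for $y\in K_{-1}$. In particular $\{\gamma
  -- z,y,\gamma z\}=0$.
  have hz' : k.der.1.1 z = 0 := by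
    refine eq_zero_of_triple_ideal h6 (K := K) ?_ fun y hy => ?_
    · rw [← TKK.lie_der_pos]
      exact lie_mem_left Φ _ K _ _ k0
    · have hy' : TKK.mk 0 0 (k.der.1.2 y) ∈ K := by
        rw [← TKK.lie_der_neg]
        exact lie_mem_left Φ _ K _ _ k0
      have h := TKK.lie_inner k.der z y
      rw [hz y (lie_self_le K hy), hz _ hy', lie_zero, add_zero] at h
      exact (inner_eq_zero_iff.mp h.symm _).1
  rw [TKK.lie_pos, hz', hz _ k2, _root_.neg_zero]
  rfl

/-- `Q_m(TKK(V(T)))` has no elements of degree `2`. -/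
theorem component_two_eq_zero (h6 : IsUnit (6 : Φ)) {p : Qm Φ (TKK Φ T T)}
    (hp : p ∈ Qm.component (TKK.grading Φ T T) 2) : p = 0 := by
  obtain ⟨I, hI, δ, gI, hδ, rfl⟩ := hp
  have hK := (TKK.isHomogeneous_iff _).mp (TKK.isHomogeneous_lie_self gI)
  -- Degree $-1$ is taken from $[I,I]$ rather than $I$: this makes $\delta$ map it into $I$, and it
  -- is the set on which `eq_zero_of_triple_ideal` tests.
  let N : Submodule Φ T :=
    { carrier := {y | TKK.mk 0 0 y ∈ (⁅I, I⁆ : LieIdeal Φ (TKK Φ T T))}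
      add_mem' := fun {a b} ha hb => by
        have h : TKK.mk 0 0 a + TKK.mk 0 0 b ∈ (⁅I, I⁆ : LieIdeal Φ (TKK Φ T T)) := add_mem ha hb
        rw [TKK.mk_add, add_zero, add_zero] at h
        exact h
      zero_mem' := zero_mem (⁅I, I⁆ : LieIdeal Φ (TKK Φ T T))
      smul_mem' := fun c a ha => by
        have h : c • TKK.mk 0 0 a ∈ (⁅I, I⁆ : LieIdeal Φ (TKK Φ T T)) := SMulMemClass.smul_mem c ha
        rw [TKK.mk_smul, smul_zero, smul_zero] at h
        exact h }
  have hNI : ∀ y : N, TKK.mk 0 0 (y : T) ∈ I := fun y => lie_self_le I y.2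
  let d : N →ₗ[Φ] T :=
    { toFun := fun y => (δ.1 ⟨_, hNI y⟩).pos
      map_add' := fun y z => by
        rw [← TKK.pos_add, ← map_add]
        congr 2
        exact Subtype.ext (TKK.ext (add_zero _).symm (add_zero _).symm rfl)
      map_smul' := fun c y => by
        rw [RingHom.id_apply, ← TKK.pos_smul, ← map_smul]
        congr 2
        exact Subtype.ext (TKK.ext (smul_zero _).symm (smul_zero _).symm rfl) }
  have hd : ∀ y : N, δ.1 ⟨_, hNI y⟩ = TKK.mk (d y) 0 0 := fun y =>
    TKK.eq_of_mem_grading_one (hδ (-1) ⟨_, hNI y⟩ (TKK.mk_neg_mem_grading _))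
  have h0 : ∀ (γ : IDer Φ T T) (h : TKK.mk 0 γ 0 ∈ I), δ.1 ⟨_, h⟩ = 0 := fun γ h =>
    TKK.eq_zero_of_mem_grading (hδ 0 ⟨_, h⟩ (TKK.mk_der_mem_grading _)) (by norm_num)
      (by norm_num) (by norm_num)
  have h1 : ∀ (x : T) (h : TKK.mk x 0 0 ∈ I), δ.1 ⟨_, h⟩ = 0 := fun x h =>
    TKK.eq_zero_of_mem_grading (hδ 1 ⟨_, h⟩ (TKK.mk_pos_mem_grading _)) (by norm_num)
      (by norm_num) (by norm_num)
  -- Elements of degree $-1$ commute, so applying $\delta$ to $[y,z]=0$ gives $[dy,z]=[dz,y]$. Its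
  -- two components are the first two relations required by `degree_two_eq_zero`.
  have hin : ∀ y z : N, JordanPair.inner Φ (d y) (z : T) = JordanPair.inner Φ (d z) (y : T) := by
    intro y z
    have hz : ⁅(TKK.mk 0 0 (y : T) : TKK Φ T T), (TKK.mk 0 0 (z : T) : TKK Φ T T)⁆ ∈ I :=
      lie_mem_left Φ _ I _ _ (hNI y)
    have e := PDer.apply_lie δ (hNI y) (hNI z) hz
    rw [hd, hd, TKK.lie_pos_neg, TKK.lie_neg_pos, TKK.mk_add] at e
    have e' : δ.1 ⟨_, hz⟩ = 0 := by
      rw [← map_zero δ.1]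
      congr 1
      exact Subtype.ext (TKK.lie_neg_neg _ _)
    rw [e'] at e
    have := congrArg TKK.der e
    exact eq_of_sub_eq_zero ((sub_eq_add_neg _ _).trans this.symm)
  have hT := degree_two_eq_zero h6 N (fun y hy x z hz => by
      have h := lie_mem_right Φ (TKK Φ T T) ⁅I, I⁆ (TKK.mk 0 (JordanPair.inner Φ x y) 0) _ hz
      rw [TKK.lie_der_neg, TKK.inner_snd] at h
      have h' := neg_mem h
      rw [TKK.mk_neg, neg_neg, _root_.neg_zero, _root_.neg_zero] at h'
      exact h') d
    (fun y z v => by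
      have := congrArg (fun γ : IDer Φ T T => γ.1.1 v) (hin y z)
      exact this)
    (fun y z v => by
      have := congrArg (fun γ : IDer Φ T T => γ.1.2 v) (hin y z)
      exact neg_injective this)
    -- The third relation is $\delta$ applied to $[[x,y],z]$ with $x$ in degree 1 and $y,z$ in
    -- degree $-1$; here $\delta[x,y]=0$ since it would have degree 2.
    (fun y x z => by
      have ho : TKK.mk 0 (JordanPair.inner Φ x (y : T)) 0 ∈ I := by
        rw [← TKK.lie_pos_neg]
        exact lie_mem_right Φ _ I _ _ (hNI y)
      have hz : ⁅TKK.mk 0 (JordanPair.inner Φ x (y : T)) 0, TKK.mk 0 0 (z : T)⁆ ∈ I :=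
        lie_mem_left Φ _ I _ _ ho
      have e := PDer.apply_lie δ ho (hNI z) hz
      rw [hd, h0, zero_lie, zero_add, TKK.lie_der_pos, TKK.inner_fst] at e
      have e1 := congrArg TKK.pos e
      rw [TKK.pos_mk] at e1
      refine Eq.trans (congrArg TKK.pos (a₂ := -δ.1 ⟨_, hz⟩) ?_) (congrArg Neg.neg e1)
      refine Eq.trans (congrArg δ.1 (Subtype.ext ?_)) (map_neg δ.1 _)
      change _ = -⁅TKK.mk 0 (JordanPair.inner Φ x (y : T)) 0, TKK.mk 0 0 (z : T)⁆
      refine Eq.trans ?_ (congrArg Neg.neg (TKK.lie_der_neg _ _)).symm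
      refine TKK.ext (_root_.neg_zero).symm (_root_.neg_zero).symm ?_
      exact (neg_neg _).symm)
    (fun y hy => by
      refine eq_zero_of_triple_ideal h6 (K := I) ?_ fun w hw => hy ⟨w, hw⟩
      rw [← hd]
      exact PDer.apply_mem δ y.2 _)
  rw [← Qm.mk_restrict hI hI.lie_self (lie_self_le I)]
  refine Qm.mk_eq_zero _ fun a ha => ?_
  obtain ⟨a1, a0, a2⟩ := hK a ha
  rw [TKK.pder_apply _ ha a1 a0 a2]
  have e2 : δ.1 ⟨_, lie_self_le I a2⟩ = 0 := (hd ⟨a.neg, a2⟩).trans (by rw [hT]; rfl)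
  refine (congrArg₂ (· + ·) (congrArg₂ (· + ·) (h1 _ (lie_self_le I a1))
    (h0 _ (lie_self_le I a0))) e2).trans ?_
  rw [add_zero, add_zero]

end Nondegenerate

end

end JordanTripleSystem

namespace JordanTripleSystem

open JordanPair LieQuot

section

variable {Φ T : Type*} [CommRing Φ] [AddCommGroup T] [Module Φ T] [JordanTripleSystem Φ T]

/-! ### The triple product on the degree one component -/

theorem triple_mem_component_one [StronglyNondegenerate Φ T] {p q r : Qm Φ (TKK Φ T T)}
    (hp : p ∈ QmOne Φ T) (hq : q ∈ QmOne Φ T) (hr : r ∈ QmOne Φ T) :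
    ⁅⁅p, Qm.conj (exchange Φ T) q⁆, r⁆ ∈ QmOne Φ T := by
  have h := TKK.lie_mem_component (TKK.lie_mem_component hp (conj_mem_component hq)) hr
  rwa [add_neg_cancel, zero_add] at h

theorem lie_eq_zero_of_component_one [StronglyNondegenerate Φ T] (h6 : IsUnit (6 : Φ))
    {p q : Qm Φ (TKK Φ T T)}
    (hp : p ∈ QmOne Φ T) (hq : q ∈ QmOne Φ T) : ⁅p, q⁆ = 0 :=
  component_two_eq_zero h6 (TKK.lie_mem_component hp hq)

variable (Φ T) in
/-- The triple product `{p, q, r} = [[p, τ q], r]` on the degree `1` component of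
`Q_m(TKK(V(T)))`. -/
noncomputable def qmOneTriple [StronglyNondegenerate Φ T] :
    QmOne Φ T →ₗ[Φ] QmOne Φ T →ₗ[Φ] QmOne Φ T →ₗ[Φ] QmOne Φ T :=
  LinearMap.mk₂ Φ (fun p q =>
    { toFun := fun r => ⟨_, triple_mem_component_one p.2 q.2 r.2⟩
      map_add' := fun r r' => Subtype.ext (lie_add _ _ _)
      map_smul' := fun c r => Subtype.ext (lie_smul _ _ _) })
    (fun p p' q => LinearMap.ext fun r => Subtype.ext (by
      change ⁅⁅(p : Qm Φ (TKK Φ T T)) + (p' : Qm Φ (TKK Φ T T)), _⁆, (r : Qm Φ (TKK Φ T T))⁆ =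
        ⁅_, _⁆ + ⁅_, _⁆
      rw [add_lie, add_lie]))
    (fun c p q => LinearMap.ext fun r => Subtype.ext (by
      change ⁅⁅c • (p : Qm Φ (TKK Φ T T)), _⁆, (r : Qm Φ (TKK Φ T T))⁆ = c • ⁅_, _⁆
      rw [smul_lie, smul_lie]))
    (fun p q q' => LinearMap.ext fun r => Subtype.ext (by
      change ⁅⁅_, Qm.conj _ ((q : Qm Φ (TKK Φ T T)) + (q' : Qm Φ (TKK Φ T T)))⁆,
        (r : Qm Φ (TKK Φ T T))⁆ =
        ⁅_, _⁆ + ⁅_, _⁆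
      rw [Qm.conj_add, lie_add, add_lie]))
    (fun c p q => LinearMap.ext fun r => Subtype.ext (by
      change ⁅⁅_, Qm.conj _ (c • (q : Qm Φ (TKK Φ T T)))⁆, (r : Qm Φ (TKK Φ T T))⁆ = c • ⁅_, _⁆
      rw [Qm.conj_smul, lie_smul, smul_lie]))

theorem coe_qmOneTriple [StronglyNondegenerate Φ T] (p q r : QmOne Φ T) :
    (qmOneTriple Φ T p q r : Qm Φ (TKK Φ T T)) =
      ⁅⁅(p : Qm Φ (TKK Φ T T)), Qm.conj (exchange Φ T) q⁆, (r : Qm Φ (TKK Φ T T))⁆ := rfl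

/-- The degree `1` component of `Q_m(TKK(V(T)))` is a Jordan triple system. -/
noncomputable abbrev jordanQmOne [StronglyNondegenerate Φ T] (h6 : IsUnit (6 : Φ)) :
    JordanTripleSystem Φ (QmOne Φ T) where
  triple := qmOneTriple Φ T
  triple_comm p q r := by
    refine Subtype.ext ?_
    -- With $[p,r]=0$ one has $[[p,\tau q],r]=[p,[\tau q,r]]$, which is $[[r,\tau q],p]$ after two
    -- sign changes.
    rw [coe_qmOneTriple, coe_qmOneTriple, lie_lie, lie_eq_zero_of_component_one h6 p.2 r.2,
      lie_zero, sub_zero, ← lie_skew, ← lie_skew (r : Qm Φ (TKK Φ T T)), neg_lie]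
  triple_jordan x y u v z := by
    refine Subtype.ext ?_
    change ⁅⁅(x : Qm Φ (TKK Φ T T)), Qm.conj (exchange Φ T) y⁆,
        ⁅⁅(u : Qm Φ (TKK Φ T T)), Qm.conj (exchange Φ T) v⁆, (z : Qm Φ (TKK Φ T T))⁆⁆ =
      ⁅⁅⁅⁅(x : Qm Φ (TKK Φ T T)), Qm.conj (exchange Φ T) y⁆, (u : Qm Φ (TKK Φ T T))⁆,
        Qm.conj (exchange Φ T) v⁆, (z : Qm Φ (TKK Φ T T))⁆ -
      ⁅⁅(u : Qm Φ (TKK Φ T T)), Qm.conj (exchange Φ T)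
        ⁅⁅(y : Qm Φ (TKK Φ T T)), Qm.conj (exchange Φ T) x⁆, (v : Qm Φ (TKK Φ T T))⁆⁆,
        (z : Qm Φ (TKK Φ T T))⁆ +
      ⁅⁅(u : Qm Φ (TKK Φ T T)), Qm.conj (exchange Φ T) v⁆,
        ⁅⁅(x : Qm Φ (TKK Φ T T)), Qm.conj (exchange Φ T) y⁆, (z : Qm Φ (TKK Φ T T))⁆⁆
    -- Bracketing with $[x,\tau y]$ is a derivation of $Q_m(L)$. Since $\tau[[y,\tau x],v]=[[\tau
    -- y,x],\tau v]=-[[x,\tau y],\tau v]$, the middle term enters with a minus sign.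
    rw [Qm.conj_lie, Qm.conj_lie, Qm.conj_conj exchange_exchange,
      ← lie_skew (x : Qm Φ (TKK Φ T T)) (Qm.conj (exchange Φ T) (y : Qm Φ (TKK Φ T T))),
      leibniz_lie (-⁅Qm.conj (exchange Φ T) (y : Qm Φ (TKK Φ T T)), (x : Qm Φ (TKK Φ T T))⁆),
      leibniz_lie (-⁅Qm.conj (exchange Φ T) (y : Qm Φ (TKK Φ T T)), (x : Qm Φ (TKK Φ T T))⁆)
        (u : Qm Φ (TKK Φ T T)), add_lie,
      neg_lie ⁅Qm.conj (exchange Φ T) (y : Qm Φ (TKK Φ T T)), (x : Qm Φ (TKK Φ T T))⁆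
        (Qm.conj (exchange Φ T) (v : Qm Φ (TKK Φ T T))), lie_neg,
      neg_lie ⁅(u : Qm Φ (TKK Φ T T)), _⁆, sub_eq_add_neg]

/-! ### Absorption of the degree one component into `T` -/

theorem lie_lie_mk (x y z : T) :
    ⁅⁅(TKK.mk x 0 0 : TKK Φ T T), (TKK.mk 0 0 y : TKK Φ T T)⁆, (TKK.mk z 0 0 : TKK Φ T T)⁆ =
      TKK.mk (triple (Φ := Φ) x y z) 0 0 := by
  rw [TKK.lie_pos_neg, TKK.lie_der_pos]
  rfl

theorem coe_toQmOne (x : T) :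
    (toQmOne Φ T x : Qm Φ (TKK Φ T T)) = Qm.of Φ (TKK Φ T T) (TKK.mk x 0 0) := rfl

theorem conj_of_mk (x : T) : Qm.conj (exchange Φ T) (Qm.of Φ (TKK Φ T T) (TKK.mk x 0 0)) =
    Qm.of Φ (TKK Φ T T) (TKK.mk 0 0 x) := Qm.conj_of _ _

theorem toQmOne_injective [StronglyNondegenerate Φ T] :
    Function.Injective (toQmOne Φ T) := fun _ _ h =>
  TKK.mk_pos_injective (Qm.of_injective (congrArg Subtype.val h))

/-- Replace the domain $I$ by $I\cap\tau(I)$. Then degrees 1 and $-1$ of the domain are the same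
submodule of $T$, as needed for products involving both $a$ and $\tau a$. -/
theorem exists_exchange_invariant {σ : ℤ} {p : Qm Φ (TKK Φ T T)}
    (hp : p ∈ Qm.component (TKK.grading Φ T T) σ) :
    ∃ (K : LieIdeal Φ (TKK Φ T T)) (hK : IsEssential K) (δ : PDer K),
      DirectSum.SetLike.IsHomogeneous (TKK.grading Φ T T) K ∧
      (∀ a ∈ K, exchange Φ T a ∈ K) ∧ PDer.HasDegree (TKK.grading Φ T T) δ σ ∧
      p = Qm.mk hK δ := by
  obtain ⟨I, hI, δ, gI, hδ, rfl⟩ := hp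
  refine ⟨I ⊓ exchangeIdeal I, hI.inf (hI.comap _), PDer.restrict inf_le_left δ,
    TKK.isHomogeneous_inf gI (isHomogeneous_exchangeIdeal gI), fun a ha => ?_,
    fun τ x hx => hδ τ _ hx, (Qm.mk_restrict _ _ _ _).symm⟩
  obtain ⟨h1, h2⟩ := (LieSubmodule.mem_inf _ _ _).mp ha
  exact (LieSubmodule.mem_inf _ _ _).mpr ⟨h2, h1⟩

section Derivation

variable {K : LieIdeal Φ (TKK Φ T T)} (hK : IsEssential K) {δ : PDer K}
  (hδ : PDer.HasDegree (TKK.grading Φ T T) δ 1)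

include hδ

theorem apply_mk_neg {a : T} (ha : TKK.mk 0 0 a ∈ K) :
    δ.1 ⟨_, ha⟩ = TKK.mk 0 (δ.1 ⟨_, ha⟩).der 0 :=
  TKK.eq_of_mem_grading_zero (hδ (-1) ⟨_, ha⟩ (TKK.mk_neg_mem_grading a))

theorem apply_mk_der {γ : IDer Φ T T} (hγ : TKK.mk 0 γ 0 ∈ K) :
    δ.1 ⟨_, hγ⟩ = TKK.mk (δ.1 ⟨_, hγ⟩).pos 0 0 :=
  TKK.eq_of_mem_grading_one (hδ 0 ⟨_, hγ⟩ (TKK.mk_der_mem_grading γ))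

theorem apply_mk_pos {a : T} (ha : TKK.mk a 0 0 ∈ K) : δ.1 ⟨_, ha⟩ = 0 :=
  TKK.eq_zero_of_mem_grading (hδ 1 ⟨_, ha⟩ (TKK.mk_pos_mem_grading a)) (by norm_num) (by norm_num)
    (by norm_num)

theorem mk_triple_left [StronglyNondegenerate Φ T] {a : T} (ha : TKK.mk 0 0 a ∈ K) (x : T) :
    ⁅⁅Qm.mk hK δ, Qm.conj (exchange Φ T) (toQmOne Φ T a)⁆,
        (toQmOne Φ T x : Qm Φ (TKK Φ T T))⁆ =
      toQmOne Φ T ((δ.1 ⟨_, ha⟩).der.1.1 x) := by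
  rw [coe_toQmOne, coe_toQmOne, coe_toQmOne, conj_of_mk, Qm.mk_lie_of hK δ ha, ← Qm.of_lie,
    apply_mk_neg hδ ha, TKK.lie_der_pos]
  rfl

/-- Since $[q,a]$ comes from $\delta(a)\in L_2=0$, the product is $[q,[\tau x,a]]$, the value of
$\delta$ at an element of $K_0$. -/
theorem mk_triple_right [StronglyNondegenerate Φ T] {a : T} (ha : TKK.mk a 0 0 ∈ K) (x : T)
    (ho : TKK.mk 0 (-JordanPair.inner Φ a x) 0 ∈ K) :
    ⁅⁅Qm.mk hK δ, Qm.conj (exchange Φ T) (toQmOne Φ T x)⁆,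
        (toQmOne Φ T a : Qm Φ (TKK Φ T T))⁆ =
      toQmOne Φ T (δ.1 ⟨_, ho⟩).pos := by
  rw [coe_toQmOne, coe_toQmOne, coe_toQmOne, conj_of_mk, lie_lie, Qm.mk_lie_of hK δ ha,
    apply_mk_pos hδ ha, map_zero, lie_zero, sub_zero, ← Qm.of_lie, TKK.lie_neg_pos,
    Qm.mk_lie_of hK δ ho, ← apply_mk_der hδ ho]

/-- Here $[a,\tau q]=\tau[\tau a,q]=-\tau(\delta(\tau a))$, so the other component of the same
derivation $\delta(\tau a)\in L_0$ appears. -/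
theorem mk_triple_middle [StronglyNondegenerate Φ T] {a : T} (ha : TKK.mk 0 0 a ∈ K) (x : T) :
    ⁅⁅(toQmOne Φ T a : Qm Φ (TKK Φ T T)), Qm.conj (exchange Φ T) (Qm.mk hK δ)⁆,
        (toQmOne Φ T x : Qm Φ (TKK Φ T T))⁆ =
      toQmOne Φ T (-(δ.1 ⟨_, ha⟩).der.1.2 x) := by
  have h : ⁅(toQmOne Φ T a : Qm Φ (TKK Φ T T)), Qm.conj (exchange Φ T) (Qm.mk hK δ)⁆ =
      -Qm.of Φ (TKK Φ T T) (TKK.mk 0 (swapDer (δ.1 ⟨_, ha⟩).der) 0) := by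
    rw [← Qm.conj_conj exchange_exchange (toQmOne Φ T a : Qm Φ (TKK Φ T T)), ← Qm.conj_lie,
      coe_toQmOne, conj_of_mk, ← lie_skew, Qm.mk_lie_of hK δ ha, ← map_neg, Qm.conj_of]
    refine Eq.trans (congrArg _ ?_) (map_neg _ _)
    rw [apply_mk_neg hδ ha]
    rfl
  rw [h, coe_toQmOne, coe_toQmOne, neg_lie, ← Qm.of_lie, TKK.lie_der_pos, ← map_neg]
  congr 1
  exact TKK.ext rfl _root_.neg_zero _root_.neg_zero

end Derivation

/-- `T` is embedded in the degree `1` component of `Q_m(TKK(V(T)))` as a Jordan triple system, and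
the latter is a Jordan triple system of `𝔐`-quotients of `T`. -/
theorem isMQuotients_toQmOne [StronglyNondegenerate Φ T] (h6 : IsUnit (6 : Φ))
    [JordanTripleSystem Φ (QmOne Φ T)]
    (hmul : ∀ x y z : QmOne Φ T, (triple (Φ := Φ) x y z : Qm Φ (TKK Φ T T)) =
      ⁅⁅(x : Qm Φ (TKK Φ T T)), Qm.conj (exchange Φ T) y⁆, (z : Qm Φ (TKK Φ T T))⁆) :
    IsMQuotients (toQmOne Φ T) := by
  refine ⟨toQmOne_injective, fun x y z => Subtype.ext ?_, fun q hq => ?_⟩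
  · rw [hmul, coe_toQmOne, coe_toQmOne, coe_toQmOne, coe_toQmOne, conj_of_mk, ← Qm.of_lie,
      ← Qm.of_lie, lie_lie_mk]
  obtain ⟨q, hq1⟩ := q
  obtain ⟨K, hK, δ, gK, sK, hδ, rfl⟩ := exists_exchange_invariant hq1
  have hpn : ∀ {a : T}, TKK.mk a 0 0 ∈ K → TKK.mk 0 0 a ∈ K := fun {a} ha => sK _ ha
  have hpd : ∀ {a : T} (x : T), TKK.mk a 0 0 ∈ K →
      TKK.mk 0 (-JordanPair.inner Φ a x) 0 ∈ K := fun {a} x ha => by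
    rw [← TKK.lie_neg_pos]
    exact lie_mem_right Φ _ K _ _ ha
  -- The absorbing ideal of $T$ is $K_1$, the elements of $T$ lying in $K$ in degree 1.
  refine ⟨K.toSubmodule.comap (toTKK Φ T), fun a ha x y => ?_, fun z hz => ?_,
    fun a ha x => ?_, ?_⟩
  · change TKK.mk a 0 0 ∈ K at ha
    change TKK.mk _ 0 0 ∈ K ∧ TKK.mk _ 0 0 ∈ K ∧ TKK.mk _ 0 0 ∈ K
    rw [← lie_lie_mk, ← lie_lie_mk, ← lie_lie_mk]
    exact ⟨lie_mem_left Φ _ K _ _ (lie_mem_left Φ _ K _ _ ha),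
      lie_mem_left Φ _ K _ _ (lie_mem_right Φ _ K _ _ (hpn ha)), lie_mem_right Φ _ K _ _ ha⟩
  · refine eq_zero_of_inner_ideal h6 hK gK fun y hy => inner_eq_zero_iff.mpr fun w => ?_
    have h := hz y (sK _ hy) w
    exact ⟨h.1, (triple_comm _ _ _).trans h.2.2⟩
  · exact ⟨⟨_, Subtype.ext ((hmul _ _ _).trans (mk_triple_left hK hδ (hpn ha) x)).symm⟩,
      ⟨_, Subtype.ext ((hmul _ _ _).trans (mk_triple_right hK hδ ha x (hpd x ha))).symm⟩,
      ⟨_, Subtype.ext ((hmul _ _ _).trans (mk_triple_middle hK hδ (hpn ha) x)).symm⟩⟩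
  · by_contra hne
    push Not at hne
    refine hq (Subtype.ext ?_)
    have zero_of : ∀ {t : T}, ((toQmOne Φ T t : QmOne Φ T) : Qm Φ (TKK Φ T T)) = 0 → t = 0 :=
      fun h => (map_eq_zero_iff _ toQmOne_injective).mp (Subtype.ext h)
    -- The left and middle products are the two components of the inner derivation $\delta(a)\in
    -- L_0$, so their vanishing kills $\delta$ on $K_{-1}$.
    have hn : ∀ (a : T) (ha : TKK.mk 0 0 a ∈ K), δ.1 ⟨_, ha⟩ = 0 := fun a ha => by
      have h1 : (δ.1 ⟨_, ha⟩).der = 0 := by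
        refine Subtype.ext (Prod.ext (LinearMap.ext fun x => zero_of ?_)
          (LinearMap.ext fun x => neg_eq_zero.mp (zero_of ?_)))
        · rw [← mk_triple_left hK hδ ha x]
          exact (hmul _ _ _).symm.trans (congrArg Subtype.val (hne a (sK _ ha) x).1)
        · rw [← mk_triple_middle hK hδ ha x]
          exact (hmul _ _ _).symm.trans (congrArg Subtype.val (hne a (sK _ ha) x).2.2)
      rw [apply_mk_neg hδ ha, h1]
      rfl
    refine Qm.mk_eq_zero hK fun k hk => ?_
    obtain ⟨k1, k0, k2⟩ := (TKK.isHomogeneous_iff K).mp gK k hk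
    -- For $\gamma\in K_0$ and $y\in K_{-1}$, the Leibniz rule gives
    -- $[\delta\gamma,y]=\delta[\gamma,y]-[\gamma,\delta y]=0$, and `eq_zero_of_inner_ideal` applies
    -- to $\delta\gamma\in L_1$.
    have h0 : (δ.1 ⟨_, k0⟩).pos = 0 := by
      refine eq_zero_of_inner_ideal h6 hK gK fun y hy => ?_
      have e := PDer.apply_lie δ k0 hy (lie_mem_left Φ _ K _ _ k0)
      rw [hn y hy, lie_zero, add_zero, apply_mk_der hδ k0, TKK.lie_pos_neg] at e
      refine (congrArg TKK.der e).symm.trans ?_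
      have hy' : TKK.mk 0 0 (k.der.1.2 y) ∈ K := by
        rw [← TKK.lie_der_neg]
        exact lie_mem_left Φ _ K _ _ k0
      have : δ.1 ⟨_, lie_mem_left Φ _ K _ _ k0⟩ = δ.1 ⟨_, hy'⟩ :=
        congrArg δ.1 (Subtype.ext (TKK.lie_der_neg k.der y))
      rw [this, hn]
      rfl
    rw [TKK.pder_apply δ hk k1 k0 k2, apply_mk_pos hδ k1, hn _ k2, apply_mk_der hδ k0, h0, zero_add,
      add_zero]
    rfl

end

end JordanTripleSystem

namespace JordanTripleSystem

open JordanPair LieQuot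

section

variable {Φ T W : Type*} [CommRing Φ] [AddCommGroup T] [Module Φ T] [JordanTripleSystem Φ T]
  [AddCommGroup W] [Module Φ W] [JordanTripleSystem Φ W] {j : T →ₗ[Φ] W}

/-! ### Systems of quotients -/

/-- An element of a Jordan triple system of `𝔐`-quotients that is annihilated by an ideal of `T`
with zero annihilator is zero. -/
theorem IsMQuotients.eq_zero (hj : IsMQuotients j) {I : Submodule Φ T} (hI : IsIdeal I)
    (hA : AnnEqZero I) {w : W}
    (h1 : ∀ b ∈ I, ∀ y : T, triple (Φ := Φ) w (j b) (j y) = 0)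
    (h2 : ∀ b ∈ I, ∀ y : T, triple (Φ := Φ) w (j y) (j b) = 0)
    (h3 : ∀ b ∈ I, ∀ y : T, triple (Φ := Φ) (j b) w (j y) = 0) : w = 0 := by
  have h1' : ∀ b ∈ I, ∀ y : T, triple (Φ := Φ) (j y) (j b) w = 0 := fun b hb y =>
    (triple_comm _ _ _).trans (h1 b hb y)
  have h2' : ∀ b ∈ I, ∀ y : T, triple (Φ := Φ) (j b) (j y) w = 0 := fun b hb y =>
    (triple_comm _ _ _).trans (h2 b hb y)
  have h3' : ∀ b ∈ I, ∀ y : T, triple (Φ := Φ) (j y) w (j b) = 0 := fun b hb y =>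
    (triple_comm _ _ _).trans (h3 b hb y)
  obtain ⟨hinj, hom, hq⟩ := hj
  have ann : ∀ t : T, (∀ b ∈ I, ∀ y : T, triple (Φ := Φ) (j y) (j b) (j t) = 0 ∧
      triple (Φ := Φ) (j b) (j y) (j t) = 0 ∧ triple (Φ := Φ) (j b) (j t) (j y) = 0) → t = 0 := by
    refine fun t ht => hA t fun b hb y => ?_
    obtain ⟨e1, e2, e3⟩ := ht b hb y
    rw [← hom, triple_comm] at e1 e2 e3
    exact ⟨hinj (e1.trans (map_zero j).symm), hinj (e2.trans (map_zero j).symm),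
      hinj (e3.trans (map_zero j).symm)⟩
  -- Any product $\{w,s,x\}$ that falls into $T$ annihilates $I$: the Jordan identity moves the
  -- element of $I$ next to $w$. The same is shown for $\{s,w,x\}$, so $w$ cannot be absorbed
  -- nontrivially by any ideal.
  have left : ∀ t s x : T, j t = triple (Φ := Φ) w (j s) (j x) → t = 0 := by
    refine fun t s x ht => ann t fun b hb y => ?_
    rw [ht]
    refine ⟨?_, ?_, ?_⟩
    · rw [triple_jordan, h1' b hb, ← hom, ← hom, h1 _ (hI b hb y s).1, h2 _ (hI b hb y x).2.1]
      simp
    · rw [triple_jordan, h2' b hb, ← hom, ← hom, h1 _ (hI b hb y s).2.1, h2 _ (hI b hb y x).1]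
      simp
    -- $\{b,\{w,s,x\},y\}$ is the middle term of the identity for $D_{s,w}$ on $\{b,x,y\}$; the
    -- identity for $D_{b,x}$ disposes of the remaining term $\{b,x,\{s,w,y\}\}$.
    · have e1 := triple_jordan (Φ := Φ) (j s) w (j b) (j x) (j y)
      have e2 := triple_jordan (Φ := Φ) (j b) (j x) (j s) w (j y)
      rw [h1' b hb, ← hom, ← hom, h3 _ (hI b hb x s).1, h3' _ (hI b hb x y).1] at e2
      rw [e2, h3' b hb, ← hom, h3' _ (hI b hb x y).1] at e1
      simpa using e1
  have middle : ∀ t s x : T, j t = triple (Φ := Φ) (j s) w (j x) → t = 0 := by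
    refine fun t s x ht => ann t fun b hb y => ?_
    rw [ht]
    refine ⟨?_, ?_, ?_⟩
    · rw [triple_jordan, h2' b hb, ← hom, ← hom, h3 _ (hI b hb y s).2.1, h3' _ (hI b hb y x).2.1]
      simp
    · rw [triple_jordan, h1' b hb, ← hom, ← hom, h3 _ (hI b hb y s).1, h3' _ (hI b hb y x).1]
      simp
    · have e1 := triple_jordan (Φ := Φ) w (j s) (j b) (j x) (j y)
      have e2 := triple_jordan (Φ := Φ) (j b) (j x) w (j s) (j y)
      rw [h2' b hb, ← hom, ← hom, h1 _ (hI b hb x s).2.1, h2 _ (hI b hb x y).1] at e2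
      rw [e2, h2 b hb, ← hom, h2 _ (hI b hb x y).1] at e1
      simpa using e1
  by_contra hw
  obtain ⟨I', -, -, habs, a, ha, x, hne⟩ := hq w hw
  obtain ⟨⟨t1, e1⟩, ⟨t2, e2⟩, ⟨t3, e3⟩⟩ := habs a ha x
  rcases hne with hne | hne | hne
  · exact hne (by rw [← e1, left _ _ _ e1, map_zero])
  · exact hne (by rw [← e2, left _ _ _ e2, map_zero])
  · exact hne (by rw [← e3, middle _ _ _ e3, map_zero])

/-- A derivation of a Jordan triple system of `𝔐`-quotients that vanishes on `T` is zero. -/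
theorem IsMQuotients.ider_eq_zero (hj : IsMQuotients j) {γ : IDer Φ W W}
    (h1 : ∀ x : T, γ.1.1 (j x) = 0) (h2 : ∀ x : T, γ.1.2 (j x) = 0) : γ = 0 := by
  have hd := isDerivation_of_mem Φ W W γ.2
  refine Subtype.ext (Prod.ext (LinearMap.ext fun w => ?_) (LinearMap.ext fun w => ?_))
  · change γ.1.1 w = 0
    rcases eq_or_ne w 0 with rfl | hw
    · exact map_zero _
    obtain ⟨I, hI, hA, habs, -⟩ := hj.2.2 w hw
    refine hj.eq_zero hI hA (fun b hb y => ?_) (fun b hb y => ?_) (fun b hb y => ?_)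
    -- The product $\{w,b,y\}$ lies in $T$, where $\gamma$ vanishes, so the derivation rule leaves
    -- $\{\gamma w,b,y\}=0$. Hence $\gamma w$ is annihilated by $I$.
    · obtain ⟨t, ht⟩ := (habs b hb y).1
      have e := hd.1 w (j b) (j y)
      rw [tp_eq, ← ht, h1, h2, h1] at e
      simpa [tp_eq] using e.symm
    · obtain ⟨t, ht⟩ := (habs b hb y).2.1
      have e := hd.1 w (j y) (j b)
      rw [tp_eq, ← ht, h1, h2, h1] at e
      simpa [tp_eq] using e.symm
    · obtain ⟨t, ht⟩ := (habs b hb y).2.2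
      have e := hd.2 (j b) w (j y)
      rw [tm_eq, ← ht, h2, h2, h2] at e
      simpa [tm_eq] using e.symm
  · change γ.1.2 w = 0
    rcases eq_or_ne w 0 with rfl | hw
    · exact map_zero _
    obtain ⟨I, hI, hA, habs, -⟩ := hj.2.2 w hw
    refine hj.eq_zero hI hA (fun b hb y => ?_) (fun b hb y => ?_) (fun b hb y => ?_)
    · obtain ⟨t, ht⟩ := (habs b hb y).1
      have e := hd.2 w (j b) (j y)
      rw [tm_eq, ← ht, h2, h1, h2] at e
      simpa [tm_eq] using e.symm
    · obtain ⟨t, ht⟩ := (habs b hb y).2.1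
      have e := hd.2 w (j y) (j b)
      rw [tm_eq, ← ht, h2, h1, h2] at e
      simpa [tm_eq] using e.symm
    · obtain ⟨t, ht⟩ := (habs b hb y).2.2
      have e := hd.1 (j b) w (j y)
      rw [tp_eq, ← ht, h1, h1, h1] at e
      simpa [tp_eq] using e.symm

theorem IsMQuotients.ider_ext (hj : IsMQuotients j) {γ μ : IDer Φ W W}
    (h1 : ∀ x : T, γ.1.1 (j x) = μ.1.1 (j x)) (h2 : ∀ x : T, γ.1.2 (j x) = μ.1.2 (j x)) :
    γ = μ := by
  refine sub_eq_zero.mp (hj.ider_eq_zero (fun x => ?_) fun x => ?_)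
  · rw [TKK.sub_fst, h1, sub_self]
  · rw [TKK.sub_snd, h2, sub_self]

/-- Send $\sum\delta(x_i,y_i)$ to $\sum\delta(jx_i,jy_i)$. The result could depend on the
presentation; for $\mathfrak M$-quotients `IsMQuotients.ider_ext` rules this out, and that is what
makes the TKK construction functorial along $j$. -/
theorem exists_extDer (hj : IsTripleHom j) (γ : IDer Φ T T) :
    ∃ μ : IDer Φ W W, (∀ x : T, μ.1.1 (j x) = j (γ.1.1 x)) ∧
      ∀ x : T, μ.1.2 (j x) = j (γ.1.2 x) := by
  obtain ⟨γ, hγ⟩ := γ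
  refine Submodule.span_induction (p := fun γ _ => ∃ μ : IDer Φ W W,
    (∀ x : T, μ.1.1 (j x) = j (γ.1 x)) ∧ ∀ x : T, μ.1.2 (j x) = j (γ.2 x)) ?_ ?_ ?_ ?_ hγ
  · rintro _ ⟨x, y, rfl⟩
    refine ⟨JordanPair.inner Φ (j x) (j y), fun z => (hj x y z).symm, fun z => ?_⟩
    rw [TKK.inner_snd]
    exact (congrArg Neg.neg (hj y x z).symm).trans (map_neg j _).symm
  · exact ⟨0, fun x => (map_zero j).symm, fun x => (map_zero j).symm⟩
  · rintro γ γ' _ _ ⟨μ, h1, h2⟩ ⟨μ', h1', h2'⟩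
    refine ⟨μ + μ', fun x => ?_, fun x => ?_⟩
    · rw [TKK.add_fst, h1, h1', ← map_add]
      rfl
    · rw [TKK.add_snd, h2, h2', ← map_add]
      rfl
  · rintro c γ _ ⟨μ, h1, h2⟩
    refine ⟨c • μ, fun x => ?_, fun x => ?_⟩
    · exact (congrArg (c • ·) (h1 x)).trans (map_smul j c _).symm
    · exact (congrArg (c • ·) (h2 x)).trans (map_smul j c _).symm

/-- The extension to `W` of an inner derivation of `T`. -/
noncomputable def extDer (hj : IsMQuotients j) (γ : IDer Φ T T) : IDer Φ W W :=
  (exists_extDer hj.2.1 γ).choose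

theorem extDer_fst (hj : IsMQuotients j) (γ : IDer Φ T T) (x : T) :
    (extDer hj γ).1.1 (j x) = j (γ.1.1 x) := (exists_extDer hj.2.1 γ).choose_spec.1 x

theorem extDer_snd (hj : IsMQuotients j) (γ : IDer Φ T T) (x : T) :
    (extDer hj γ).1.2 (j x) = j (γ.1.2 x) := (exists_extDer hj.2.1 γ).choose_spec.2 x

theorem extDer_add (hj : IsMQuotients j) (γ μ : IDer Φ T T) :
    extDer hj (γ + μ) = extDer hj γ + extDer hj μ :=
  hj.ider_ext
    (fun x => by rw [extDer_fst, TKK.add_fst, TKK.add_fst, extDer_fst, extDer_fst, map_add])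
    fun x => by rw [extDer_snd, TKK.add_snd, TKK.add_snd, extDer_snd, extDer_snd, map_add]

theorem extDer_sub (hj : IsMQuotients j) (γ μ : IDer Φ T T) :
    extDer hj (γ - μ) = extDer hj γ - extDer hj μ :=
  hj.ider_ext
    (fun x => by rw [extDer_fst, TKK.sub_fst, TKK.sub_fst, extDer_fst, extDer_fst, map_sub])
    fun x => by rw [extDer_snd, TKK.sub_snd, TKK.sub_snd, extDer_snd, extDer_snd, map_sub]

theorem extDer_smul (hj : IsMQuotients j) (c : Φ) (γ : IDer Φ T T) :
    extDer hj (c • γ) = c • extDer hj γ :=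
  hj.ider_ext
    (fun x => (extDer_fst hj _ x).trans
      ((map_smul j c _).trans (congrArg (c • ·) (extDer_fst hj γ x).symm)))
    fun x => (extDer_snd hj _ x).trans
      ((map_smul j c _).trans (congrArg (c • ·) (extDer_snd hj γ x).symm))

theorem extDer_lie (hj : IsMQuotients j) (γ μ : IDer Φ T T) :
    extDer hj ⁅γ, μ⁆ = ⁅extDer hj γ, extDer hj μ⁆ :=
  hj.ider_ext (fun x => by
      rw [extDer_fst, TKK.lie_fst, TKK.lie_fst, extDer_fst, extDer_fst, extDer_fst, extDer_fst,
        map_sub])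
    fun x => by
      rw [extDer_snd, TKK.lie_snd, TKK.lie_snd, extDer_snd, extDer_snd, extDer_snd, extDer_snd,
        map_sub]

theorem extDer_inner (hj : IsMQuotients j) (x y : T) :
    extDer hj (JordanPair.inner Φ x y) = JordanPair.inner Φ (j x) (j y) :=
  hj.ider_ext (fun z => by
      rw [extDer_fst, TKK.inner_fst, TKK.inner_fst]
      exact hj.2.1 x y z)
    fun z => by
      rw [extDer_snd, TKK.inner_snd, TKK.inner_snd, map_neg]
      exact congrArg Neg.neg (hj.2.1 y x z)

theorem extDer_swap (hj : IsMQuotients j) (γ : IDer Φ T T) :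
    extDer hj (swapDer γ) = swapDer (extDer hj γ) :=
  hj.ider_ext (fun x => (extDer_fst hj _ x).trans (extDer_snd hj γ x).symm)
    fun x => (extDer_snd hj _ x).trans (extDer_fst hj γ x).symm

theorem extDer_injective (hj : IsMQuotients j) {γ : IDer Φ T T} (h : extDer hj γ = 0) :
    γ = 0 := by
  refine Subtype.ext (Prod.ext (LinearMap.ext fun x => hj.1 ?_) (LinearMap.ext fun x => hj.1 ?_))
  · rw [← extDer_fst hj, h]
    exact (map_zero j).symm
  · rw [← extDer_snd hj, h]
    exact (map_zero j).symm

theorem extDer_zero (hj : IsMQuotients j) : extDer hj (0 : IDer Φ T T) = 0 := by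
  rw [← sub_self (0 : IDer Φ T T), extDer_sub, sub_self]

/-- The homomorphism `TKK(V(T)) → TKK(V(W))` for a Jordan triple system `W` of `𝔐`-quotients
of `T`. -/
noncomputable def mapTKK (hj : IsMQuotients j) : TKK Φ T T →ₗ⁅Φ⁆ TKK Φ W W where
  toFun a := TKK.mk (j a.pos) (extDer hj a.der) (j a.neg)
  map_add' a b := TKK.ext (map_add j _ _) (extDer_add hj _ _) (map_add j _ _)
  map_smul' c a := TKK.ext (map_smul j c _) (extDer_smul hj c _) (map_smul j c _)
  map_lie' := by
    intro a b
    refine TKK.ext ?_ ?_ ?_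
    · change j (a.der.1.1 b.pos - b.der.1.1 a.pos) =
        (extDer hj a.der).1.1 (j b.pos) - (extDer hj b.der).1.1 (j a.pos)
      rw [map_sub, extDer_fst, extDer_fst]
    · change extDer hj (⁅a.der, b.der⁆ + JordanPair.inner Φ a.pos b.neg -
        JordanPair.inner Φ b.pos a.neg) = ⁅extDer hj a.der, extDer hj b.der⁆ +
          JordanPair.inner Φ (j a.pos) (j b.neg) - JordanPair.inner Φ (j b.pos) (j a.neg)
      rw [extDer_sub, extDer_add, extDer_lie, extDer_inner, extDer_inner]
    · change j (a.der.1.2 b.neg - b.der.1.2 a.neg) =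
        (extDer hj a.der).1.2 (j b.neg) - (extDer hj b.der).1.2 (j a.neg)
      rw [map_sub, extDer_snd, extDer_snd]

theorem mapTKK_mk (hj : IsMQuotients j) (x y : T) (γ : IDer Φ T T) :
    mapTKK hj (TKK.mk x γ y) = TKK.mk (j x) (extDer hj γ) (j y) := rfl

theorem mapTKK_pos (hj : IsMQuotients j) (x : T) :
    mapTKK hj (TKK.mk x 0 0) = TKK.mk (j x) 0 0 := by
  rw [mapTKK_mk, extDer_zero, map_zero]

theorem mapTKK_neg (hj : IsMQuotients j) (x : T) :
    mapTKK hj (TKK.mk 0 0 x) = TKK.mk 0 0 (j x) := by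
  rw [mapTKK_mk, extDer_zero, map_zero]

theorem mapTKK_der (hj : IsMQuotients j) (γ : IDer Φ T T) :
    mapTKK hj (TKK.mk 0 γ 0) = TKK.mk 0 (extDer hj γ) 0 := by
  rw [mapTKK_mk, map_zero]

theorem mapTKK_exchange (hj : IsMQuotients j) (a : TKK Φ T T) :
    mapTKK hj (exchange Φ T a) = exchange Φ W (mapTKK hj a) :=
  TKK.ext rfl (extDer_swap hj a.der) rfl

theorem mapTKK_mem_grading (hj : IsMQuotients j) {n : ℤ} {a : TKK Φ T T} :
    mapTKK hj a ∈ TKK.grading Φ W W n ↔ a ∈ TKK.grading Φ T T n := by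
  constructor
  · rintro ⟨h1, h0, h2⟩
    exact ⟨fun h => (map_eq_zero_iff j hj.1).mp (h1 h), fun h => extDer_injective hj (h0 h),
      fun h => (map_eq_zero_iff j hj.1).mp (h2 h)⟩
  · rintro ⟨h1, h0, h2⟩
    exact ⟨fun h => (congrArg j (h1 h)).trans (map_zero j),
      fun h => (congrArg (extDer hj) (h0 h)).trans (extDer_zero hj),
      fun h => (congrArg j (h2 h)).trans (map_zero j)⟩

theorem mapTKK_injective (hj : IsMQuotients j) : Function.Injective (mapTKK hj) := by
  refine (injective_iff_map_eq_zero (mapTKK hj : TKK Φ T T →ₗ[Φ] TKK Φ W W)).mpr fun a ha => ?_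
  exact TKK.ext ((map_eq_zero_iff j hj.1).mp (congrArg TKK.pos ha))
    (extDer_injective hj (congrArg TKK.der ha))
    ((map_eq_zero_iff j hj.1).mp (congrArg TKK.neg ha))

/-! ### The ideal of `TKK(V(T))` generated by an ideal of `T` -/

theorem IsIdeal.ider_mem {I : Submodule Φ T} (hI : IsIdeal I) (γ : IDer Φ T T) {a : T}
    (ha : a ∈ I) : γ.1.1 a ∈ I ∧ γ.1.2 a ∈ I := by
  obtain ⟨γ, hγ⟩ := γ
  refine Submodule.span_induction (p := fun γ _ => γ.1 a ∈ I ∧ γ.2 a ∈ I) ?_ ?_ ?_ ?_ hγ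
  · rintro _ ⟨x, y, rfl⟩
    exact ⟨(hI a ha x y).2.2, neg_mem (hI a ha y x).2.2⟩
  · exact ⟨zero_mem _, zero_mem _⟩
  · rintro γ μ _ _ h h'
    exact ⟨add_mem h.1 h'.1, add_mem h.2 h'.2⟩
  · rintro c γ _ h
    exact ⟨Submodule.smul_mem _ c h.1, Submodule.smul_mem _ c h.2⟩

/-- The span `δ(I, T) + δ(T, I)` in `IDer(V(T))`. -/
def innerIdeal (I : Submodule Φ T) : Submodule Φ (IDer Φ T T) :=
  Submodule.span Φ {γ | ∃ a ∈ I, ∃ x : T,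
    γ = JordanPair.inner Φ a x ∨ γ = JordanPair.inner Φ x a}

theorem inner_mem_left {I : Submodule Φ T} {a : T} (ha : a ∈ I) (x : T) :
    JordanPair.inner Φ a x ∈ innerIdeal I := Submodule.subset_span ⟨a, ha, x, Or.inl rfl⟩

theorem inner_mem_right {I : Submodule Φ T} {a : T} (ha : a ∈ I) (x : T) :
    JordanPair.inner Φ x a ∈ innerIdeal I := Submodule.subset_span ⟨a, ha, x, Or.inr rfl⟩

theorem IsIdeal.innerIdeal_apply {I : Submodule Φ T} (hI : IsIdeal I) {γ : IDer Φ T T}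
    (hγ : γ ∈ innerIdeal I) (x : T) : γ.1.1 x ∈ I ∧ γ.1.2 x ∈ I := by
  refine Submodule.span_induction (p := fun γ _ => γ.1.1 x ∈ I ∧ γ.1.2 x ∈ I) ?_ ?_ ?_ ?_ hγ
  · rintro _ ⟨a, ha, y, rfl | rfl⟩
    · exact ⟨(hI a ha y x).1, neg_mem (hI a ha y x).2.1⟩
    · exact ⟨(hI a ha y x).2.1, neg_mem (hI a ha y x).1⟩
  · exact ⟨zero_mem _, zero_mem _⟩
  · rintro γ μ _ _ h h'
    exact ⟨add_mem h.1 h'.1, add_mem h.2 h'.2⟩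
  · rintro c γ _ h
    exact ⟨Submodule.smul_mem _ c h.1, Submodule.smul_mem _ c h.2⟩

theorem IsIdeal.lie_mem_innerIdeal {I : Submodule Φ T} (hI : IsIdeal I) (μ : IDer Φ T T)
    {γ : IDer Φ T T} (hγ : γ ∈ innerIdeal I) : ⁅μ, γ⁆ ∈ innerIdeal I := by
  refine Submodule.span_induction (p := fun γ _ => ⁅μ, γ⁆ ∈ innerIdeal I) ?_ ?_ ?_ ?_ hγ
  · rintro _ ⟨a, ha, y, rfl | rfl⟩
    · rw [TKK.lie_inner]
      exact add_mem (inner_mem_left (hI.ider_mem μ ha).1 _) (inner_mem_left ha _)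
    · rw [TKK.lie_inner]
      exact add_mem (inner_mem_right ha _) (inner_mem_right (hI.ider_mem μ ha).2 _)
  · rw [lie_zero]
    exact zero_mem _
  · rintro γ γ' _ _ h h'
    rw [lie_add]
    exact add_mem h h'
  · rintro c γ _ h
    rw [lie_smul]
    exact Submodule.smul_mem _ c h

/-- The ideal `I ⊕ (δ(I, T) + δ(T, I)) ⊕ I` of `TKK(V(T))`. -/
noncomputable def IsIdeal.toLieIdeal {I : Submodule Φ T} (hI : IsIdeal I) :
    LieIdeal Φ (TKK Φ T T) where
  carrier := {a | a.pos ∈ I ∧ a.der ∈ innerIdeal I ∧ a.neg ∈ I}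
  add_mem' ha hb := ⟨add_mem ha.1 hb.1, add_mem ha.2.1 hb.2.1, add_mem ha.2.2 hb.2.2⟩
  zero_mem' := ⟨zero_mem I, zero_mem (innerIdeal I), zero_mem I⟩
  smul_mem' c _ ha := ⟨Submodule.smul_mem _ c ha.1, Submodule.smul_mem _ c ha.2.1,
    Submodule.smul_mem _ c ha.2.2⟩
  lie_mem {x _} := fun ⟨h1, h0, h2⟩ =>
    ⟨sub_mem (hI.ider_mem x.der h1).1 (hI.innerIdeal_apply h0 x.pos).1,
      sub_mem (add_mem (hI.lie_mem_innerIdeal x.der h0) (inner_mem_right h2 _))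
        (inner_mem_left h1 _),
      sub_mem (hI.ider_mem x.der h2).2 (hI.innerIdeal_apply h0 x.neg).2⟩

theorem IsIdeal.isHomogeneous_toLieIdeal {I : Submodule Φ T} (hI : IsIdeal I) :
    DirectSum.SetLike.IsHomogeneous (TKK.grading Φ T T) hI.toLieIdeal :=
  (TKK.isHomogeneous_iff _).mpr fun _ ha =>
    ⟨⟨ha.1, zero_mem _, zero_mem _⟩, ⟨zero_mem _, ha.2.1, zero_mem _⟩,
      ⟨zero_mem _, zero_mem _, ha.2.2⟩⟩

/-- It is enough that the centralizer vanishes. If $c$ centralizes the ideal, its brackets with $I$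
in degrees $\pm1$ and with $\delta(I,T)$, $\delta(T,I)$ show that its outer components annihilate
$I$. -/
theorem IsIdeal.isEssential_toLieIdeal {I : Submodule Φ T} (hI : IsIdeal I) (hA : AnnEqZero I) :
    IsEssential hI.toLieIdeal := by
  have h1 : ∀ c : TKK Φ T T, (∀ k ∈ hI.toLieIdeal, ⁅c, k⁆ = 0) → c.pos = 0 := fun c hc =>
    hA _ fun a ha x => by
      have e1 := congrArg TKK.der (hc (TKK.mk 0 0 a) ⟨zero_mem _, zero_mem _, ha⟩)
      have e2 := congrArg TKK.pos (hc (TKK.mk 0 (JordanPair.inner Φ a x) 0)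
        ⟨zero_mem _, inner_mem_left ha x, zero_mem _⟩)
      simp only [TKK.der_lie, TKK.pos_mk, TKK.neg_mk, TKK.der_mk, lie_zero, TKK.inner_zero_left,
        zero_add, sub_zero, TKK.der_zero] at e1
      simp only [TKK.pos_lie, TKK.pos_mk, TKK.der_mk, map_zero, zero_sub, TKK.pos_zero,
        TKK.inner_fst] at e2
      have e3 := inner_eq_zero_iff.mp e1 x
      exact ⟨e3.1, (triple_comm _ _ _).trans (neg_eq_zero.mp e2),
        (triple_comm _ _ _).trans e3.2⟩
  have h2 : ∀ c : TKK Φ T T, (∀ k ∈ hI.toLieIdeal, ⁅c, k⁆ = 0) → c.neg = 0 := fun c hc =>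
    hA _ fun a ha x => by
      have e1 := congrArg TKK.der (hc (TKK.mk a 0 0) ⟨ha, zero_mem _, zero_mem _⟩)
      have e2 := congrArg TKK.neg (hc (TKK.mk 0 (JordanPair.inner Φ x a) 0)
        ⟨zero_mem _, inner_mem_right ha x, zero_mem _⟩)
      simp only [TKK.der_lie, TKK.pos_mk, TKK.neg_mk, TKK.der_mk, lie_zero, TKK.inner_zero_right,
        zero_add, zero_sub, TKK.der_zero] at e1
      simp only [TKK.neg_lie, TKK.neg_mk, TKK.der_mk, map_zero, zero_sub, TKK.neg_zero,
        TKK.inner_snd, neg_neg] at e2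
      have e3 := inner_eq_zero_iff.mp (neg_eq_zero.mp e1) x
      exact ⟨e3.2, (triple_comm _ _ _).trans e2, (triple_comm _ _ _).trans e3.1⟩
  refine isEssential_of_centralizer fun c hc => ?_
  -- The centralizer is an ideal, so the vanishing of outer components also holds for $[c,x]$; for
  -- $x$ in degrees $\pm1$ this says that the degree 0 part of $c$ acts as zero.
  have hlie : ∀ x : TKK Φ T T, ∀ k ∈ hI.toLieIdeal, ⁅⁅c, x⁆, k⁆ = 0 := fun x k hk => by
    rw [lie_lie, hc k hk, lie_zero, hc _ (lie_mem_right Φ _ _ x k hk), sub_zero]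
  refine TKK.ext (h1 c hc) (Subtype.ext (Prod.ext (LinearMap.ext fun x => ?_)
    (LinearMap.ext fun x => ?_))) (h2 c hc)
  · have e := h1 _ (hlie (TKK.mk x 0 0))
    simpa [TKK.pos_lie] using e
  · have e := h2 _ (hlie (TKK.mk 0 0 x))
    simpa [TKK.neg_lie] using e

/-! ### Absorption by essential ideals -/

/-- $L$ is generated by its degrees $\pm1$, since $L_0$ is spanned by the brackets
$[x,y]=\delta(x,y)$, and $\mathrm{ad}\,m$ is a derivation. -/
theorem lie_mapTKK_mem_range (hj : IsMQuotients j) {m : TKK Φ W W}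
    (h1 : ∀ x : T, ⁅m, mapTKK hj (TKK.mk x 0 0)⁆ ∈ (mapTKK hj).range)
    (h2 : ∀ x : T, ⁅m, mapTKK hj (TKK.mk 0 0 x)⁆ ∈ (mapTKK hj).range) (l : TKK Φ T T) :
    ⁅m, mapTKK hj l⁆ ∈ (mapTKK hj).range := by
  have h0 : ∀ γ : IDer Φ T T, ⁅m, mapTKK hj (TKK.mk 0 γ 0)⁆ ∈ (mapTKK hj).range := by
    rintro ⟨γ, hγ⟩
    refine Submodule.span_induction (p := fun γ hγ =>
      ⁅m, mapTKK hj (TKK.mk 0 ⟨γ, hγ⟩ 0)⁆ ∈ (mapTKK hj).range) ?_ ?_ ?_ ?_ hγ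
    · rintro _ ⟨x, y, rfl⟩
      change ⁅m, mapTKK hj (TKK.mk 0 (JordanPair.inner Φ x y) 0)⁆ ∈ _
      rw [← TKK.lie_pos_neg, LieHom.map_lie, leibniz_lie]
      exact add_mem ((mapTKK hj).range.lie_mem (h1 x) ⟨_, rfl⟩)
        ((mapTKK hj).range.lie_mem ⟨_, rfl⟩ (h2 y))
    · change ⁅m, mapTKK hj 0⁆ ∈ _
      rw [map_zero, lie_zero]
      exact zero_mem _
    · intro γ μ hγ hμ h h'
      have : (TKK.mk 0 ⟨γ + μ, add_mem hγ hμ⟩ 0 : TKK Φ T T) =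
          TKK.mk 0 ⟨γ, hγ⟩ 0 + TKK.mk 0 ⟨μ, hμ⟩ 0 :=
        TKK.ext (add_zero _).symm rfl (add_zero _).symm
      rw [this, map_add, lie_add]
      exact add_mem h h'
    · intro c γ hγ h
      have : (TKK.mk 0 ⟨c • γ, Submodule.smul_mem _ c hγ⟩ 0 : TKK Φ T T) =
          c • TKK.mk 0 ⟨γ, hγ⟩ 0 := TKK.ext (smul_zero _).symm rfl (smul_zero _).symm
      rw [this, map_smul, lie_smul]
      exact SMulMemClass.smul_mem c h
  rw [TKK.eq_sum l, map_add, map_add, lie_add, lie_add]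
  exact add_mem (add_mem (h1 _) (h0 _)) (h2 _)

/-- `I` absorbs the element `w` of `W` into `T`. -/
def TripleAbsorbs (j : T →ₗ[Φ] W) (I : Submodule Φ T) (w : W) : Prop :=
  ∀ a ∈ I, ∀ x : T,
    triple (Φ := Φ) w (j a) (j x) ∈ LinearMap.range j ∧
    triple (Φ := Φ) w (j x) (j a) ∈ LinearMap.range j ∧
    triple (Φ := Φ) (j a) w (j x) ∈ LinearMap.range j

/-- For $k$ in degree $-1$, $[w,k]=\delta(w,k)$ is an inner derivation of $W$ that need not come
from $T$. It does map $T$ into $T$, in both components, so one more bracket with $L$ lands in $L$.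
-/
theorem lie_lie_mapTKK_mem_range (hj : IsMQuotients j) {I : Submodule Φ T} (hI : IsIdeal I)
    {w : W} (hw : TripleAbsorbs j I w) {k : TKK Φ T T} (hk : k ∈ hI.toLieIdeal) (l : TKK Φ T T) :
    ⁅⁅(TKK.mk w 0 0 : TKK Φ W W), mapTKK hj k⁆, mapTKK hj l⁆ ∈ (mapTKK hj).range := by
  obtain ⟨-, k0, k2⟩ := hk
  rw [TKK.eq_sum k, map_add, map_add, lie_add, lie_add, add_lie, add_lie,
    mapTKK_pos, TKK.lie_pos_pos, zero_lie, zero_add]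
  refine add_mem ?_ (lie_mapTKK_mem_range hj (fun x => ?_) (fun x => ?_) l)
  · have h : ∃ t : T, j t = (extDer hj k.der).1.1 w := by
      refine Submodule.span_induction (p := fun γ _ => ∃ t : T, j t = (extDer hj γ).1.1 w)
        ?_ ?_ ?_ ?_ k0
      · rintro _ ⟨a, ha, x, rfl | rfl⟩
        · obtain ⟨t, ht⟩ := (hw a ha x).2.1
          refine ⟨t, ?_⟩
          rw [extDer_inner, TKK.inner_fst, ht]
          exact triple_comm _ _ _
        · obtain ⟨t, ht⟩ := (hw a ha x).1
          refine ⟨t, ?_⟩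
          rw [extDer_inner, TKK.inner_fst, ht]
          exact triple_comm _ _ _
      · exact ⟨0, by rw [extDer_zero, map_zero]; rfl⟩
      · rintro γ μ _ _ ⟨t, ht⟩ ⟨t', ht'⟩
        exact ⟨t + t', by rw [extDer_add, map_add, ht, ht']; rfl⟩
      · rintro c γ _ ⟨t, ht⟩
        exact ⟨c • t, by rw [extDer_smul, map_smul, ht]; rfl⟩
    obtain ⟨t, ht⟩ := h
    rw [mapTKK_der, TKK.lie_pos_der, ← ht, ← map_neg, ← mapTKK_pos hj, ← LieHom.map_lie]
    exact ⟨_, rfl⟩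
  · obtain ⟨t, ht⟩ := (hw _ k2 x).1
    rw [mapTKK_neg, mapTKK_pos, TKK.lie_pos_neg, TKK.lie_der_pos, TKK.inner_fst]
    refine ⟨TKK.mk t 0 0, (mapTKK_pos hj t).trans ?_⟩
    rw [ht]
    rfl
  · obtain ⟨t, ht⟩ := (hw _ k2 x).2.2
    rw [mapTKK_neg, mapTKK_neg, TKK.lie_pos_neg, TKK.lie_der_neg, TKK.inner_snd]
    refine ⟨TKK.mk 0 0 (-t), (mapTKK_neg hj (-t)).trans ?_⟩
    rw [map_neg, ht]
    rfl

theorem absorbs_lie_self (hj : IsMQuotients j) {I : Submodule Φ T} (hI : IsIdeal I)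
    {w : W} (hw : TripleAbsorbs j I w) :
    Absorbs (mapTKK hj) ⁅hI.toLieIdeal, hI.toLieIdeal⁆ (TKK.mk w 0 0) := by
  intro k hk
  change ⁅_, _⁆ ∈ (mapTKK hj).range
  have hk' : k ∈ (⁅hI.toLieIdeal, hI.toLieIdeal⁆ : LieIdeal Φ (TKK Φ T T)).toSubmodule := hk
  rw [LieSubmodule.lieIdeal_oper_eq_linear_span'] at hk'
  refine Submodule.span_induction
    (p := fun k _ => ⁅(TKK.mk w 0 0 : TKK Φ W W), mapTKK hj k⁆ ∈ (mapTKK hj).range)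
    ?_ ?_ ?_ ?_ hk'
  -- $[w,[a,b]]=[[w,a],b]-[[w,b],a]$ has only double brackets of the kind just controlled; this is
  -- why $[J,J]$ absorbs $w$ for $J=I\oplus(\delta(I,T)+\delta(T,I))\oplus I$.
  · rintro _ ⟨a, ha, b, hb, rfl⟩
    rw [LieHom.map_lie, leibniz_lie, ← lie_skew (mapTKK hj a)]
    exact add_mem (lie_lie_mapTKK_mem_range hj hI hw ha b)
      (neg_mem (lie_lie_mapTKK_mem_range hj hI hw hb a))
  · rw [map_zero, lie_zero]
    exact zero_mem _
  · intro a b _ _ ha hb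
    rw [map_add, lie_add]
    exact add_mem ha hb
  · intro c a _ ha
    rw [map_smul, lie_smul]
    exact SMulMemClass.smul_mem c ha

theorem exists_absorbs [StronglyNondegenerate Φ T] (hj : IsMQuotients j) (w : W) :
    ∃ K : LieIdeal Φ (TKK Φ T T), IsEssential K ∧
      DirectSum.SetLike.IsHomogeneous (TKK.grading Φ T T) K ∧
      Absorbs (mapTKK hj) K (TKK.mk w 0 0) := by
  rcases eq_or_ne w 0 with rfl | hw
  · refine ⟨⊤, IsEssential.top, fun _ _ _ => LieSubmodule.mem_top _, fun k _ => ⟨0, ?_⟩⟩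
    rw [map_zero]
    exact (zero_lie _).symm
  obtain ⟨I, hI, hA, habs, -⟩ := hj.2.2 w hw
  exact ⟨_, (hI.isEssential_toLieIdeal hA).lie_self,
    TKK.isHomogeneous_lie_self hI.isHomogeneous_toLieIdeal, absorbs_lie_self hj hI habs⟩

/-! ### The embedding of $W$ into $Q_m(L)_1$ and its uniqueness -/

theorem quotMap_mem_component [StronglyNondegenerate Φ T] (hj : IsMQuotients j) (w : W) :
    quotMap (mapTKK_injective hj) (TKK.mk w 0 0) ∈ QmOne Φ T := by
  obtain ⟨K, hK, gK, hw⟩ := exists_absorbs hj w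
  refine ⟨K, hK, hw.der (mapTKK_injective hj), gK, fun τ x hx => ?_, quotMap_eq _ hK hw⟩
  rw [← mapTKK_mem_grading hj, hw.map_der (mapTKK_injective hj) x.2, add_comm]
  exact SetLike.GradedBracket.bracket_mem (TKK.mk_pos_mem_grading w)
    ((mapTKK_mem_grading hj).mpr hx)

/-- The map of a Jordan triple system of `𝔐`-quotients of `T` to `(Q_m(TKK(V(T))))₁`. -/
noncomputable def toQuot [StronglyNondegenerate Φ T] (hj : IsMQuotients j) :
    W →ₗ[Φ] QmOne Φ T where
  toFun w := ⟨_, quotMap_mem_component hj w⟩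
  map_add' w w' := Subtype.ext (by
    obtain ⟨K, hK, -, hw⟩ := exists_absorbs hj w
    obtain ⟨K', hK', -, hw'⟩ := exists_absorbs hj w'
    have h := quotMap_add (mapTKK_injective hj) (hK.inf hK') (hw.mono inf_le_left)
      (hw'.mono inf_le_right)
    rw [TKK.mk_add, add_zero, add_zero] at h
    exact h)
  map_smul' c w := Subtype.ext (by
    obtain ⟨K, hK, -, hw⟩ := exists_absorbs hj w
    have h := quotMap_smul (mapTKK_injective hj) hK c hw
    rw [TKK.mk_smul, smul_zero, smul_zero] at h
    exact h)

theorem toQuot_apply [StronglyNondegenerate Φ T] (hj : IsMQuotients j) (x : T) :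
    toQuot hj (j x) = toQmOne Φ T x := by
  refine Subtype.ext ?_
  change quotMap _ _ = _
  rw [← mapTKK_pos hj, quotMap_range]
  rfl

theorem isTripleHom_toQuot [StronglyNondegenerate Φ T] [JordanTripleSystem Φ (QmOne Φ T)]
    (hmul : ∀ x y z : QmOne Φ T, (triple (Φ := Φ) x y z : Qm Φ (TKK Φ T T)) =
      ⁅⁅(x : Qm Φ (TKK Φ T T)), Qm.conj (exchange Φ T) y⁆, (z : Qm Φ (TKK Φ T T))⁆)
    (hj : IsMQuotients j) : IsTripleHom (toQuot hj) := by
  intro x y z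
  refine Subtype.ext ?_
  rw [hmul]
  obtain ⟨K1, hK1, -, hx⟩ := exists_absorbs hj x
  obtain ⟨K2, hK2, -, hy⟩ := exists_absorbs hj y
  obtain ⟨K3, hK3, -, hz⟩ := exists_absorbs hj z
  have hinj := mapTKK_injective hj
  have hy' := hy.conj (mapTKK_exchange hj)
  -- A common essential ideal absorbing $x$, $\tau y$ and $z$; on it the map to $Q_m(L)$ respects
  -- the brackets in $\{x,y,z\}=[[x,\tau y],z]$ computed in $\mathrm{TKK}(V(W))$.
  have hK := (hK1.inf (hK2.comap (exchange Φ T))).inf hK3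
  have hx := hx.mono ((inf_le_left (b := K3)).trans
    (inf_le_left (a := K1) (b := exchangeIdeal K2)))
  have hy'' := hy'.mono ((inf_le_left (b := K3)).trans
    (inf_le_right (a := K1) (b := exchangeIdeal K2)))
  have hz := hz.mono (inf_le_right (a := K1 ⊓ exchangeIdeal K2))
  change quotMap hinj (TKK.mk (triple (Φ := Φ) x y z) 0 0) =
    ⁅⁅quotMap hinj (TKK.mk x 0 0), Qm.conj (exchange Φ T) (quotMap hinj (TKK.mk y 0 0))⁆,
      quotMap hinj (TKK.mk z 0 0)⁆
  rw [← quotMap_conj hinj (mapTKK_exchange hj) hK2 hy, ← quotMap_lie hinj hK hx hy'',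
    ← quotMap_lie hinj hK.lie_self (Absorbs.lie hinj hx hy'') (hz.mono (lie_self_le _)),
    ← lie_lie_mk]
  rfl

/-- A nonzero $w$ in the kernel has a nonzero product in $T$; that product is again in the kernel,
against injectivity on $T$. -/
theorem injective_of_comp {Q : Type*} [AddCommGroup Q] [Module Φ Q] [JordanTripleSystem Φ Q]
    (hj : IsMQuotients j) {f : W →ₗ[Φ] Q} (hf : IsTripleHom f)
    (hfj : Function.Injective (f ∘ₗ j)) : Function.Injective f := by
  refine (injective_iff_map_eq_zero f).mpr fun w hw => ?_
  by_contra hne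
  obtain ⟨I, -, -, habs, a, ha, x, h⟩ := hj.2.2 w hne
  have key : ∀ v ∈ LinearMap.range j, f v = 0 → v = 0 := by
    rintro _ ⟨t, rfl⟩ ht
    rw [hfj (a₁ := t) (a₂ := 0) (by simpa using ht), map_zero]
  obtain ⟨h1, h2, h3⟩ := habs a ha x
  rcases h with h | h | h
  · exact h (key _ h1 (by rw [hf, hw]; simp))
  · exact h (key _ h2 (by rw [hf, hw]; simp))
  · exact h (key _ h3 (by rw [hf, hw]; simp))

/-- The products of $w$ with an absorbing ideal and $T$ lie in $T$, where $f$ and $g$ agree. So that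
ideal annihilates $gw-fw$ in $Q$, which is zero by `IsMQuotients.eq_zero`. -/
theorem eq_of_comp_eq {Q : Type*} [AddCommGroup Q] [Module Φ Q] [JordanTripleSystem Φ Q]
    {ι : T →ₗ[Φ] Q} (hι : IsMQuotients ι) (hj : IsMQuotients j) {f g : W →ₗ[Φ] Q}
    (hf : IsTripleHom f) (hg : IsTripleHom g) (hfj : f ∘ₗ j = ι) (hgj : g ∘ₗ j = ι) : g = f := by
  refine LinearMap.ext fun w => ?_
  rcases eq_or_ne w 0 with rfl | hw
  · rw [map_zero, map_zero]
  obtain ⟨I, hI, hA, habs, -⟩ := hj.2.2 w hw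
  have key : ∀ v ∈ LinearMap.range j, g v = f v := by
    rintro _ ⟨t, rfl⟩
    exact LinearMap.congr_fun (hgj.trans hfj.symm) t
  have ef : ∀ x, f (j x) = ι x := LinearMap.congr_fun hfj
  have eg : ∀ x, g (j x) = ι x := LinearMap.congr_fun hgj
  refine sub_eq_zero.mp (hι.eq_zero hI hA (fun a ha x => ?_) (fun a ha x => ?_) fun a ha x => ?_)
  · have h := key _ (habs a ha x).1
    rw [hg, hf, ef, ef, eg, eg] at h
    rw [map_sub, LinearMap.sub_apply, LinearMap.sub_apply, h, sub_self]
  · have h := key _ (habs a ha x).2.1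
    rw [hg, hf, ef, ef, eg, eg] at h
    rw [map_sub, LinearMap.sub_apply, LinearMap.sub_apply, h, sub_self]
  · have h := key _ (habs a ha x).2.2
    rw [hg, hf, ef, ef, eg, eg] at h
    rw [map_sub, LinearMap.sub_apply, h, sub_self]

end

end JordanTripleSystem

/-- For a strongly nondegenerate Jordan triple system `T` over `Φ ∋ 1/6`, the degree `1` component
of `Q_m(TKK(V(T)))`, with the triple product `{x, y, z} = [[x, τ y], z]` (where `τ` is the map of
`Q_m(TKK(V(T)))` induced by the exchange automorphism of `TKK(V(T))`), is a Jordan triple system,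
and it is the maximal Jordan triple system of `𝔐`-quotients of `T`. -/
theorem mainTheorem9 {Φ : Type u} {T : Type v} [CommRing Φ] [AddCommGroup T] [Module Φ T]
    [JordanTripleSystem Φ T] [JordanTripleSystem.StronglyNondegenerate Φ T]
    (h6 : IsUnit (6 : Φ)) :
    ∃ _ : JordanTripleSystem Φ (JordanTripleSystem.QmOne Φ T),
      (∀ x y z : JordanTripleSystem.QmOne Φ T,
        (JordanTripleSystem.triple (Φ := Φ) x y z : LieQuot.Qm Φ (JordanPair.TKK Φ T T)) =
          ⁅⁅(x : LieQuot.Qm Φ (JordanPair.TKK Φ T T)),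
            LieQuot.Qm.conj (JordanTripleSystem.exchange Φ T) y⁆,
            (z : LieQuot.Qm Φ (JordanPair.TKK Φ T T))⁆) ∧
      JordanTripleSystem.IsMaximalMQuotients.{u, v, v, w}
        (JordanTripleSystem.toQmOne Φ T) := by

  refine ⟨JordanTripleSystem.jordanQmOne h6, fun _ _ _ => rfl, ?_⟩
  let _ := JordanTripleSystem.jordanQmOne (T := T) h6
  have hι := JordanTripleSystem.isMQuotients_toQmOne (T := T) h6 fun _ _ _ => rfl
  refine ⟨hι, fun W _ _ _ j hj => ?_⟩
  have hf := JordanTripleSystem.isTripleHom_toQuot (fun _ _ _ => rfl) hj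
  have hfj : JordanTripleSystem.toQuot hj ∘ₗ j = JordanTripleSystem.toQmOne Φ T :=
    LinearMap.ext (JordanTripleSystem.toQuot_apply hj)
  exact ⟨JordanTripleSystem.toQuot hj, hf,
    JordanTripleSystem.injective_of_comp hj hf (by rw [hfj]; exact hι.1), hfj,
    fun g hg hgj => JordanTripleSystem.eq_of_comp_eq hι hj hf hg hfj hgj⟩
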